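/- A tiling of the plane is a family of polygonal regions that covers the plane and whose distinct members meet only along their boundaries; it is edge to edge if any two distinct tiles that meet have in common exactly one vertex of both or exactly one entire edge of both. A Cairo pentagon (respectively, a Prismatic pentagon) is a convex pentagon of area $1$ that is circumscribed about a circle and has three interior angles equal to $2\pi/3$ and two equal to $\pi/2$, where the two right angles are not adjacent (respectively, are adjacent). (1) There is a tiling of the plane all of whose tiles are Cairo pentagons, and any two such tilings are carried to each other by an isometry of the plane. Every such tiling is edge to edge; moreover each tile has one edge that is strictly shorter than its four other edges, and both endpoints of this edge are vertices of degree $3$ of the tiling, that is, points that lie in exactly three tiles and are vertices of all three. (2) There is an edge-to-edge tiling of the plane all of whose tiles are Prismatic pentagons, and any two such edge-to-edge tilings are carried to each other by an isometry of the plane. -/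

import Mathlib

open scoped EuclideanGeometry

noncomputable section

namespace PentagonTiling

/-- The Euclidean plane. -/
abbrev Plane : Type := EuclideanSpace ℝ (Fin 2)

/-- Pentagons, given by their vertices in cyclic order; `finRotate 5 i` is the index after `i`. -/
abbrev Pentagon : Type := Polygon Plane 5

/-- The pentagon is (strictly) convex: for every edge, the three remaining vertices lie strictly
on one side of the line through that edge. -/
def IsConvex (P : Pentagon) : Prop :=
  ∀ i j k : Fin 5, j ≠ i → j ≠ finRotate 5 i → k ≠ i → k ≠ finRotate 5 i →
    line[ℝ, P i, P (finRotate 5 i)].SSameSide (P j) (P k)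

/-- The closed region bounded by a convex pentagon. -/
def region (P : Pentagon) : Set Plane := convexHull ℝ (Set.range P.vertices)

/-- The length of the `i`-th edge. -/
def edgeLength (P : Pentagon) (i : Fin 5) : ℝ := dist (P i) (P (finRotate 5 i))

/-- The interior angle of a convex pentagon at its `i`-th vertex. -/
def interiorAngle (P : Pentagon) (i : Fin 5) : ℝ :=
  ∠ (P ((finRotate 5).symm i)) (P i) (P (finRotate 5 i))

/-- The pentagon is circumscribed about a circle: every edge touches one and the same circle. -/
def IsCircumscribed (P : Pentagon) : Prop :=
  ∃ s : EuclideanGeometry.Sphere Plane, 0 < s.radius ∧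
    ∀ i, ∃ p ∈ P.edgeSet ℝ i, s.IsTangentAt p line[ℝ, P i, P (finRotate 5 i)]

/-- Cairo pentagons: convex, of unit area, circumscribed about a circle, with three angles `2π/3`
and two right angles, the right angles not adjacent. -/
def IsCairo (P : Pentagon) : Prop :=
  IsConvex P ∧ MeasureTheory.volume (region P) = 1 ∧ IsCircumscribed P ∧
    ∀ i, interiorAngle P i =
      ![2 * Real.pi / 3, 2 * Real.pi / 3, Real.pi / 2, 2 * Real.pi / 3, Real.pi / 2] i

/-- Prismatic pentagons: convex, of unit area, circumscribed about a circle, with three angles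
`2π/3` and two right angles, the right angles adjacent. -/
def IsPrismatic (P : Pentagon) : Prop :=
  IsConvex P ∧ MeasureTheory.volume (region P) = 1 ∧ IsCircumscribed P ∧
    ∀ i, interiorAngle P i =
      ![2 * Real.pi / 3, 2 * Real.pi / 3, 2 * Real.pi / 3, Real.pi / 2, Real.pi / 2] i

/-- `𝒯` is a tiling of the plane by pentagons of the kind `K`: its members are regions of such
pentagons, they cover the plane, and distinct ones meet only along their boundaries. -/
def IsTilingBy (K : Pentagon → Prop) (𝒯 : Set (Set Plane)) : Prop :=
  (∀ T ∈ 𝒯, ∃ P, K P ∧ region P = T) ∧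
    ⋃₀ 𝒯 = Set.univ ∧
    𝒯.Pairwise fun S T => S ∩ T ⊆ frontier S ∩ frontier T

/-- A tiling by convex pentagons is edge to edge: two distinct tiles that meet have in common
either exactly a vertex of both or exactly an entire edge of both. -/
def IsEdgeToEdge (𝒯 : Set (Set Plane)) : Prop :=
  ∀ P Q : Pentagon, IsConvex P → IsConvex Q → region P ∈ 𝒯 → region Q ∈ 𝒯 →
    region P ≠ region Q →
      region P ∩ region Q = ∅ ∨
      (∃ i j, region P ∩ region Q = {P i} ∧ P i = Q j) ∨
      (∃ i j, region P ∩ region Q = P.edgeSet ℝ i ∧ P.edgeSet ℝ i = Q.edgeSet ℝ j)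

/-- Exactly `n` tiles of `𝒯` contain the point `p`, and `p` is a vertex of each of them. -/
def IsVertexOfDegree (𝒯 : Set (Set Plane)) (p : Plane) (n : ℕ) : Prop :=
  {T ∈ 𝒯 | p ∈ T}.encard = n ∧
    ∀ P : Pentagon, IsConvex P → region P ∈ 𝒯 → p ∈ region P → ∃ i, P i = p

/-- The `i`-th edge is strictly shorter than the four others. -/
def IsShortEdge (P : Pentagon) (i : Fin 5) : Prop :=
  ∀ j, j ≠ i → edgeLength P i < edgeLength P j

/-- Two tilings are the same up to an isometry of the plane. -/
def AreCongruent (𝒯 𝒯' : Set (Set Plane)) : Prop :=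
  ∃ g : Plane ≃ᵃⁱ[ℝ] Plane, 𝒯' = (fun T => g '' T) '' 𝒯

end PentagonTiling

end

open PentagonTiling

/-! The proof has three ingredients: rigidity of the pentagon, a local analysis that forces every
neighbour of a tile, and a global description of the resulting arrangement as a Voronoi diagram.

Rigidity: the angles of a circumscribed pentagon fix its edge directions up to a rotation, and all
edge lines have the same distance from the incentre, so the pentagon is determined up to similarity
(`Shape.recognise`); unit area fixes the scale. Both pentagons are mirror symmetric, so reflected
copies have the same regions as direct ones (`Shape.Model.exists_place`). A tiling therefore becomes
a tiling of `ℂ` by sets `S.tile c u`, with incentre `c` and rotation `u`.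

Local analysis: a flag records a tile having a given point on its boundary, together with the
direction of the edge there. Turning counterclockwise leads from flag to flag (`next_vertex`,
`next_edge`), and sectors of different tiles do not overlap (`not_inside`). As all angles are `π/2`
or `2π/3`, an angle `2π/3` is surrounded by exactly three of its kind (`three_around`). For Cairo
pentagons the only short edge joins two angles `2π/3`, so edges match at such corners without any
edge-to-edge assumption (`clockwise`); for Prismatic pentagons matching comes from the hypothesis
(`VertexCond.len_eq`). Comparing edge lengths around a vertex determines its three corners, except
that for Cairo pentagons three apexes might meet; `cairo_not_three_three` excludes this. Hence all
five neighbours of any tile are prescribed (`cairo_neighbour`, `prism_neighbour`).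

Global description: the orbit of the base tile under these neighbour steps is a group of motions,
and the incentre of a neighbour is the mirror image of the incentre in the common edge. So each edge
line is a perpendicular bisector. An explicit list of the centres within twice the circumradius
(`cairo_near`, `prism_near`) shows that the tiles are exactly the Voronoi cells of the centres
(`Orbit.mem_tile_iff`). This gives existence (`isTiling_tilingAt`), uniqueness (`eq_tilingAt`), the
edge-to-edge property (`Orbit.inter_cases`) and, at vertices closer to the incentre than the
circumradius, degree three (`isVertexOfDegree_three`). -/

namespace PentagonTiling

open Complex Filter Topology Set
open scoped ComplexConjugate

/-! ### The cross product of complex numbers -/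

/-- The cross product of two plane vectors. -/
def cross (a b : ℂ) : ℝ := a.re * b.im - a.im * b.re

lemma cross_add (a b c : ℂ) : cross a (b + c) = cross a b + cross a c := by
  simp only [cross, add_re, add_im]; ring

lemma cross_sub (a b c : ℂ) : cross a (b - c) = cross a b - cross a c := by
  simp only [cross, sub_re, sub_im]; ring

lemma cross_neg (a b : ℂ) : cross a (-b) = -cross a b := by
  simp only [cross, neg_re, neg_im]; ring

lemma cross_real_mul (a b : ℂ) (x : ℝ) : cross a (x * b) = x * cross a b := by
  simp only [cross, re_ofReal_mul, im_ofReal_mul]; ring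

lemma real_mul_cross (a b : ℂ) (x : ℝ) : cross (x * a) b = x * cross a b := by
  simp only [cross, re_ofReal_mul, im_ofReal_mul]; ring

lemma cross_self (a : ℂ) : cross a a = 0 := by
  simp only [cross]; ring

lemma cross_zero (a : ℂ) : cross a 0 = 0 := by
  simp [cross]

lemma cross_swap (a b : ℂ) : cross a b = -cross b a := by
  simp only [cross]; ring

lemma cross_mul_mul (u a b : ℂ) : cross (u * a) (u * b) = ‖u‖ ^ 2 * cross a b := by
  rw [← Complex.normSq_eq_norm_sq]
  simp only [cross, mul_re, mul_im, normSq_apply]; ring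

lemma cross_unit_mul {u : ℂ} (hu : ‖u‖ = 1) (a b : ℂ) : cross (u * a) (u * b) = cross a b := by
  rw [cross_mul_mul, hu]; ring

lemma cross_I_mul_self {a : ℂ} (ha : ‖a‖ = 1) : cross a (I * a) = 1 := by
  have : ‖a‖ ^ 2 = 1 := by rw [ha]; norm_num
  rw [← Complex.normSq_eq_norm_sq, normSq_apply] at this
  simp only [cross, mul_re, mul_im, I_re, I_im]; linarith

lemma cross_le_norm (a b : ℂ) : |cross a b| ≤ ‖a‖ * ‖b‖ := by
  apply abs_le_of_sq_le_sq _ (by positivity)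
  rw [mul_pow, ← Complex.normSq_eq_norm_sq, ← Complex.normSq_eq_norm_sq, normSq_apply,
    normSq_apply, cross]
  nlinarith [sq_nonneg (a.re * b.re + a.im * b.im)]

lemma mul_conj_unit {u : ℂ} (hu : ‖u‖ = 1) : u * conj u = 1 := by
  rw [Complex.mul_conj, Complex.normSq_eq_norm_sq, hu]; simp

lemma conj_mul_unit {u : ℂ} (hu : ‖u‖ = 1) : conj u * u = 1 := by
  rw [mul_comm, mul_conj_unit hu]

lemma continuous_cross (a : ℂ) : Continuous (cross a) := by
  unfold cross; fun_prop

/-- A vector parallel to a unit vector is a real multiple of it. -/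
lemma eq_real_mul_of_cross_eq_zero {a b : ℂ} (ha : ‖a‖ = 1) (h : cross a b = 0) :
    b = (cross b (I * a) : ℝ) * a := by
  have h1 : a.re * a.re + a.im * a.im = 1 := by
    rw [← normSq_apply, Complex.normSq_eq_norm_sq, ha]; norm_num
  simp only [cross] at h
  apply Complex.ext
  · rw [re_ofReal_mul]
    simp only [cross, mul_re, mul_im, I_re, I_im]
    linear_combination (-b.re) * h1 - a.im * h
  · rw [im_ofReal_mul]
    simp only [cross, mul_re, mul_im, I_re, I_im]
    linear_combination (-b.im) * h1 + a.re * h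

/-- Vectors are determined by their cross products with two independent ones. -/
lemma eq_of_cross_eq {a b x y : ℂ} (hab : cross a b ≠ 0) (h1 : cross a x = cross a y)
    (h2 : cross b x = cross b y) : x = y := by
  simp only [cross] at *
  apply Complex.ext
  · apply mul_left_cancel₀ hab
    linear_combination b.re * h1 - a.re * h2
  · apply mul_left_cancel₀ hab
    linear_combination b.im * h1 - a.im * h2

/-- Divided by `D`, the three cross products are the barycentric coordinates of `z` with respect to
`A`, `B`, `C`. -/
lemma mem_of_mem_triangle {s : Set ℂ} (hs : Convex ℝ s) {A B C z : ℂ} (hA : A ∈ s) (hB : B ∈ s)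
    (hC : C ∈ s) (hD : 0 < cross (B - A) (C - A)) (h0 : 0 ≤ cross (C - B) (z - B))
    (h1 : 0 ≤ cross (A - C) (z - C)) (h2 : 0 ≤ cross (B - A) (z - A)) : z ∈ s := by
  set D := cross (B - A) (C - A) with hDdef
  have hsum : cross (C - B) (z - B) + cross (A - C) (z - C) + cross (B - A) (z - A) = D := by
    simp only [hDdef, cross, sub_re, sub_im]; ring
  have hz : z = (cross (C - B) (z - B) / D) • A + (cross (A - C) (z - C) / D) • B
      + (cross (B - A) (z - A) / D) • C := by
    have hD' := hD.ne'
    apply Complex.ext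
    · simp only [add_re, real_smul, re_ofReal_mul]
      field_simp
      simp only [hDdef, cross, sub_re, sub_im]; ring
    · simp only [add_im, real_smul, im_ofReal_mul]
      field_simp
      simp only [hDdef, cross, sub_re, sub_im]; ring
  rw [hz]
  have := hs.sum_mem (t := (Finset.univ : Finset (Fin 3)))
    (w := ![cross (C - B) (z - B) / D, cross (A - C) (z - C) / D, cross (B - A) (z - A) / D])
    (z := ![A, B, C]) ?_ ?_ ?_
  · simpa [Fin.sum_univ_three] using this
  · intro i _; fin_cases i <;> simp <;> positivity
  · simp only [Fin.sum_univ_three, Matrix.cons_val]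
    rw [← add_div, ← add_div, hsum, div_self hD.ne']
  · intro i _; fin_cases i <;> simp [hA, hB, hC]

/-! ### Circumscribed pentagons about the origin -/

/-- A convex pentagon circumscribed about a circle centred at the origin: the vertices `v` in
counterclockwise order, the unit edge directions `f`, the edge lengths and the inradius. -/
structure Shape where
  v : Fin 5 → ℂ
  f : Fin 5 → ℂ
  len : Fin 5 → ℝ
  rad : ℝ
  rad_pos : 0 < rad
  norm_f : ∀ k, ‖f k‖ = 1
  len_pos : ∀ k, 0 < len k
  v_succ : ∀ k, v (k + 1) = v k + len k * f k
  turn : ∀ k, 0 < cross (f k) (f (k + 1))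
  cross_v : ∀ k, cross (f k) (v k) = -rad
  conv : ∀ k j, j ≠ k → j ≠ k + 1 → -rad < cross (f k) (v j)

namespace Shape

variable (S : Shape)

/-- The copy of the pentagon with incentre `c`, rotated by the unit `u`. -/
def tile (c u : ℂ) : Set ℂ := {z | ∀ k, -S.rad ≤ cross (u * S.f k) (z - c)}

lemma cross_v_succ (k : Fin 5) : cross (S.f k) (S.v (k + 1)) = -S.rad := by
  rw [S.v_succ, cross_add, cross_real_mul, cross_self, S.cross_v]; ring

lemma le_cross_v (k j : Fin 5) : -S.rad ≤ cross (S.f k) (S.v j) := by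
  by_cases h1 : j = k
  · rw [h1, S.cross_v]
  by_cases h2 : j = k + 1
  · rw [h2, S.cross_v_succ]
  exact (S.conv k j h1 h2).le

lemma turn' (k : Fin 5) : 0 < cross (S.f (k - 1)) (S.f k) := by
  simpa using S.turn (k - 1)

lemma cross_edge_self (k : Fin 5) (s : ℝ) : cross (S.f k) (S.v k + s * S.f k) = -S.rad := by
  rw [cross_add, cross_real_mul, cross_self, S.cross_v]; ring

lemma cross_edge_pred (k : Fin 5) (s : ℝ) :
    cross (S.f (k - 1)) (S.v k + s * S.f k) = -S.rad + s * cross (S.f (k - 1)) (S.f k) := by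
  have := S.cross_v_succ (k - 1)
  rw [sub_add_cancel] at this
  rw [cross_add, cross_real_mul, this]

lemma cross_edge_eq (j k : Fin 5) (s : ℝ) : cross (S.f j) (S.v k + s * S.f k) =
    (1 - s / S.len k) * cross (S.f j) (S.v k) + s / S.len k * cross (S.f j) (S.v (k + 1)) := by
  have := (S.len_pos k).ne'
  rw [S.v_succ, cross_add, cross_add, cross_real_mul, cross_real_mul]
  field_simp
  ring

lemma lt_cross_edge {j k : Fin 5} (h1 : j ≠ k) (h2 : j ≠ k - 1) {s : ℝ} (hs : 0 ≤ s)
    (hs' : s < S.len k) : -S.rad < cross (S.f j) (S.v k + s * S.f k) := by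
  have hl := S.len_pos k
  have h0 : s / S.len k < 1 := (div_lt_one hl).2 hs'
  have h00 : 0 ≤ s / S.len k := by positivity
  have a1 := S.conv j k h1.symm (by rintro rfl; simp at h2)
  have a2 := S.le_cross_v j (k + 1)
  rw [cross_edge_eq]
  nlinarith

lemma le_cross_edge (j k : Fin 5) {s : ℝ} (hs : 0 ≤ s)
    (hs' : s ≤ S.len k) : -S.rad ≤ cross (S.f j) (S.v k + s * S.f k) := by
  have hl := S.len_pos k
  have h0 : s / S.len k ≤ 1 := (div_le_one hl).2 hs'
  have h00 : 0 ≤ s / S.len k := by positivity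
  have a1 := S.le_cross_v j k
  have a2 := S.le_cross_v j (k + 1)
  rw [cross_edge_eq]
  nlinarith

variable {S} {c u : ℂ}

lemma cross_tile (hu : ‖u‖ = 1) (j : Fin 5) (z w : ℂ) :
    cross (u * S.f j) (z - c) = cross (u * S.f j) (z - (c + u * w)) + cross (S.f j) w := by
  rw [← cross_unit_mul hu (S.f j) w, ← cross_add]; congr 1; ring

lemma vertex_add_mem_tile (hu : ‖u‖ = 1) (k : Fin 5) {s : ℝ} (hs : 0 ≤ s) (hs' : s ≤ S.len k) :
    c + u * (S.v k + s * S.f k) ∈ S.tile c u := by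
  intro j
  rw [cross_tile hu j _ (S.v k + s * S.f k), sub_self, cross_zero, zero_add]
  exact S.le_cross_edge j k hs hs'

lemma vertex_mem_tile (hu : ‖u‖ = 1) (k : Fin 5) : c + u * S.v k ∈ S.tile c u := by
  simpa using vertex_add_mem_tile (c := c) hu k le_rfl (S.len_pos k).le

lemma convex_tile : Convex ℝ (S.tile c u) := by
  intro x hx y hy a b ha hb hab k
  have h1 := hx k
  have h2 := hy k
  have : cross (u * S.f k) (a • x + b • y - c)
      = a * cross (u * S.f k) (x - c) + b * cross (u * S.f k) (y - c) := by
    rw [← cross_real_mul, ← cross_real_mul, ← cross_add]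
    congr 1
    have : (a : ℂ) + b = 1 := by exact_mod_cast hab
    simp only [real_smul]
    linear_combination c * this
  rw [this]
  have h3 : a * S.rad + b * S.rad = S.rad := by rw [← add_mul, hab, one_mul]
  linarith [mul_le_mul_of_nonneg_left h1 ha, mul_le_mul_of_nonneg_left h2 hb]

lemma mem_interior_tile_of_lt {z : ℂ} (h : ∀ k, -S.rad < cross (u * S.f k) (z - c)) :
    z ∈ interior (S.tile c u) := by
  rw [mem_interior]
  refine ⟨{z | ∀ k, -S.rad < cross (u * S.f k) (z - c)}, fun z hz k => (hz k).le, ?_, h⟩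
  simp only [ofPred_forall]
  exact isOpen_iInter_of_finite fun k => isOpen_lt continuous_const
    ((continuous_cross _).comp (continuous_id.sub continuous_const))

lemma lt_of_mem_interior_tile (hu : ‖u‖ = 1) {z : ℂ} (h : z ∈ interior (S.tile c u)) (k : Fin 5) :
    -S.rad < cross (u * S.f k) (z - c) := by
  -- `-(I * (u * S.f k))` is the outward normal of edge `k`; a small step along it stays in the
  -- tile, so the constraint of this edge has room to spare at `z`.
  have ht : Tendsto (fun x : ℝ => z - x * (I * (u * S.f k))) (𝓝[>] 0) (𝓝 z) := by
    have : Continuous (fun x : ℝ => z - x * (I * (u * S.f k))) := by fun_prop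
    simpa using (this.tendsto 0).mono_left nhdsWithin_le_nhds
  have := ht.eventually (mem_interior_iff_mem_nhds.1 h)
  obtain ⟨x, hx, hx0⟩ := (this.and self_mem_nhdsWithin).exists
  have h1 := hx k
  have h2 : z - x * (I * (u * S.f k)) - c = (z - c) - x * (I * (u * S.f k)) := by ring
  rw [h2, cross_sub, cross_real_mul,
    cross_I_mul_self (by rw [norm_mul, hu, S.norm_f, one_mul])] at h1
  have : 0 < x := hx0
  linarith

lemma ball_subset_interior_tile (hu : ‖u‖ = 1) : Metric.ball c S.rad ⊆ interior (S.tile c u) := by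
  intro z hz
  apply mem_interior_tile_of_lt
  intro k
  have h := cross_le_norm (u * S.f k) (z - c)
  rw [norm_mul, hu, S.norm_f, one_mul, one_mul] at h
  rw [Metric.mem_ball, dist_eq_norm] at hz
  have := (abs_le.1 h).1
  linarith

/-- Links the two descriptions of the pentagon: `region` is a convex hull, whereas the local
arguments use the half-planes of the edges. -/
lemma convexHull_eq_tile : convexHull ℝ (range S.v) = S.tile 0 1 := by
  apply Subset.antisymm
  · apply convexHull_min _ convex_tile
    rintro _ ⟨k, rfl⟩
    simpa using vertex_mem_tile (S := S) (c := 0) (u := 1) (by simp) k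
  · intro z hz
    have hz' : ∀ k, -S.rad ≤ cross (S.f k) z := fun k => by simpa using hz k
    have hm : ∀ k, S.v k ∈ convexHull ℝ (range S.v) := fun k => subset_convexHull _ _ ⟨k, rfl⟩
    have he : ∀ k w, cross (S.v (k + 1) - S.v k) (w - S.v k)
        = S.len k * (cross (S.f k) w + S.rad) := by
      intro k w
      rw [S.v_succ, add_sub_cancel_left, real_mul_cross, cross_sub, S.cross_v]; ring
    have hp : ∀ k, 0 ≤ cross (S.v (k + 1) - S.v k) (z - S.v k) := by
      intro k
      rw [he]
      exact mul_nonneg (S.len_pos k).le (by linarith [hz' k])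
    have hq : ∀ k j, j ≠ k → j ≠ k + 1 → 0 < cross (S.v (k + 1) - S.v k) (S.v j - S.v k) := by
      intro k j h1 h2
      rw [he]
      exact mul_pos (S.len_pos k) (by linarith [S.conv k j h1 h2])
    have hc := convex_convexHull ℝ (range S.v)
    have flip : ∀ x y z : ℂ, cross (x - y) (z - y) = -cross (y - x) (z - x) := by
      intro x y z; simp only [cross, sub_re, sub_im]; ring
    have cyc : ∀ x y z : ℂ, cross (x - y) (z - y) = cross (z - x) (y - x) := by
      intro x y z; simp only [cross, sub_re, sub_im]; ring
    -- The diagonals from vertex `0` cut the pentagon into a fan of three triangles; the sides of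
    -- these diagonals on which `z` lies tell which triangle contains it.
    rcases le_total (cross (S.v 2 - S.v 0) (z - S.v 0)) 0 with ha | ha
    · refine mem_of_mem_triangle hc (hm 0) (hm 1) (hm 2) (hq 0 2 (by decide) (by decide)) (hp 1)
        ?_ (hp 0)
      rw [flip]; linarith
    rcases le_total (cross (S.v 3 - S.v 0) (z - S.v 0)) 0 with hb | hb
    · refine mem_of_mem_triangle hc (hm 0) (hm 2) (hm 3) ?_ (hp 2) ?_ ha
      · rw [cyc]; exact hq 2 0 (by decide) (by decide)
      · rw [flip]; linarith
    · refine mem_of_mem_triangle hc (hm 0) (hm 3) (hm 4) ?_ (hp 3) (hp 4) hb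
      rw [cyc]; exact hq 3 0 (by decide) (by decide)

lemma tile_eq_image (hu : ‖u‖ = 1) : S.tile c u = (fun z => c + u * z) '' S.tile 0 1 := by
  ext z
  constructor
  · intro hz
    refine ⟨conj u * (z - c), fun k => ?_, ?_⟩
    · rw [one_mul, sub_zero, ← cross_unit_mul hu, ← mul_assoc, mul_conj_unit hu, one_mul]
      exact hz k
    · simp only
      rw [← mul_assoc, mul_conj_unit hu]; ring
  · rintro ⟨w, hw, rfl⟩ k
    simp only [add_sub_cancel_left]
    rw [cross_unit_mul hu]
    simpa using hw k

lemma norm_le_of_mem {R : ℝ} (hR : ∀ k, ‖S.v k‖ ≤ R) {z : ℂ} (hz : z ∈ S.tile 0 1) : ‖z‖ ≤ R := by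
  rw [← convexHull_eq_tile] at hz
  have : convexHull ℝ (range S.v) ⊆ Metric.closedBall 0 R := by
    apply convexHull_min _ (convex_closedBall _ _)
    rintro _ ⟨k, rfl⟩
    simpa using hR k
  simpa using this hz

lemma exists_dist_le (S : Shape) :
    ∃ R, ∀ c u z : ℂ, ‖u‖ = 1 → z ∈ S.tile c u → ‖z - c‖ ≤ R := by
  refine ⟨∑ k, ‖S.v k‖, fun c u z hu hz => ?_⟩
  rw [tile_eq_image hu] at hz
  obtain ⟨w, hw, rfl⟩ := hz
  simp only [add_sub_cancel_left, norm_mul, hu, one_mul]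
  exact norm_le_of_mem
    (fun k => Finset.single_le_sum (f := fun k => ‖S.v k‖) (fun _ _ => norm_nonneg _)
      (Finset.mem_univ k)) hw

/-- Motion from `p` in a direction pointing strictly inwards from all edges through `p`. -/
lemma eventually_mem_interior {p w : ℂ}
    (h : ∀ j, -S.rad < cross (u * S.f j) (p - c) ∨
      (-S.rad = cross (u * S.f j) (p - c) ∧ 0 < cross (u * S.f j) w)) :
    ∀ᶠ x : ℝ in 𝓝[>] 0, p + x * w ∈ interior (S.tile c u) := by
  have : ∀ j, ∀ᶠ x : ℝ in 𝓝[>] 0, -S.rad < cross (u * S.f j) (p + x * w - c) := by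
    intro j
    have he : ∀ x : ℝ, cross (u * S.f j) (p + x * w - c)
        = cross (u * S.f j) (p - c) + x * cross (u * S.f j) w := by
      intro x
      rw [← cross_real_mul, ← cross_add]; congr 1; ring
    simp only [he]
    rcases h j with h | ⟨h1, h2⟩
    · have hc : Continuous fun x : ℝ => cross (u * S.f j) (p - c) + x * cross (u * S.f j) w := by
        fun_prop
      have := hc.tendsto 0
      simp only [zero_mul, add_zero] at this
      exact (this.mono_left nhdsWithin_le_nhds).eventually (lt_mem_nhds h)
    · filter_upwards [self_mem_nhdsWithin] with x hx
      have := mul_pos hx h2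
      linarith
  filter_upwards [eventually_all.2 this] with x hx using mem_interior_tile_of_lt hx

end Shape

end PentagonTiling

namespace PentagonTiling

open Complex Filter Topology Set
open scoped ComplexConjugate

/-! ### Tilings by copies of a pentagon, and their flags -/

/-- `𝒮` is a tiling of the complex plane by direct copies of the pentagon `S`. -/
structure Shape.IsTiling (S : Shape) (𝒮 : Set (Set ℂ)) : Prop where
  tiles : ∀ X ∈ 𝒮, ∃ c u, ‖u‖ = 1 ∧ X = S.tile c u
  cover : ∀ z, ∃ X ∈ 𝒮, z ∈ X
  sep : ∀ X ∈ 𝒮, ∀ Y ∈ 𝒮, ∀ z ∈ X, z ∈ interior Y → X = Y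

/-- The point `p` lies on the edge `k` of some tile, at distance `s` from the start of that edge
and before its end, and the edge points in the direction `e`. -/
def Shape.Flag (S : Shape) (𝒮 : Set (Set ℂ)) (p e : ℂ) (k : Fin 5) (s : ℝ) : Prop :=
  ∃ c u, ‖u‖ = 1 ∧ S.tile c u ∈ 𝒮 ∧ u * S.f k = e ∧ c + u * (S.v k + s * S.f k) = p ∧
    0 ≤ s ∧ s < S.len k

/-- The unit number whose argument is the interior angle at the vertex `k`. -/
def Shape.q (S : Shape) (k : Fin 5) : ℂ := -(S.f (k - 1) * conj (S.f k))

namespace Shape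

variable {S : Shape} {𝒮 : Set (Set ℂ)} {p e : ℂ} {k : Fin 5} {s : ℝ}

lemma f_mul_q (S : Shape) (k : Fin 5) : S.f k * S.q k = -S.f (k - 1) := by
  rw [q]
  linear_combination (-S.f (k - 1)) * mul_conj_unit (S.norm_f k)

lemma norm_q (S : Shape) (k : Fin 5) : ‖S.q k‖ = 1 := by
  rw [q, norm_neg, norm_mul, RCLike.norm_conj, S.norm_f, S.norm_f, one_mul]

/-- Incentres of different tiles are at least two inradii apart, since otherwise their midpoint
would be interior to both tiles. As the tiles have bounded diameter, the tiling is locally finite.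
-/
lemma IsTiling.finite_meeting (h : S.IsTiling 𝒮) (p : ℂ) (M : ℝ) :
    {X ∈ 𝒮 | ∃ z ∈ X, ‖z - p‖ ≤ M}.Finite := by
  classical
  choose! cen rot hrot htile using h.tiles
  obtain ⟨R, hR⟩ := S.exists_dist_le
  have key : ∀ X ∈ 𝒮, ∀ Y ∈ 𝒮, dist (cen X) (cen Y) < 2 * S.rad → X = Y := by
    intro X hX Y hY hd
    have h1 : dist (midpoint ℝ (cen X) (cen Y)) (cen X) < S.rad := by
      rw [dist_midpoint_left]; norm_num; linarith
    have h2 : dist (midpoint ℝ (cen X) (cen Y)) (cen Y) < S.rad := by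
      rw [dist_midpoint_right]; norm_num; linarith
    refine h.sep X hX Y hY (midpoint ℝ (cen X) (cen Y)) ?_ ?_
    · have i1 := interior_subset (ball_subset_interior_tile (S := S) (hrot X hX) h1)
      rwa [← htile X hX] at i1
    · have i2 := ball_subset_interior_tile (S := S) (hrot Y hY) h2
      rwa [← htile Y hY] at i2
  have hpair : (cen '' 𝒮).Pairwise fun x y => 2 * S.rad ≤ dist x y := by
    rintro _ ⟨X, hX, rfl⟩ _ ⟨Y, hY, rfl⟩ hne
    by_contra hlt
    exact hne (by rw [key X hX Y hY (not_le.1 hlt)])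
  have hpos : 0 < 2 * S.rad := by linarith [S.rad_pos]
  have hdisc : IsDiscrete (cen '' 𝒮) := by
    refine ⟨DiscreteTopology.of_forall_le_dist hpos ?_⟩
    intro x y hxy
    exact hpair x.2 y.2 (fun hh => hxy (Subtype.ext hh))
  have hfin := Metric.finite_isBounded_inter_isClosed hdisc
    (Metric.isBounded_closedBall (x := p) (r := M + R))
    (Metric.isClosed_of_pairwise_le_dist hpos hpair)
  apply Set.Finite.of_finite_image (f := cen)
  · apply hfin.subset
    rintro _ ⟨X, ⟨hX, z, hz, hzp⟩, rfl⟩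
    refine ⟨?_, X, hX, rfl⟩
    rw [Metric.mem_closedBall, dist_eq_norm]
    have h1 := hR (cen X) (rot X) z (hrot X hX) (by rw [← htile X hX]; exact hz)
    calc ‖cen X - p‖ = ‖(z - p) - (z - cen X)‖ := by congr 1; ring
      _ ≤ ‖z - p‖ + ‖z - cen X‖ := norm_sub_le _ _
      _ ≤ M + R := by linarith
  · intro X hX Y hY hXY
    exact key X hX.1 Y hY.1 (by rw [hXY, dist_self]; exact hpos)

/-- Lexicographic sign of the coefficients, used to probe a tile along a parabola that is tangent to
a ray. -/
lemma nonneg_of_frequently {a b d : ℝ} (h : ∃ᶠ x : ℝ in 𝓝[>] 0, 0 ≤ a + x * b + x ^ 2 * d) :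
    0 ≤ a ∧ (a = 0 → 0 ≤ b ∧ (b = 0 → 0 ≤ d)) := by
  have lim : ∀ y z : ℝ, 0 ≤ y ∨ ∀ᶠ x : ℝ in 𝓝[>] 0, y + x * z < 0 := by
    intro y z
    rcases le_or_gt 0 y with hy | hy
    · exact Or.inl hy
    · right
      have hc : Continuous fun x : ℝ => y + x * z := by fun_prop
      have := (hc.tendsto 0).mono_left (nhdsWithin_le_nhds (s := Ioi 0))
      simp only [zero_mul, add_zero] at this
      exact this.eventually (gt_mem_nhds hy)
  have lim2 : ∀ y z t : ℝ, 0 ≤ y ∨ ∀ᶠ x : ℝ in 𝓝[>] 0, y + x * z + x ^ 2 * t < 0 := by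
    intro y z t
    rcases le_or_gt 0 y with hy | hy
    · exact Or.inl hy
    · right
      have hc : Continuous fun x : ℝ => y + x * z + x ^ 2 * t := by fun_prop
      have := (hc.tendsto 0).mono_left (nhdsWithin_le_nhds (s := Ioi 0))
      simp only [zero_mul, add_zero, ne_eq, OfNat.ofNat_ne_zero, not_false_eq_true, zero_pow]
        at this
      exact this.eventually (gt_mem_nhds hy)
  refine ⟨?_, fun ha => ⟨?_, fun hb => ?_⟩⟩
  · rcases lim2 a b d with h1 | h1
    · exact h1
    · obtain ⟨x, hx, hx'⟩ := (h.and_eventually h1).exists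
      linarith
  · rcases lim b d with h1 | h1
    · exact h1
    · obtain ⟨x, hx, hx', hx0⟩ := (h.and_eventually (h1.and self_mem_nhdsWithin)).exists
      have hx0 : 0 < x := hx0
      have := mul_neg_of_pos_of_neg hx0 hx'
      rw [ha] at hx
      nlinarith
  · obtain ⟨x, hx, hx0⟩ := (h.and_eventually self_mem_nhdsWithin).exists
    have hx0 : 0 < x := hx0
    rw [ha, hb] at hx
    by_contra hd
    have := mul_neg_of_pos_of_neg (pow_pos hx0 2) (not_le.1 hd)
    linarith

/-- If the direction `E` at `p` runs along the boundary of a tile, then some tile has an edge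
through `p` in the direction `E` which does not end at `p`. -/
lemma IsTiling.exists_flag_of_boundary (h : S.IsTiling 𝒮) {X : Set ℂ} (hX : X ∈ 𝒮) {E : ℂ}
    (hE : ‖E‖ = 1) (hb : ∀ᶠ x : ℝ in 𝓝[>] 0, p + x * E ∈ X ∧ p + x * E ∉ interior X) :
    ∃ k s, S.Flag 𝒮 p E k s := by
  have hfin := h.finite_meeting p 2
  -- The probe points leave the ray to the left only at second order. Finitely many tiles come near
  -- `p`, so one of them contains such points arbitrarily close to `p`: it is the tile just to the
  -- left of the ray.
  have hex : ∃ Y ∈ 𝒮, ∃ᶠ x : ℝ in 𝓝[>] 0, p + x * E + x ^ 2 * (I * E) ∈ Y := by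
    by_contra hcon
    push Not at hcon
    have h1 : ∀ᶠ x : ℝ in 𝓝[>] 0, ∀ Y ∈ {X ∈ 𝒮 | ∃ z ∈ X, ‖z - p‖ ≤ 2},
        p + x * E + x ^ 2 * (I * E) ∉ Y := by
      rw [hfin.eventually_all]
      intro Y hY
      simpa [Filter.Frequently] using hcon Y hY.1
    have h2 : ∀ᶠ x : ℝ in 𝓝[>] 0, x < 1 :=
      mem_nhdsWithin_of_mem_nhds (gt_mem_nhds one_pos)
    obtain ⟨x, hx, hx1, hx0⟩ := (h1.and (h2.and self_mem_nhdsWithin)).exists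
    have hx0 : 0 < x := hx0
    obtain ⟨Y, hY, hzY⟩ := h.cover (p + x * E + x ^ 2 * (I * E))
    refine hx Y ⟨hY, _, hzY, ?_⟩ hzY
    have : p + x * E + x ^ 2 * (I * E) - p = x * E + x ^ 2 * (I * E) := by ring
    rw [this]
    refine (norm_add_le _ _).trans ?_
    rw [norm_mul, norm_mul, norm_mul, hE, norm_pow, Complex.norm_real, Complex.norm_I,
      Real.norm_of_nonneg hx0.le]
    nlinarith
  obtain ⟨Y, hY, hfreq⟩ := hex
  obtain ⟨c, u, hu, rfl⟩ := h.tiles Y hY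
  have hnf : ∀ j, ‖u * S.f j‖ = 1 := fun j => by rw [norm_mul, hu, S.norm_f, one_mul]
  have hj : ∀ j, 0 ≤ cross (u * S.f j) (p - c) + S.rad ∧
      (cross (u * S.f j) (p - c) + S.rad = 0 → 0 ≤ cross (u * S.f j) E ∧
        (cross (u * S.f j) E = 0 → 0 ≤ cross (u * S.f j) (I * E))) := by
    intro j
    apply nonneg_of_frequently
    refine hfreq.mono fun x hx => ?_
    have h1 := hx j
    have h2 : p + x * E + x ^ 2 * (I * E) - c
        = (p - c) + (x : ℝ) * E + (x ^ 2 : ℝ) * (I * E) := by push_cast; ring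
    rw [h2, cross_add, cross_add, cross_real_mul, cross_real_mul] at h1
    linarith
  -- If every constraint active at `p` strictly increased along `E`, the ray would start inside `Y`.
  -- Then `X` would equal `Y`, although the ray avoids the interior of `X`.
  obtain ⟨j, hj1, hj2⟩ : ∃ j, cross (u * S.f j) (p - c) + S.rad = 0 ∧ cross (u * S.f j) E = 0 := by
    by_contra hcon
    push Not at hcon
    have hint : ∀ᶠ x : ℝ in 𝓝[>] 0, p + x * E ∈ interior (S.tile c u) := by
      apply eventually_mem_interior
      intro j
      rcases (hj j).1.eq_or_lt with h0 | h0
      · right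
        exact ⟨by linarith, lt_of_le_of_ne ((hj j).2 h0.symm).1 (hcon j h0.symm).symm⟩
      · left; linarith
    obtain ⟨x, hx, hx1, hx2⟩ := (hint.and hb).exists
    have := h.sep X hX _ hY _ hx1 hx
    rw [this] at hx2
    exact hx2 hx
  -- The quadratic term of the probe rules out the opposite direction `-E`.
  have hje : u * S.f j = E := by
    have h1 := ((hj j).2 hj1).2 hj2
    have h2 := eq_real_mul_of_cross_eq_zero (hnf j) hj2
    set t := cross E (I * (u * S.f j))
    have h3 : |t| = 1 := by
      have := congrArg norm h2
      rw [norm_mul, hE, hnf, Complex.norm_real, Real.norm_eq_abs, mul_one] at this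
      exact this.symm
    rw [h2, mul_left_comm, cross_real_mul, cross_I_mul_self (hnf j), mul_one] at h1
    rw [abs_of_nonneg h1] at h3
    rw [h3] at h2
    rw [h2]; simp
  obtain ⟨s, hs⟩ : ∃ s : ℝ, p = c + u * (S.v j + s * S.f j) := by
    have h1 : cross (u * S.f j) (p - (c + u * S.v j)) = 0 := by
      have := cross_tile (c := c) (S := S) hu j p (S.v j)
      rw [S.cross_v] at this
      linarith
    have h2 := eq_real_mul_of_cross_eq_zero (hnf j) h1
    refine ⟨cross (p - (c + u * S.v j)) (I * (u * S.f j)), ?_⟩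
    rw [mul_add, mul_left_comm, ← add_assoc, ← h2]; ring
  have hcr : ∀ i, cross (u * S.f i) (p - c) = cross (S.f i) (S.v j + s * S.f j) := by
    intro i
    rw [cross_tile hu i p (S.v j + s * S.f j), ← hs, sub_self, cross_zero, zero_add]
  refine ⟨j, s, c, u, hu, hY, hje, hs.symm, ?_, ?_⟩
  · have h1 := (hj (j - 1)).1
    rw [hcr, cross_edge_pred] at h1
    have h2 := S.turn' j
    by_contra h3
    nlinarith
  -- At the end of the edge the constraint of the next edge would be active and decreasing along
  -- `E`, so `p` lies strictly before the end.
  · have h1 := hj (j + 1)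
    have h2 := S.turn j
    have h3 : cross (S.f (j + 1)) (S.v j + s * S.f j) + S.rad
        = (S.len j - s) * cross (S.f j) (S.f (j + 1)) := by
      have h4 := S.cross_v (j + 1)
      rw [S.v_succ, cross_add, cross_real_mul] at h4
      rw [cross_add, cross_real_mul, cross_swap (S.f j)]
      linarith
    rw [hcr, h3, ← hje, cross_unit_mul hu, cross_swap (S.f (j + 1))] at h1
    rcases lt_trichotomy s (S.len j) with h5 | h5 | h5
    · exact h5
    · have := (h1.2 (by rw [h5]; ring)).1
      linarith
    · have := h1.1
      nlinarith

lemma Flag.norm_eq_one (hF : S.Flag 𝒮 p e k s) : ‖e‖ = 1 := by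
  obtain ⟨c, u, hu, -, rfl, -⟩ := hF
  rw [norm_mul, hu, S.norm_f, one_mul]

/-- The next tile counterclockwise at a vertex. -/
lemma IsTiling.next_vertex (h : S.IsTiling 𝒮) (hF : S.Flag 𝒮 p e k 0) :
    ∃ k' s', S.Flag 𝒮 p (e * S.q k) k' s' := by
  have he := hF.norm_eq_one
  obtain ⟨c, u, hu, hX, rfl, rfl, -, -⟩ := hF
  apply h.exists_flag_of_boundary hX (by rw [norm_mul, he, S.norm_q, one_mul])
  have hl := S.len_pos (k - 1)
  have h2 : ∀ᶠ x : ℝ in 𝓝[>] 0, x < S.len (k - 1) :=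
    mem_nhdsWithin_of_mem_nhds (gt_mem_nhds hl)
  filter_upwards [h2, self_mem_nhdsWithin] with x hx hx0
  have hx0 : 0 < x := hx0
  have hv := S.v_succ (k - 1)
  rw [sub_add_cancel] at hv
  have heq : c + u * (S.v k + (0 : ℝ) * S.f k) + x * (u * S.f k * S.q k)
      = c + u * (S.v (k - 1) + (S.len (k - 1) - x : ℝ) * S.f (k - 1)) := by
    rw [mul_assoc u, f_mul_q, hv]; push_cast; ring
  rw [heq]
  refine ⟨vertex_add_mem_tile hu _ (by linarith) (by linarith), fun hi => ?_⟩
  have := lt_of_mem_interior_tile hu hi (k - 1)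
  rw [cross_tile hu _ _ (S.v (k - 1) + (S.len (k - 1) - x : ℝ) * S.f (k - 1)), sub_self,
    cross_zero, zero_add, cross_edge_self] at this
  exact lt_irrefl _ this

/-- The next tile counterclockwise at a point in the interior of an edge. -/
lemma IsTiling.next_edge (h : S.IsTiling 𝒮) (hF : S.Flag 𝒮 p e k s) (hs : 0 < s) :
    ∃ k' s', S.Flag 𝒮 p (-e) k' s' := by
  have he := hF.norm_eq_one
  obtain ⟨c, u, hu, hX, rfl, rfl, -, hs'⟩ := hF
  apply h.exists_flag_of_boundary hX (by rw [norm_neg, he])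
  have h2 : ∀ᶠ x : ℝ in 𝓝[>] 0, x < s :=
    mem_nhdsWithin_of_mem_nhds (gt_mem_nhds hs)
  filter_upwards [h2, self_mem_nhdsWithin] with x hx hx0
  have hx0 : 0 < x := hx0
  have heq : c + u * (S.v k + s * S.f k) + x * (-(u * S.f k))
      = c + u * (S.v k + (s - x : ℝ) * S.f k) := by
    push_cast; ring
  rw [heq]
  refine ⟨vertex_add_mem_tile hu _ (by linarith) (by linarith), fun hi => ?_⟩
  have := lt_of_mem_interior_tile hu hi k
  rw [cross_tile hu _ _ (S.v k + (s - x : ℝ) * S.f k), sub_self,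
    cross_zero, zero_add, cross_edge_self] at this
  exact lt_irrefl _ this

lemma cross_flag_pred {u : ℂ} (w : ℂ) :
    cross (u * S.f (k - 1)) w = cross w (u * S.f k * S.q k) := by
  rw [mul_assoc, f_mul_q, mul_neg, cross_neg, ← cross_swap]

/-- Near the point of a flag the tile contains the sector spanned by the flag. -/
lemma eventually_mem_interior_of_flag {c u w : ℂ} (hu : ‖u‖ = 1)
    (hp : c + u * (S.v k + s * S.f k) = p) (hs : 0 ≤ s) (hs' : s < S.len k)
    (h1 : 0 < cross (u * S.f k) w) (h2 : s = 0 → 0 < cross w (u * S.f k * S.q k)) :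
    ∀ᶠ x : ℝ in 𝓝[>] 0, p + x * w ∈ interior (S.tile c u) := by
  apply eventually_mem_interior
  intro j
  rw [cross_tile hu j p (S.v k + s * S.f k), hp, sub_self, cross_zero, zero_add]
  by_cases hjk : j = k
  · right
    rw [hjk, cross_edge_self]
    exact ⟨rfl, h1⟩
  by_cases hjk' : j = k - 1
  · rw [hjk', cross_edge_pred]
    rcases hs.eq_or_lt with h0 | h0
    · right
      rw [← h0, zero_mul, add_zero, cross_flag_pred]
      exact ⟨rfl, h2 h0.symm⟩
    · left
      have := mul_pos h0 (S.turn' k)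
      linarith
  · left
    exact S.lt_cross_edge hjk hjk' hs hs'

lemma cross_f_mul_q_pos (hu : ‖e‖ = 1) : 0 < cross e (e * S.q k) := by
  have h1 := S.turn' k
  have h2 : cross (1 : ℂ) (S.q k) = cross (S.f (k - 1)) (S.f k) := by
    rw [← cross_unit_mul (S.norm_f k), f_mul_q, mul_one, cross_neg, ← cross_swap]
  have := cross_unit_mul hu 1 (S.q k)
  rw [mul_one] at this
  rw [this, h2]; exact h1

/-- Flags whose sectors overlap belong to the same tile. -/
lemma IsTiling.tile_eq_of_overlap (h : S.IsTiling 𝒮) {c u c₁ u₁ : ℂ} {k₁ : Fin 5} {s₁ : ℝ}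
    (hu : ‖u‖ = 1) (hX : S.tile c u ∈ 𝒮)
    (hp : c + u * (S.v k + s * S.f k) = p) (hs : 0 ≤ s) (hs' : s < S.len k)
    (hu₁ : ‖u₁‖ = 1) (hX₁ : S.tile c₁ u₁ ∈ 𝒮)
    (hp₁ : c₁ + u₁ * (S.v k₁ + s₁ * S.f k₁) = p) (hs₁ : 0 ≤ s₁) (hs₁' : s₁ < S.len k₁)
    (h1 : 0 < cross (u * S.f k) (u₁ * S.f k₁) ∨ u * S.f k = u₁ * S.f k₁)
    (h2 : s = 0 → 0 < cross (u₁ * S.f k₁) (u * S.f k * S.q k)) :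
    S.tile c u = S.tile c₁ u₁ := by
  set e₁ := u₁ * S.f k₁ with he₁
  have hn₁ : ‖e₁‖ = 1 := by rw [he₁, norm_mul, hu₁, S.norm_f, one_mul]
  have ev : ∀ a b : ℝ, 0 < a → ∀ᶠ y : ℝ in 𝓝[>] 0, 0 < a + y * b := by
    intro a b ha
    have hc : Continuous fun y : ℝ => a + y * b := by fun_prop
    have := (hc.tendsto 0).mono_left (nhdsWithin_le_nhds (s := Ioi 0))
    simp only [zero_mul, add_zero] at this
    exact this.eventually (lt_mem_nhds ha)
  -- Directions slightly counterclockwise of `e₁` lie inside both sectors, so both tiles contain a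
  -- common interior point near `p`.
  have e1 : ∀ᶠ y : ℝ in 𝓝[>] 0, 0 < cross (u * S.f k) (e₁ + y * (I * e₁)) := by
    simp only [cross_add, cross_real_mul]
    rcases h1 with h1 | h1
    · exact ev _ _ h1
    · filter_upwards [self_mem_nhdsWithin] with y hy
      have hy : 0 < y := hy
      rw [h1, cross_self, cross_I_mul_self hn₁]; linarith
  have swap : ∀ (y : ℝ) (w : ℂ), cross (e₁ + y * (I * e₁)) w
      = cross e₁ w + y * cross (I * e₁) w := by
    intro y w
    rw [cross_swap, cross_add, cross_real_mul, cross_swap w, cross_swap w]; ring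
  have e2 : ∀ᶠ y : ℝ in 𝓝[>] 0,
      s = 0 → 0 < cross (e₁ + y * (I * e₁)) (u * S.f k * S.q k) := by
    by_cases hs0 : s = 0
    · simp only [swap]
      filter_upwards [ev _ _ (h2 hs0)] with y hy _ using hy
    · exact Eventually.of_forall fun y h => absurd h hs0
  have e3 : ∀ᶠ y : ℝ in 𝓝[>] 0, 0 < cross e₁ (e₁ + y * (I * e₁)) := by
    filter_upwards [self_mem_nhdsWithin] with y hy
    have hy : 0 < y := hy
    rw [cross_add, cross_self, cross_real_mul, cross_I_mul_self hn₁]; linarith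
  have e4 : ∀ᶠ y : ℝ in 𝓝[>] 0, s₁ = 0 → 0 < cross (e₁ + y * (I * e₁)) (e₁ * S.q k₁) := by
    simp only [swap]
    filter_upwards [ev _ (cross (I * e₁) (e₁ * S.q k₁)) (cross_f_mul_q_pos (k := k₁) hn₁)]
      with y hy _ using hy
  obtain ⟨y, y1, y2, y3, y4⟩ := (e1.and (e2.and (e3.and e4))).exists
  have i1 := eventually_mem_interior_of_flag hu hp hs hs' y1 y2
  have i2 := eventually_mem_interior_of_flag hu₁ hp₁ hs₁ hs₁' y3 y4
  obtain ⟨x, x1, x2⟩ := (i1.and i2).exists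
  exact h.sep _ hX _ hX₁ _ (interior_subset x1) x2

/-- No flag points strictly inside the sector of another flag at the same point. -/
lemma IsTiling.not_inside (h : S.IsTiling 𝒮) {e₁ : ℂ} {k₁ : Fin 5} {s₁ : ℝ}
    (hF : S.Flag 𝒮 p e k s) (hF₁ : S.Flag 𝒮 p e₁ k₁ s₁) (h1 : 0 < cross e e₁)
    (h2 : s = 0 → 0 < cross e₁ (e * S.q k)) : False := by
  obtain ⟨c, u, hu, hX, rfl, hp, hs, hs'⟩ := hF
  obtain ⟨c₁, u₁, hu₁, hX₁, rfl, hp₁, hs₁, hs₁'⟩ := hF₁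
  -- The two tiles coincide; but the ray along `e₁` starts in the interior of the first and runs on
  -- the boundary line of an edge of the second.
  have := h.tile_eq_of_overlap hu hX hp hs hs' hu₁ hX₁ hp₁ hs₁ hs₁' (Or.inl h1) h2
  have i1 := eventually_mem_interior_of_flag hu hp hs hs' h1 h2
  obtain ⟨x, hx⟩ := i1.exists
  rw [this] at hx
  have h3 := lt_of_mem_interior_tile hu₁ hx k₁
  rw [cross_tile hu₁ _ _ (S.v k₁ + s₁ * S.f k₁), hp₁, add_sub_cancel_left, cross_real_mul,
    cross_self, cross_edge_self] at h3
  linarith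

lemma add_mem_tile_iff_edge {c u : ℂ} (hu : ‖u‖ = 1) (hp : c + u * (S.v k + s * S.f k) = p)
    (x : ℝ) : p + x * (u * S.f k) ∈ S.tile c u ↔ 0 ≤ s + x ∧ s + x ≤ S.len k := by
  have heq : p + x * (u * S.f k) = c + u * (S.v k + (s + x : ℝ) * S.f k) := by
    rw [← hp]; push_cast; ring
  rw [heq]
  constructor
  · intro hm
    constructor
    · have h1 := hm (k - 1)
      rw [cross_tile hu _ _ (S.v k + (s + x : ℝ) * S.f k), sub_self, cross_zero, zero_add,
        cross_edge_pred] at h1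
      have h2 := S.turn' k
      by_contra h3
      nlinarith
    · have h1 := hm (k + 1)
      have h4 := S.cross_v (k + 1)
      rw [S.v_succ, cross_add, cross_real_mul] at h4
      rw [cross_tile hu _ _ (S.v k + (s + x : ℝ) * S.f k), sub_self, cross_zero, zero_add,
        cross_add, cross_real_mul] at h1
      have h2 := S.turn k
      rw [cross_swap] at h2
      by_contra h3
      nlinarith
  · rintro ⟨h1, h2⟩
    exact vertex_add_mem_tile hu _ h1 h2

lemma vertex_eq_edge_end {c u : ℂ} (k : Fin 5) : c + u * (S.v k + (0 : ℝ) * S.f k) =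
    c + u * (S.v (k - 1) + (S.len (k - 1) : ℝ) * S.f (k - 1)) := by
  have hv := S.v_succ (k - 1)
  rw [sub_add_cancel] at hv
  rw [hv]; simp

/-- Flags at the same point in the same direction have the same data. -/
lemma IsTiling.flag_unique (h : S.IsTiling 𝒮) {k₁ : Fin 5} {s₁ : ℝ}
    (hF : S.Flag 𝒮 p e k s) (hF₁ : S.Flag 𝒮 p e k₁ s₁) :
    s = s₁ ∧ S.len k = S.len k₁ ∧ (s = 0 → S.q k = S.q k₁ ∧ S.len (k - 1) = S.len (k₁ - 1)) := by
  have he := hF.norm_eq_one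
  obtain ⟨c, u, hu, hX, rfl, hp, hs, hs'⟩ := hF
  obtain ⟨c₁, u₁, hu₁, hX₁, hee, hp₁, hs₁, hs₁'⟩ := hF₁
  have hT := h.tile_eq_of_overlap hu hX hp hs hs' hu₁ hX₁ hp₁ hs₁ hs₁' (Or.inr hee.symm)
    (fun _ => by rw [hee]; exact cross_f_mul_q_pos he)
  have A := add_mem_tile_iff_edge hu hp
  have A₁ := add_mem_tile_iff_edge hu₁ hp₁
  rw [hee, ← hT] at A₁
  have B : ∀ x : ℝ, (0 ≤ s + x ∧ s + x ≤ S.len k) ↔ (0 ≤ s₁ + x ∧ s₁ + x ≤ S.len k₁) :=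
    fun x => (A x).symm.trans (A₁ x)
  -- Both offsets and both lengths are read off from the interval of those `x` for which `p + x * e`
  -- lies in the common tile.
  have hss : s = s₁ := by
    have b1 := (B (-s)).1 ⟨by linarith, by linarith⟩
    have b2 := (B (-s₁)).2 ⟨by linarith, by linarith⟩
    linarith [b1.1, b2.1]
  subst hss
  have hll : S.len k = S.len k₁ := by
    have b1 := (B (S.len k - s)).1 ⟨by linarith, by linarith⟩
    have b2 := (B (S.len k₁ - s)).2 ⟨by linarith, by linarith⟩
    linarith [b1.2, b2.2]
  refine ⟨rfl, hll, ?_⟩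
  rintro rfl
  have hq : S.q k = S.q k₁ := by
    -- The start of the edge preceding one flag lies in the tile of the other, so neither angle
    -- exceeds the other.
    have side : ∀ (c u c₁ u₁ : ℂ) (k k₁ : Fin 5), ‖u‖ = 1 → ‖u₁‖ = 1 →
        c + u * (S.v k + (0 : ℝ) * S.f k) = p → c₁ + u₁ * (S.v k₁ + (0 : ℝ) * S.f k₁) = p →
        u₁ * S.f k₁ = u * S.f k → S.tile c u = S.tile c₁ u₁ →
        0 ≤ cross (S.q k) (-S.q k₁) := by
      intro c u c₁ u₁ k k₁ hu hu₁ hp hp₁ hee hT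
      have hm := vertex_add_mem_tile (c := c₁) (S := S) hu₁ (k₁ - 1) le_rfl (S.len_pos _).le
      rw [← hT] at hm
      have h1 := hm (k - 1)
      have hv := S.v_succ (k₁ - 1)
      rw [sub_add_cancel] at hv
      have hw : c₁ + u₁ * (S.v (k₁ - 1) + (0 : ℝ) * S.f (k₁ - 1))
          = p + (S.len (k₁ - 1)) * (u * S.f k * S.q k₁) := by
        rw [← hee, mul_assoc u₁, f_mul_q, ← hp₁, hv]; push_cast; ring
      rw [hw, cross_tile hu _ _ (S.v k + (0 : ℝ) * S.f k), hp, cross_edge_pred,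
        add_sub_cancel_left, cross_real_mul, cross_flag_pred] at h1
      have h2 := S.len_pos (k₁ - 1)
      rw [cross_unit_mul (by rw [norm_mul, hu, S.norm_f, one_mul]), cross_swap] at h1
      rw [cross_neg]
      by_contra h3
      nlinarith
    have s1 := side c u c₁ u₁ k k₁ hu hu₁ hp hp₁ hee hT
    have s2 := side c₁ u₁ c u k₁ k hu₁ hu hp₁ hp hee.symm hT.symm
    rw [cross_neg] at s1 s2
    rw [cross_swap] at s2
    have hz : cross (S.q k) (S.q k₁) = 0 := by linarith
    have h2 := eq_real_mul_of_cross_eq_zero (S.norm_q k) hz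
    set t := cross (S.q k₁) (I * S.q k)
    have h3 : |t| = 1 := by
      have := congrArg norm h2
      rw [norm_mul, S.norm_q, S.norm_q, Complex.norm_real, Real.norm_eq_abs, mul_one] at this
      exact this.symm
    have p1 : 0 < cross 1 (1 * S.q k) := cross_f_mul_q_pos (by simp)
    have p2 : 0 < cross 1 (1 * S.q k₁) := cross_f_mul_q_pos (by simp)
    rw [one_mul] at p1 p2
    rw [h2, cross_real_mul] at p2
    have : 0 < t := pos_of_mul_pos_left p2 p1.le
    rw [abs_of_pos this] at h3
    rw [h2, h3]; simp
  refine ⟨hq, ?_⟩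
  have C := add_mem_tile_iff_edge hu ((vertex_eq_edge_end k).symm.trans hp)
  have C₁ := add_mem_tile_iff_edge hu₁ ((vertex_eq_edge_end k₁).symm.trans hp₁)
  have hd : u₁ * S.f (k₁ - 1) = u * S.f (k - 1) := by
    have h1 := S.f_mul_q k
    have h2 := S.f_mul_q k₁
    rw [hq] at h1
    linear_combination u₁ * h2 - u * h1 - S.q k₁ * hee
  rw [hd, ← hT] at C₁
  have b1 := ((C (-S.len (k - 1))).symm.trans (C₁ _)).1
    ⟨by linarith, by linarith [S.len_pos (k - 1)]⟩
  have b2 := ((C (-S.len (k₁ - 1))).symm.trans (C₁ _)).2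
    ⟨by linarith, by linarith [S.len_pos (k₁ - 1)]⟩
  linarith [b1.1, b2.1]

/-- The flag at the next vertex of the same tile. -/
lemma Flag.succ (hF : S.Flag 𝒮 p e k s) :
    S.Flag 𝒮 (p + (S.len k - s : ℝ) * e) (-(e * conj (S.q (k + 1)))) (k + 1) 0 := by
  obtain ⟨c, u, hu, hX, rfl, rfl, hs, hs'⟩ := hF
  refine ⟨c, u, hu, hX, ?_, ?_, le_rfl, S.len_pos _⟩
  · have h1 := S.f_mul_q (k + 1)
    rw [add_sub_cancel_right] at h1
    have h2 := mul_conj_unit (S.norm_q (k + 1))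
    linear_combination (-u * S.f (k + 1)) * h2 + u * conj (S.q (k + 1)) * h1
  · rw [S.v_succ]; push_cast; ring

/-- The flag at the previous vertex of the same tile. -/
lemma Flag.pred (hF : S.Flag 𝒮 p e k 0) :
    S.Flag 𝒮 (p + S.len (k - 1) * (e * S.q k)) (-(e * S.q k)) (k - 1) 0 := by
  obtain ⟨c, u, hu, hX, rfl, rfl, hs, hs'⟩ := hF
  refine ⟨c, u, hu, hX, ?_, ?_, le_rfl, S.len_pos _⟩
  · rw [mul_assoc u, f_mul_q]; ring
  · have hv := S.v_succ (k - 1)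
    rw [sub_add_cancel] at hv
    rw [mul_assoc u, f_mul_q, hv]; push_cast; ring

/-- The flag at another point of the same edge. -/
lemma Flag.slide (hF : S.Flag 𝒮 p e k s) {x : ℝ} (h0 : 0 ≤ s + x) (h1 : s + x < S.len k) :
    S.Flag 𝒮 (p + x * e) e k (s + x) := by
  obtain ⟨c, u, hu, hX, rfl, rfl, hs, hs'⟩ := hF
  exact ⟨c, u, hu, hX, rfl, by push_cast; ring, h0, h1⟩

end Shape

end PentagonTiling

namespace PentagonTiling

open Complex Filter Topology Set
open scoped ComplexConjugate

/-! ### The Cairo and Prismatic pentagons -/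

/-- The primitive cube root of unity in the upper half plane. -/
noncomputable def om : ℂ := ⟨-1 / 2, √3 / 2⟩

lemma sqrt_three_sq : √3 * √3 = 3 := Real.mul_self_sqrt (by norm_num)

lemma sqrt_three_pos : 0 < √3 := by positivity

lemma one_lt_sqrt_three : 1 < √3 := by
  nlinarith [sqrt_three_sq, sqrt_three_pos]

lemma om_mul_om : om * om = conj om := by
  apply Complex.ext <;> simp [om] <;> nlinarith [sqrt_three_sq]

lemma om_mul_conj : om * conj om = 1 := by
  apply Complex.ext <;> simp [om] <;> nlinarith [sqrt_three_sq]

lemma conj_mul_conj : conj om * conj om = om := by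
  rw [← map_mul, om_mul_om, conj_conj]

lemma I_ne_om : I ≠ om := by
  intro h
  have := congrArg Complex.re h
  norm_num [om] at this

lemma norm_eq_one_of_sq {z : ℂ} (h : z.re * z.re + z.im * z.im = 1) : ‖z‖ = 1 := by
  rw [← Complex.normSq_apply, Complex.normSq_eq_norm_sq] at h
  exact (pow_eq_one_iff_of_nonneg (norm_nonneg z) two_ne_zero).1 h

lemma forall_fin_five {P : Fin 5 → Prop} (h0 : P 0) (h1 : P 1) (h2 : P 2) (h3 : P 3) (h4 : P 4) :
    ∀ k, P k := by
  intro k; fin_cases k <;> assumption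

/-- The vertices of the Cairo pentagon of inradius `√3`. -/
noncomputable def cairoV : Fin 5 → ℂ :=
  ![⟨√3, -1⟩, ⟨√3, 1⟩, ⟨(√3 - 3) / 2, (3 + √3) / 2⟩, ⟨-2, 0⟩, ⟨(√3 - 3) / 2, -(3 + √3) / 2⟩]

/-- The edge directions of the Cairo pentagon. -/
noncomputable def cairoF : Fin 5 → ℂ :=
  ![⟨0, 1⟩, ⟨-√3 / 2, 1 / 2⟩, ⟨-1 / 2, -√3 / 2⟩, ⟨1 / 2, -√3 / 2⟩, ⟨√3 / 2, 1 / 2⟩]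

/-- The Cairo pentagon of inradius `√3`. -/
noncomputable def cairo : Shape where
  v := cairoV
  f := cairoF
  len := ![2, 1 + √3, 1 + √3, 1 + √3, 1 + √3]
  rad := √3
  rad_pos := sqrt_three_pos
  norm_f := by
    refine forall_fin_five ?_ ?_ ?_ ?_ ?_ <;> apply norm_eq_one_of_sq <;>
      simp [cairoF] <;> nlinarith [sqrt_three_sq]
  len_pos := by
    refine forall_fin_five ?_ ?_ ?_ ?_ ?_ <;> simp <;> positivity
  v_succ := by
    refine forall_fin_five ?_ ?_ ?_ ?_ ?_ <;> apply Complex.ext <;>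
      simp [cairoV, cairoF] <;> nlinarith [sqrt_three_sq]
  turn := by
    refine forall_fin_five ?_ ?_ ?_ ?_ ?_ <;>
      simp [cairoF, cross] <;> nlinarith [sqrt_three_sq, sqrt_three_pos]
  cross_v := by
    refine forall_fin_five ?_ ?_ ?_ ?_ ?_ <;>
      simp [cairoV, cairoF, cross] <;> nlinarith [sqrt_three_sq]
  conv := by
    have h1 := sqrt_three_sq
    have h2 := one_lt_sqrt_three
    refine forall_fin_five ?_ ?_ ?_ ?_ ?_ <;> refine forall_fin_five ?_ ?_ ?_ ?_ ?_ <;>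
      simp [cairoV, cairoF, cross] <;> nlinarith

/-- The vertices of the Prismatic pentagon of inradius `√3`. -/
noncomputable def prismV : Fin 5 → ℂ :=
  ![⟨1, -√3⟩, ⟨2, 0⟩, ⟨1, √3⟩, ⟨-√3, √3⟩, ⟨-√3, -√3⟩]

/-- The edge directions of the Prismatic pentagon. -/
noncomputable def prismF : Fin 5 → ℂ :=
  ![⟨1 / 2, √3 / 2⟩, ⟨-1 / 2, √3 / 2⟩, ⟨-1, 0⟩, ⟨0, -1⟩, ⟨1, 0⟩]

/-- The Prismatic pentagon of inradius `√3`. -/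
noncomputable def prism : Shape where
  v := prismV
  f := prismF
  len := ![2, 2, 1 + √3, 2 * √3, 1 + √3]
  rad := √3
  rad_pos := sqrt_three_pos
  norm_f := by
    refine forall_fin_five ?_ ?_ ?_ ?_ ?_ <;> apply norm_eq_one_of_sq <;>
      simp [prismF] <;> nlinarith [sqrt_three_sq]
  len_pos := by
    refine forall_fin_five ?_ ?_ ?_ ?_ ?_ <;> simp <;> positivity
  v_succ := by
    refine forall_fin_five ?_ ?_ ?_ ?_ ?_ <;> apply Complex.ext <;>
      simp [prismV, prismF] <;> nlinarith [sqrt_three_sq]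
  turn := by
    refine forall_fin_five ?_ ?_ ?_ ?_ ?_ <;>
      simp [prismF, cross] <;> nlinarith [sqrt_three_sq, sqrt_three_pos]
  cross_v := by
    refine forall_fin_five ?_ ?_ ?_ ?_ ?_ <;>
      simp [prismV, prismF, cross] <;> nlinarith [sqrt_three_sq]
  conv := by
    have h1 := sqrt_three_sq
    have h2 := one_lt_sqrt_three
    refine forall_fin_five ?_ ?_ ?_ ?_ ?_ <;> refine forall_fin_five ?_ ?_ ?_ ?_ ?_ <;>
      simp [prismV, prismF, cross] <;> nlinarith

lemma cairo_q : cairo.q = ![om, om, I, om, I] := by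
  funext k
  revert k
  refine forall_fin_five ?_ ?_ ?_ ?_ ?_ <;> apply Complex.ext <;>
    simp [Shape.q, cairo, cairoF, om, show (0 : Fin 5) - 1 = 4 from rfl,
      show (2 : Fin 5) - 1 = 1 from rfl, show (3 : Fin 5) - 1 = 2 from rfl,
      show (4 : Fin 5) - 1 = 3 from rfl] <;> nlinarith [sqrt_three_sq]

lemma prism_q : prism.q = ![om, om, om, I, I] := by
  funext k
  revert k
  refine forall_fin_five ?_ ?_ ?_ ?_ ?_ <;> apply Complex.ext <;>
    simp [Shape.q, prism, prismF, om, show (0 : Fin 5) - 1 = 4 from rfl,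
      show (2 : Fin 5) - 1 = 1 from rfl, show (3 : Fin 5) - 1 = 2 from rfl,
      show (4 : Fin 5) - 1 = 3 from rfl] <;> nlinarith [sqrt_three_sq]

end PentagonTiling

namespace PentagonTiling

open Complex Filter Topology Set
open scoped ComplexConjugate

/-! ### The tiles around a vertex -/

namespace Shape

variable {S : Shape} {𝒮 : Set (Set ℂ)} {p e a : ℂ} {k k₁ : Fin 5} {s s₁ : ℝ}

/-- All angles of the pentagon are right angles or angles of `2π/3`. -/
def AngleCond (S : Shape) : Prop := ∀ k, S.q k = I ∨ S.q k = om

/-- Less than a right angle is left from `e * a` counterclockwise to `e`, and every angle of the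
pentagon is at least a right angle, so the tile at `e * a` would swallow the ray along `e`. -/
lemma IsTiling.no_flag_before (h : S.IsTiling 𝒮) (hq : S.AngleCond) (hF : S.Flag 𝒮 p e k s)
    (hF₁ : S.Flag 𝒮 p (e * a) k₁ s₁) (him : a.im < 0) (hre : 0 < a.re) : False := by
  have he := hF.norm_eq_one
  have hc : ∀ b, cross e (e * a * b) = cross 1 (a * b) := by
    intro b
    have := cross_unit_mul he 1 (a * b)
    rwa [mul_one, ← mul_assoc] at this
  refine h.not_inside hF₁ hF ?_ fun _ => ?_
  · have := cross_unit_mul he a 1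
    rw [mul_one] at this
    rw [this]
    simp only [cross, one_re, one_im]; linarith
  · rw [hc]
    rcases hq k₁ with h1 | h1 <;> rw [h1]
    · simpa [cross] using hre
    · have := sqrt_three_pos
      simp [cross, om]
      nlinarith [mul_pos this hre]

/-- The analogue for a straight angle: less than `π` is left before `e`. -/
lemma IsTiling.no_edge_before (h : S.IsTiling 𝒮) (hF : S.Flag 𝒮 p e k s)
    (hF₁ : S.Flag 𝒮 p (e * a) k₁ s₁) (hs₁ : s₁ ≠ 0) (him : a.im < 0) : False := by
  have he := hF.norm_eq_one
  refine h.not_inside hF₁ hF ?_ fun h0 => absurd h0 hs₁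
  have := cross_unit_mul he a 1
  rw [mul_one] at this
  rw [this]
  simp only [cross, one_re, one_im]; linarith

lemma Flag.offset_nonneg (hF : S.Flag 𝒮 p e k s) : 0 ≤ s := by
  obtain ⟨c, u, -, -, -, -, hs, -⟩ := hF
  exact hs

/-- Around a vertex with an angle `2π/3` there are exactly three such angles. -/
lemma IsTiling.three_around (h : S.IsTiling 𝒮) (hq : S.AngleCond) (hF : S.Flag 𝒮 p e k 0)
    (hk : S.q k = om) :
    (∃ k₁, S.q k₁ = om ∧ S.Flag 𝒮 p (e * om) k₁ 0) ∧
      (∃ k₂, S.q k₂ = om ∧ S.Flag 𝒮 p (e * conj om) k₂ 0) := by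
  have h3 := sqrt_three_pos
  obtain ⟨k₁, s₁, F₁⟩ := h.next_vertex hF
  rw [hk] at F₁
  -- A straight angle following `2π/3` would leave only `π/3`.
  have hs₁ : s₁ = 0 := by
    by_contra hs
    obtain ⟨k₂, s₂, F₂⟩ := h.next_edge F₁ (lt_of_le_of_ne F₁.offset_nonneg (Ne.symm hs))
    rw [← mul_neg] at F₂
    exact h.no_flag_before hq hF F₂ (by simp [om]) (by norm_num [om])
  subst hs₁
  obtain ⟨k₂, s₂, F₂⟩ := h.next_vertex F₁
  rw [mul_assoc] at F₂
  have hs₂ : s₂ = 0 := by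
    by_contra hs
    refine h.no_edge_before hF F₂ hs ?_
    rcases hq k₁ with h1 | h1 <;> rw [h1]
    · norm_num [om]
    · rw [om_mul_om]; simp [om]
  subst hs₂
  obtain ⟨k₃, s₃, F₃⟩ := h.next_vertex F₂
  rw [mul_assoc] at F₃
  -- A second angle `π/2` leaves `5π/6`, and a third angle would then leave `π/3` or `π/6`. A second
  -- angle `2π/3` leaves `2π/3`, where a right angle would leave `π/6`.
  rcases hq k₁ with h1 | h1
  · exfalso
    rw [h1] at F₃
    rcases hq k₂ with h2 | h2 <;> rw [h2] at F₃
    · exact h.no_flag_before hq hF F₃ (by simp [om]) (by norm_num [om])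
    · refine h.no_flag_before hq hF F₃ ?_ ?_
      · simp [om]; nlinarith [sqrt_three_sq]
      · simp [om]; nlinarith [sqrt_three_sq]
  · rw [h1, om_mul_om] at F₂ F₃
    refine ⟨⟨k₁, h1, F₁⟩, k₂, ?_, F₂⟩
    rcases hq k₂ with h2 | h2
    · exfalso
      rw [h2] at F₃
      exact h.no_flag_before hq hF F₃ (by norm_num [om]) (by norm_num [om])
    · exact h2

/-- If edges that are not of maximal length join angles `2π/3`, then edges match at such angles. -/
lemma IsTiling.clockwise (h : S.IsTiling 𝒮) (hq : S.AngleCond)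
    (hlen : ∀ i j, S.len i < S.len j → S.q i = om ∧ S.q (i + 1) = om) (hF : S.Flag 𝒮 p e k 0)
    (hk : S.q k = om) :
    ∃ k₂, S.q k₂ = om ∧ S.Flag 𝒮 p (e * conj om) k₂ 0 ∧ S.len (k₂ - 1) = S.len k := by
  have he := hF.norm_eq_one
  obtain ⟨-, k₂, hk₂, F₂⟩ := h.three_around hq hF hk
  refine ⟨k₂, hk₂, F₂, ?_⟩
  have P₂ := F₂.pred
  rw [hk₂, mul_assoc, mul_comm (conj om), om_mul_conj, mul_one] at P₂
  -- If the lengths differ, the far end of the shorter edge is a corner `2π/3` in the interior of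
  -- the longer edge. Such a corner is surrounded by three corners, which leaves no place for a
  -- straight angle.
  rcases lt_trichotomy (S.len (k₂ - 1)) (S.len k) with hlt | heq | hlt
  · exfalso
    obtain ⟨-, j, hj, Fj⟩ := h.three_around hq P₂ (hlen _ _ hlt).1
    have hx := S.len_pos (k₂ - 1)
    have Fs := hF.slide (x := S.len (k₂ - 1)) (by linarith) (by linarith)
    refine h.not_inside Fs Fj ?_ (fun h0 => by linarith)
    have := cross_unit_mul he 1 (-conj om)
    rw [mul_one, mul_neg] at this
    rw [neg_mul, this]
    simp [cross, om]
  · exact heq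
  · exfalso
    have F₁ := hF.succ
    have hk₁ := (hlen _ _ hlt).2
    obtain ⟨⟨j, hj, Fj⟩, -⟩ := h.three_around hq F₁ hk₁
    have hx := S.len_pos k
    have Fs := P₂.slide (x := S.len (k₂ - 1) - S.len k) (by linarith) (by linarith)
    have e1 : p + S.len (k₂ - 1) * e + (S.len (k₂ - 1) - S.len k : ℝ) * -e
        = p + (S.len k - 0 : ℝ) * e := by push_cast; ring
    rw [hk₁, neg_mul, mul_assoc, mul_comm (conj om), om_mul_conj, mul_one] at Fj
    rw [e1] at Fs
    have := (h.flag_unique Fs Fj).1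
    linarith

/-- A flag at a vertex determines incentre and rotation of its tile; `hw` and `hd` are the
coordinate checks that identify them relative to the tile `c`, `u`. -/
lemma tile_mem_of_flag {c u d w ε : ℂ} {j : Fin 5} (hF : S.Flag 𝒮 (c + u * S.v k) (u * S.f k * ε) j 0)
    (hw : w * S.f j = S.f k * ε) (hd : d + w * S.v j = S.v k) :
    S.tile (c + u * d) (u * w) ∈ 𝒮 := by
  obtain ⟨c', u', hu', hX, h1, h2, -⟩ := hF
  have hf : S.f j ≠ 0 := by
    intro h0
    have := S.norm_f j
    rw [h0] at this; simp at this
  have hu : u' = u * w := by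
    apply mul_right_cancel₀ hf
    rw [h1, mul_assoc, mul_assoc, hw]
  have hc : c' = c + u * d := by
    rw [hu] at h2
    push_cast at h2
    linear_combination h2 - u * hd
  rwa [hu, hc] at hX

lemma flag_vertex {c u : ℂ} (hu : ‖u‖ = 1) (hX : S.tile c u ∈ 𝒮) (k : Fin 5) :
    S.Flag 𝒮 (c + u * S.v k) (u * S.f k) k 0 :=
  ⟨c, u, hu, hX, rfl, by simp, le_rfl, S.len_pos k⟩

end Shape

/-! ### Adjacent tiles in tilings by Cairo pentagons -/

section Cairo

variable {𝒮 : Set (Set ℂ)} {p e : ℂ} {k : Fin 5}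

lemma cairo_angleCond : cairo.AngleCond := by
  rw [Shape.AngleCond, cairo_q]
  refine forall_fin_five ?_ ?_ ?_ ?_ ?_ <;> simp

lemma cairo_len : cairo.len = ![2, 1 + √3, 1 + √3, 1 + √3, 1 + √3] := rfl

lemma cairo_clockwise (h : cairo.IsTiling 𝒮) (hF : cairo.Flag 𝒮 p e k 0)
    (hk : cairo.q k = om) : ∃ k₂, cairo.q k₂ = om ∧ cairo.Flag 𝒮 p (e * conj om) k₂ 0 ∧
      cairo.len (k₂ - 1) = cairo.len k := by
  refine h.clockwise cairo_angleCond ?_ hF hk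
  have h3 := one_lt_sqrt_three
  rw [cairo_q, cairo_len]
  refine forall_fin_five ?_ ?_ ?_ ?_ ?_ <;> refine forall_fin_five ?_ ?_ ?_ ?_ ?_ <;>
    simp <;> intro <;> linarith

lemma cairo_clockwise_zero (h : cairo.IsTiling 𝒮) (hF : cairo.Flag 𝒮 p e 0 0) :
    cairo.Flag 𝒮 p (e * conj om) 1 0 := by
  have h3 := one_lt_sqrt_three
  obtain ⟨k, hk, F, hl⟩ := cairo_clockwise h hF (by rw [cairo_q]; rfl)
  rw [cairo_len] at hl
  rw [cairo_q] at hk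
  fin_cases k
  · exfalso; change (1 + √3 : ℝ) = 2 at hl; linarith
  · exact F
  · exact absurd hk I_ne_om
  · exfalso; change (1 + √3 : ℝ) = 2 at hl; linarith
  · exact absurd hk I_ne_om

/-- The edge arriving at vertex `1` is the short one, and a flag at a vertex determines the length
of the arriving edge. -/
lemma cairo_flag_one_three (h : cairo.IsTiling 𝒮) (hF : cairo.Flag 𝒮 p e 1 0)
    (hF' : cairo.Flag 𝒮 p e k 0) (hl : cairo.len (k - 1) = 1 + √3) : False := by
  have h3 := one_lt_sqrt_three
  have := ((h.flag_unique hF hF').2.2 rfl).2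
  rw [hl] at this
  change (2 : ℝ) = 1 + √3 at this
  linarith

/-- The arriving edge must be long, which leaves the corners `0` and `3`. Corner `0` would be
followed by corner `1`, and closing up after three steps would make the short edge of the initial
tile match a long one. -/
lemma cairo_clockwise_one (h : cairo.IsTiling 𝒮) (hF : cairo.Flag 𝒮 p e 1 0) :
    cairo.Flag 𝒮 p (e * conj om) 3 0 := by
  have h3 := one_lt_sqrt_three
  obtain ⟨k, hk, F, hl⟩ := cairo_clockwise h hF (by rw [cairo_q]; rfl)
  rw [cairo_len] at hl
  rw [cairo_q] at hk
  fin_cases k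
  · exfalso
    have F1 := cairo_clockwise_zero h F
    obtain ⟨k₂, -, F2, hl2⟩ := cairo_clockwise h F1 (by rw [cairo_q]; rfl)
    rw [mul_assoc e, conj_mul_conj, mul_assoc, om_mul_conj, mul_one] at F2
    exact cairo_flag_one_three h hF F2 hl2
  · exfalso; change (2 : ℝ) = 1 + √3 at hl; linarith
  · exact absurd hk I_ne_om
  · exact F
  · exact absurd hk I_ne_om

lemma cairo_counterclockwise_zero (h : cairo.IsTiling 𝒮) (hF : cairo.Flag 𝒮 p e 0 0) :
    cairo.Flag 𝒮 p (e * om) 3 0 := by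
  have := cairo_clockwise_one h (cairo_clockwise_zero h hF)
  rwa [mul_assoc, conj_mul_conj] at this

/-- Two apexes cannot be neighbours at a vertex. -/
lemma cairo_not_three_three (h : cairo.IsTiling 𝒮) (hF : cairo.Flag 𝒮 p e 3 0)
    (hF' : cairo.Flag 𝒮 p (e * conj om) 3 0) : False := by
  have q0 : cairo.q 0 = om := by rw [cairo_q]; rfl
  have q1 : cairo.q 1 = om := by rw [cairo_q]; rfl
  have q2 : cairo.q 2 = I := by rw [cairo_q]; rfl
  have q3 : cairo.q 3 = om := by rw [cairo_q]; rfl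
  have q4 : cairo.q 4 = I := by rw [cairo_q]; rfl
  have n34 : (3 : Fin 5) + 1 = 4 := rfl
  have n40 : (4 : Fin 5) + 1 = 0 := rfl
  have n32 : (3 : Fin 5) - 1 = 2 := rfl
  have n21 : (2 : Fin 5) - 1 = 1 := rfl
  have l3 : cairo.len 3 = 1 + √3 := rfl
  have l4 : cairo.len 4 = 1 + √3 := rfl
  have l2 : cairo.len 2 = 1 + √3 := rfl
  have l1 : cairo.len 1 = 1 + √3 := rfl
  have hoc := om_mul_conj
  -- Two walks, one from each apex, reach the same flag: the point at distance `2 * (1 + √3)` from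
  -- `p` in the direction `e`, with edge direction `-e`. The first walk finds corner `3` there, the
  -- second corner `1`.
  have A1 := hF.succ
  rw [n34, q4, l3] at A1
  have A2 := A1.succ
  rw [n40, q0, l4] at A2
  have A3 := cairo_counterclockwise_zero h A2
  have A4 := A3.succ
  rw [n34, q4, l3] at A4
  have A5 := A4.succ
  rw [n40, q0, l4] at A5
  have A6 := cairo_counterclockwise_zero h A5
  have B1 := hF'.pred
  rw [q3, n32, l2] at B1
  have B2 := B1.pred
  rw [q2, n21, l1] at B2
  have B3 := cairo_clockwise_one h B2
  have B4 := B3.pred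
  rw [q3, n32, l2] at B4
  have B5 := B4.pred
  rw [q2, n21, l1] at B5
  have II := I_mul_I
  simp only [conj_I, mul_assoc, neg_mul, mul_neg, neg_neg, hoc, mul_comm (conj om) om, mul_one, II,
    sub_zero, add_neg_cancel_right, neg_add_cancel_right] at A6 B5
  exact cairo_flag_one_three h B5 A6 rfl

lemma cairo_clockwise_three (h : cairo.IsTiling 𝒮) (hF : cairo.Flag 𝒮 p e 3 0) :
    cairo.Flag 𝒮 p (e * conj om) 0 0 := by
  have h3 := one_lt_sqrt_three
  obtain ⟨k, hk, F, hl⟩ := cairo_clockwise h hF (by rw [cairo_q]; rfl)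
  rw [cairo_len] at hl
  rw [cairo_q] at hk
  fin_cases k
  · exact F
  · exfalso; change (2 : ℝ) = 1 + √3 at hl; linarith
  · exact absurd hk I_ne_om
  · exact (cairo_not_three_three h hF F).elim
  · exact absurd hk I_ne_om

lemma cairo_counterclockwise_three (h : cairo.IsTiling 𝒮) (hF : cairo.Flag 𝒮 p e 3 0) :
    cairo.Flag 𝒮 p (e * om) 1 0 := by
  have := cairo_clockwise_zero h (cairo_clockwise_three h hF)
  rwa [mul_assoc, conj_mul_conj] at this

/-- The rotations carrying a Cairo tile to its neighbours. -/
noncomputable def cairoW : Fin 5 → ℂ := ![-1, I, -I, I, -I]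

/-- The incentre of the tile adjacent along the edge `k`. -/
noncomputable def Shape.d (S : Shape) (k : Fin 5) : ℂ := -(2 * S.rad * (I * S.f k))

/-- Every edge has an end with angle `2π/3`, so the tile across it is found by one clockwise step at
its start or one counterclockwise step at its end. Right-angled corners need no analysis. -/
lemma cairo_neighbour (h : cairo.IsTiling 𝒮) {c u : ℂ} (hu : ‖u‖ = 1)
    (hX : cairo.tile c u ∈ 𝒮) (k : Fin 5) : cairo.tile (c + u * cairo.d k) (u * cairoW k) ∈ 𝒮 := by
  have F := fun k => Shape.flag_vertex hu hX k
  have hs := sqrt_three_sq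
  fin_cases k
  · refine Shape.tile_mem_of_flag (cairo_clockwise_zero h (F 0)) ?_ ?_ <;> apply Complex.ext <;>
      simp [Shape.d, cairo, cairoW, cairoF, cairoV, om] <;> nlinarith
  · refine Shape.tile_mem_of_flag (cairo_clockwise_one h (F 1)) ?_ ?_ <;> apply Complex.ext <;>
      simp [Shape.d, cairo, cairoW, cairoF, cairoV, om] <;> nlinarith
  · refine Shape.tile_mem_of_flag (cairo_counterclockwise_three h (F 3)) ?_ ?_ <;>
      apply Complex.ext <;>
      simp [Shape.d, cairo, cairoW, cairoF, cairoV, om] <;> nlinarith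
  · refine Shape.tile_mem_of_flag (cairo_clockwise_three h (F 3)) ?_ ?_ <;> apply Complex.ext <;>
      simp [Shape.d, cairo, cairoW, cairoF, cairoV, om] <;> nlinarith
  · refine Shape.tile_mem_of_flag (cairo_counterclockwise_zero h (F 0)) ?_ ?_ <;>
      apply Complex.ext <;>
      simp [Shape.d, cairo, cairoW, cairoF, cairoV, om] <;> nlinarith

end Cairo

/-! ### Adjacent tiles in edge-to-edge tilings by Prismatic pentagons -/

section Prismatic

variable {S : Shape} {𝒮 : Set (Set ℂ)} {p e : ℂ} {k : Fin 5}

/-- Vertices of tiles do not lie in the interior of edges. -/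
def Shape.VertexCond (S : Shape) (𝒮 : Set (Set ℂ)) : Prop :=
  ∀ p e k e' k' s', S.Flag 𝒮 p e k 0 → S.Flag 𝒮 p e' k' s' → s' = 0

lemma Shape.VertexCond.len_eq (hV : S.VertexCond 𝒮) (hF : S.Flag 𝒮 p e k 0) {e₂ : ℂ} {k₂ : Fin 5}
    (hF₂ : S.Flag 𝒮 p e₂ k₂ 0) (he : e₂ * S.q k₂ = e) : S.len (k₂ - 1) = S.len k := by
  have P₂ := hF₂.pred
  rw [he] at P₂
  have hx := S.len_pos k
  have hy := S.len_pos (k₂ - 1)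
  rcases lt_trichotomy (S.len (k₂ - 1)) (S.len k) with hlt | heq | hlt
  · have := hV _ _ _ _ _ _ P₂ (hF.slide (x := S.len (k₂ - 1)) (by linarith) (by linarith))
    linarith
  · exact heq
  · have Fs := P₂.slide (x := S.len (k₂ - 1) - S.len k) (by linarith) (by linarith)
    have e1 : p + S.len (k₂ - 1) * e + (S.len (k₂ - 1) - S.len k : ℝ) * -e
        = p + (S.len k - 0 : ℝ) * e := by push_cast; ring
    rw [e1] at Fs
    have := hV _ _ _ _ _ _ hF.succ Fs
    linarith

lemma prism_angleCond : prism.AngleCond := by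
  rw [Shape.AngleCond, prism_q]
  refine forall_fin_five ?_ ?_ ?_ ?_ ?_ <;> simp

lemma prism_len : prism.len = ![2, 2, 1 + √3, 2 * √3, 1 + √3] := rfl

lemma prism_clockwise (h : prism.IsTiling 𝒮) (hV : prism.VertexCond 𝒮)
    (hF : prism.Flag 𝒮 p e k 0) (hk : prism.q k = om) : ∃ k₂, prism.q k₂ = om ∧
      prism.Flag 𝒮 p (e * conj om) k₂ 0 ∧ prism.len (k₂ - 1) = prism.len k := by
  obtain ⟨-, k₂, hk₂, F₂⟩ := h.three_around prism_angleCond hF hk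
  refine ⟨k₂, hk₂, F₂, hV.len_eq hF F₂ ?_⟩
  rw [hk₂, mul_assoc, mul_comm (conj om), om_mul_conj, mul_one]

lemma prism_clockwise_two (h : prism.IsTiling 𝒮) (hV : prism.VertexCond 𝒮)
    (hF : prism.Flag 𝒮 p e 2 0) : prism.Flag 𝒮 p (e * conj om) 0 0 := by
  have h3 := one_lt_sqrt_three
  obtain ⟨k, hk, F, hl⟩ := prism_clockwise h hV hF (by rw [prism_q]; rfl)
  rw [prism_len] at hl
  rw [prism_q] at hk
  fin_cases k
  · exact F
  · exfalso; change (2 : ℝ) = 1 + √3 at hl; linarith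
  · exfalso; change (2 : ℝ) = 1 + √3 at hl; linarith
  · exact absurd hk I_ne_om
  · exact absurd hk I_ne_om

lemma prism_clockwise_zero (h : prism.IsTiling 𝒮) (hV : prism.VertexCond 𝒮)
    (hF : prism.Flag 𝒮 p e 0 0) : prism.Flag 𝒮 p (e * conj om) 1 0 := by
  have h3 := one_lt_sqrt_three
  obtain ⟨k, hk, F, hl⟩ := prism_clockwise h hV hF (by rw [prism_q]; rfl)
  rw [prism_len] at hl
  rw [prism_q] at hk
  fin_cases k
  · exfalso; change (1 + √3 : ℝ) = 2 at hl; linarith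
  · exact F
  -- Corner `2` would be followed by corner `0`; after closing up, the arriving edge at the initial
  -- corner would have length `2` instead of `1 + √3`.
  · exfalso
    have F1 := prism_clockwise_two h hV F
    rw [mul_assoc, conj_mul_conj] at F1
    obtain ⟨k₂, -, F2, hl2⟩ := prism_clockwise h hV F1 (by rw [prism_q]; rfl)
    rw [mul_assoc, om_mul_conj, mul_one] at F2
    have := ((h.flag_unique hF F2).2.2 rfl).2
    rw [hl2] at this
    change (1 + √3 : ℝ) = 2 at this
    linarith
  · exact absurd hk I_ne_om
  · exact absurd hk I_ne_om

lemma prism_counterclockwise_zero (h : prism.IsTiling 𝒮) (hV : prism.VertexCond 𝒮)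
    (hF : prism.Flag 𝒮 p e 0 0) : prism.Flag 𝒮 p (e * om) 2 0 := by
  have h3 := one_lt_sqrt_three
  obtain ⟨k, hk, F, hl⟩ := prism_clockwise h hV (prism_clockwise_zero h hV hF)
    (by rw [prism_q]; rfl)
  rw [mul_assoc, conj_mul_conj] at F
  have hl' := hV.len_eq F hF
  have hq0 : prism.q 0 = om := by rw [prism_q]; rfl
  rw [hq0] at hl'
  replace hl' := hl' rfl
  rw [prism_len] at hl'
  rw [prism_q] at hk
  fin_cases k
  · exfalso; change (1 + √3 : ℝ) = 2 at hl'; linarith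
  · exfalso; change (1 + √3 : ℝ) = 2 at hl'; linarith
  · exact F
  · exact absurd hk I_ne_om
  · exact absurd hk I_ne_om

lemma prism_counterclockwise_two (h : prism.IsTiling 𝒮) (hV : prism.VertexCond 𝒮)
    (hF : prism.Flag 𝒮 p e 2 0) : prism.Flag 𝒮 p (e * om) 1 0 := by
  have := prism_clockwise_zero h hV (prism_clockwise_two h hV hF)
  rwa [mul_assoc, conj_mul_conj] at this

/-- Edge `3` joins two right angles, so `three_around` is not available at its ends. Instead a right
angle is shown to be surrounded by four right angles, and the length `2 * √3` of this edge, which no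
other edge has, selects the corner `4`. -/
lemma prism_clockwise_three (h : prism.IsTiling 𝒮) (hV : prism.VertexCond 𝒮)
    (hF : prism.Flag 𝒮 p e 3 0) : prism.Flag 𝒮 p (e * -I) 4 0 := by
  have h3 := one_lt_sqrt_three
  have he := hF.norm_eq_one
  have hq := prism_angleCond
  have hq3 : prism.q 3 = I := by rw [prism_q]; rfl
  obtain ⟨k₁, s₁, F₁⟩ := h.next_vertex hF
  obtain rfl := hV _ _ _ _ _ _ hF F₁
  rw [hq3] at F₁
  -- By `three_around` an angle `2π/3` at `k₁` would be preceded by another one, starting `π/6`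
  -- before `e`.
  have hk₁ : prism.q k₁ = I := by
    rcases hq k₁ with h1 | h1
    · exact h1
    · exfalso
      obtain ⟨-, k₂, -, F₂⟩ := h.three_around hq F₁ h1
      rw [mul_assoc] at F₂
      exact h.no_flag_before hq hF F₂ (by norm_num [om]) (by norm_num [om])
  obtain ⟨k₂, s₂, F₂⟩ := h.next_vertex F₁
  obtain rfl := hV _ _ _ _ _ _ hF F₂
  rw [hk₁, mul_assoc] at F₂
  obtain ⟨k₃, s₃, F₃⟩ := h.next_vertex F₂
  obtain rfl := hV _ _ _ _ _ _ hF F₃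
  have hk₂ : prism.q k₂ = I := by
    rcases hq k₂ with h1 | h1
    · exact h1
    · exfalso
      rw [h1, mul_assoc] at F₃
      exact h.no_flag_before hq hF F₃ (by norm_num [om]) (by norm_num [om])
  rw [hk₂, mul_assoc, I_mul_I, neg_one_mul] at F₃
  have hk₃ : prism.q k₃ = I := by
    rcases hq k₃ with h1 | h1
    · exact h1
    · exfalso
      refine h.not_inside F₃ hF ?_ fun _ => ?_
      · have := cross_unit_mul he (-I) 1
        rw [mul_one] at this
        rw [this]; norm_num [cross]
      · have := cross_unit_mul he 1 (-I * om)
        rw [mul_one, ← mul_assoc] at this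
        rw [h1, this]; norm_num [cross, om]
  have hl := hV.len_eq hF F₃ (by rw [hk₃, mul_assoc, neg_mul, I_mul_I, neg_neg, mul_one])
  rw [prism_len] at hl
  rw [prism_q] at hk₃
  fin_cases k₃
  · exact absurd hk₃.symm I_ne_om
  · exact absurd hk₃.symm I_ne_om
  · exact absurd hk₃.symm I_ne_om
  · exfalso; change (1 + √3 : ℝ) = 2 * √3 at hl; linarith
  · exact F₃

/-- The rotations carrying a Prismatic tile to its neighbours. -/
noncomputable def prismW : Fin 5 → ℂ := ![-1, -1, 1, -1, 1]

lemma prism_neighbour (h : prism.IsTiling 𝒮) (hV : prism.VertexCond 𝒮) {c u : ℂ} (hu : ‖u‖ = 1)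
    (hX : prism.tile c u ∈ 𝒮) (k : Fin 5) : prism.tile (c + u * prism.d k) (u * prismW k) ∈ 𝒮 := by
  have F := fun k => Shape.flag_vertex hu hX k
  have hs := sqrt_three_sq
  fin_cases k
  · refine Shape.tile_mem_of_flag (prism_clockwise_zero h hV (F 0)) ?_ ?_ <;> apply Complex.ext <;>
      simp [Shape.d, prism, prismW, prismF, prismV, om] <;> nlinarith
  · refine Shape.tile_mem_of_flag (prism_counterclockwise_two h hV (F 2)) ?_ ?_ <;>
      apply Complex.ext <;>
      simp [Shape.d, prism, prismW, prismF, prismV, om] <;> nlinarith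
  · refine Shape.tile_mem_of_flag (prism_clockwise_two h hV (F 2)) ?_ ?_ <;> apply Complex.ext <;>
      simp [Shape.d, prism, prismW, prismF, prismV, om] <;> nlinarith
  · refine Shape.tile_mem_of_flag (prism_clockwise_three h hV (F 3)) ?_ ?_ <;>
      apply Complex.ext <;>
      simp [Shape.d, prism, prismW, prismF, prismV] <;> nlinarith
  · refine Shape.tile_mem_of_flag (prism_counterclockwise_zero h hV (F 0)) ?_ ?_ <;>
      apply Complex.ext <;>
      simp [Shape.d, prism, prismW, prismF, prismV, om] <;> nlinarith

end Prismatic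

end PentagonTiling

namespace PentagonTiling

open Complex Filter Topology Set
open scoped ComplexConjugate

/-! ### Periodic tilings as Voronoi diagrams -/

/-- Rotations `w k` carrying the pentagon `S` to copies adjacent along the edge `k`, which is the
edge `opp k` of the copy; the vertices have distance at most `R` from the incentre. -/
structure Adjacency (S : Shape) where
  w : Fin 5 → ℂ
  opp : Fin 5 → Fin 5
  R : ℝ
  R_pos : 0 < R
  norm_v_le : ∀ k, ‖S.v k‖ ≤ R
  norm_w : ∀ k, ‖w k‖ = 1
  w_mul_w : ∀ k, w k * w (opp k) = 1
  w_mul_f : ∀ k, w k * S.f (opp k) = -S.f k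
  glue : ∀ k, S.d k + w k * S.v (opp k) = S.v (k + 1)
  glue' : ∀ k, S.d k + w k * S.v (opp k + 1) = S.v k

namespace Adjacency

variable {S : Shape} (A : Adjacency S)

/-- The placements reached from the pentagon itself by passing to adjacent copies. -/
inductive Orbit : ℂ → ℂ → Prop
  | base : Orbit 0 1
  | step {c u : ℂ} (h : Orbit c u) (k : Fin 5) : Orbit (c + u * S.d k) (u * A.w k)

/-- The only placements in the orbit whose centre is at distance at most `2 * R` are the pentagon
itself, the five adjacent ones, and those opposite to it at a vertex at distance `R`. -/
def Near : Prop := ∀ c u, A.Orbit c u → ‖c‖ ≤ 2 * A.R →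
  (c = 0 ∧ u = 1) ∨ (∃ k, c = S.d k ∧ u = A.w k) ∨ (∃ k, c = 2 * S.v k ∧ u = -1 ∧ ‖c‖ = 2 * A.R)

variable {A} {c u c' u' z : ℂ}

lemma Orbit.norm_eq_one (h : A.Orbit c u) : ‖u‖ = 1 := by
  induction h with
  | base => simp
  | step h k ih => rw [norm_mul, ih, A.norm_w, one_mul]

/-- With `Orbit.inv` this makes the orbit a group of motions, so that any tile may be taken as the
base tile. -/
lemma Orbit.mul (h : A.Orbit c u) (h' : A.Orbit c' u') : A.Orbit (c + u * c') (u * u') := by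
  induction h' with
  | base => simpa using h
  | step h' k ih =>
    have := ih.step k
    rwa [add_assoc, mul_assoc u, ← mul_add, mul_assoc u] at this

lemma orbit_neighbour (A : Adjacency S) (k : Fin 5) : A.Orbit (S.d k) (A.w k) := by
  simpa using (Orbit.base (A := A)).step k

lemma w_opp_eq (A : Adjacency S) (k : Fin 5) : A.w (A.opp k) = conj (A.w k) := by
  have h1 := A.w_mul_w k
  have h2 := conj_mul_unit (A.norm_w k)
  linear_combination conj (A.w k) * h1 - A.w (A.opp k) * h2

lemma w_mul_d (A : Adjacency S) (k : Fin 5) : A.w k * S.d (A.opp k) = -S.d k := by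
  have h1 := A.w_mul_f k
  simp only [Shape.d]
  linear_combination (-2 * S.rad * I) * h1

lemma Orbit.inv (h : A.Orbit c u) : A.Orbit (-(conj u * c)) (conj u) := by
  induction h with
  | base => simpa using Orbit.base (A := A)
  | @step c u h k ih =>
    have h1 := (A.orbit_neighbour (A.opp k)).mul ih
    rw [w_opp_eq] at h1
    have h2 := A.w_mul_d k
    have h3 := conj_mul_unit (A.norm_w k)
    have h4 := conj_mul_unit h.norm_eq_one
    convert h1 using 1
    · rw [map_mul]
      linear_combination (-conj (A.w k) * S.d k) * h4 - conj (A.w k) * h2 +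
        S.d (A.opp k) * h3
    · rw [map_mul, mul_comm]

lemma norm_sq_eq (z : ℂ) : ‖z‖ ^ 2 = z.re * z.re + z.im * z.im := by
  rw [← Complex.normSq_eq_norm_sq, normSq_apply]

/-- `S.d k` is the mirror image of the incentre in the line of edge `k`, so the half-plane of that
edge consists of the points at least as close to the incentre as to `S.d k`. -/
lemma norm_sub_d_sq (S : Shape) (k : Fin 5) (z : ℂ) :
    ‖z - S.d k‖ ^ 2 = ‖z‖ ^ 2 + 4 * S.rad * (cross (S.f k) z + S.rad) := by
  have h1 : ‖S.f k‖ ^ 2 = 1 := by rw [S.norm_f]; norm_num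
  rw [norm_sq_eq] at *
  rw [norm_sq_eq]
  simp only [Shape.d, cross, sub_re, sub_im, neg_re, neg_im, mul_re, mul_im, I_re, I_im, ofReal_re,
    ofReal_im, re_ofNat, im_ofNat]
  linear_combination (4 * S.rad ^ 2) * h1

lemma norm_d (S : Shape) (k : Fin 5) : ‖S.d k‖ = 2 * S.rad := by
  simp [Shape.d, S.norm_f, abs_of_pos S.rad_pos]

/-- For an adjacent centre the edge constraint says this; every other centre has norm at least `2 *
A.R`, and the triangle inequality with `‖z‖ ≤ A.R` suffices. -/
lemma norm_le_of_near (hN : A.Near) (h : A.Orbit c u) (hz : z ∈ S.tile 0 1) :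
    ‖z‖ ≤ ‖z - c‖ := by
  have hzR := Shape.norm_le_of_mem A.norm_v_le hz
  have htri : ‖c‖ ≤ ‖z‖ + ‖z - c‖ := by
    calc ‖c‖ = ‖z - (z - c)‖ := by congr 1; ring
      _ ≤ _ := norm_sub_le _ _
  by_cases hc : ‖c‖ ≤ 2 * A.R
  · rcases hN c u h hc with ⟨rfl, -⟩ | ⟨k, rfl, -⟩ | ⟨k, -, -, h2⟩
    · simp
    · apply le_of_sq_le_sq _ (norm_nonneg _)
      rw [norm_sub_d_sq]
      have := hz k
      rw [one_mul, sub_zero] at this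
      have := mul_nonneg S.rad_pos.le (by linarith : 0 ≤ cross (S.f k) z + S.rad)
      linarith
    · linarith
  · linarith

lemma mem_tile_iff_conj (hu : ‖u‖ = 1) : z ∈ S.tile c u ↔ conj u * (z - c) ∈ S.tile 0 1 := by
  simp only [Shape.tile, mem_ofPred_eq, one_mul, sub_zero]
  refine forall_congr' fun k => ?_
  rw [← cross_unit_mul hu (S.f k), ← mul_assoc, mul_conj_unit hu, one_mul]

/-- The tiles are the Voronoi cells of their centres. -/
lemma Orbit.mem_tile_iff (h : A.Orbit c u) (hN : A.Near) :
    z ∈ S.tile c u ↔ ∀ c' u', A.Orbit c' u' → ‖z - c‖ ≤ ‖z - c'‖ := by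
  have hu := h.norm_eq_one
  have hu' : ‖conj u‖ = 1 := by rw [RCLike.norm_conj, hu]
  have hn : ∀ c', ‖conj u * (z - c) - conj u * (c' - c)‖ = ‖z - c'‖ := by
    intro c'
    rw [← mul_sub, norm_mul, hu', one_mul]; congr 1; ring
  have hn0 : ‖conj u * (z - c)‖ = ‖z - c‖ := by rw [norm_mul, hu', one_mul]
  rw [mem_tile_iff_conj hu]
  constructor
  · intro hz c' u' h'
    have h1 := h.inv.mul h'
    have h2 : -(conj u * c) + conj u * c' = conj u * (c' - c) := by ring
    rw [h2] at h1
    have := norm_le_of_near hN h1 hz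
    rwa [hn, hn0] at this
  · intro hz k
    have h1 := hz _ _ (h.step k)
    rw [← hn0, ← hn (c + u * S.d k), add_sub_cancel_left, ← mul_assoc, conj_mul_unit hu,
      one_mul] at h1
    have h2 := pow_le_pow_left₀ (norm_nonneg _) h1 2
    rw [norm_sub_d_sq] at h2
    have h3 : 0 ≤ (4 * S.rad) * (cross (S.f k) (conj u * (z - c)) + S.rad) := by linarith
    have := nonneg_of_mul_nonneg_right h3 (by linarith [S.rad_pos])
    rw [one_mul, sub_zero]
    linarith

/-- By `Near` and the group property the centres are uniformly discrete, hence form a closed set in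
which the distance is attained. This is why the Voronoi cells cover the plane. -/
lemma Orbit.exists_nearest (hN : A.Near) (z : ℂ) :
    ∃ c u, A.Orbit c u ∧ ∀ c' u', A.Orbit c' u' → ‖z - c‖ ≤ ‖z - c'‖ := by
  set C : Set ℂ := {c | ∃ u, A.Orbit c u} with hC
  have hr := S.rad_pos
  have hε : 0 < min (2 * S.rad) (2 * A.R) := lt_min (by linarith) (by linarith [A.R_pos])
  have hsep : C.Pairwise fun x y => min (2 * S.rad) (2 * A.R) ≤ dist x y := by
    rintro x ⟨u, hx⟩ y ⟨u', hy⟩ hne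
    have h1 := hy.inv.mul hx
    have h2 : -(conj u' * y) + conj u' * x = conj u' * (x - y) := by ring
    rw [h2] at h1
    have hnorm : ‖conj u' * (x - y)‖ = dist x y := by
      rw [norm_mul, RCLike.norm_conj, hy.norm_eq_one, one_mul, dist_eq_norm]
    rw [← hnorm]
    by_cases hc : ‖conj u' * (x - y)‖ ≤ 2 * A.R
    · rcases hN _ _ h1 hc with ⟨h0, -⟩ | ⟨k, h0, -⟩ | ⟨k, -, -, h2⟩
      · rw [h0, norm_zero] at hnorm
        exact absurd (dist_eq_zero.1 hnorm.symm) hne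
      · rw [h0, norm_d]; exact min_le_left _ _
      · rw [h2]; exact min_le_right _ _
    · exact (min_le_right _ _).trans (not_le.1 hc).le
  have hcl := Metric.isClosed_of_pairwise_le_dist hε hsep
  obtain ⟨c, ⟨u, hc⟩, hd⟩ := hcl.exists_infDist_eq_dist ⟨0, 1, Orbit.base⟩ z
  refine ⟨c, u, hc, fun c' u' h' => ?_⟩
  rw [← dist_eq_norm, ← dist_eq_norm, ← hd]
  exact Metric.infDist_le_dist_of_mem ⟨u', h'⟩

variable (A) in
/-- The copy of the periodic tiling containing the tile with centre `c` and rotation `u`. -/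
def tilingAt (c u : ℂ) : Set (Set ℂ) :=
  {X | ∃ c' u', A.Orbit c' u' ∧ X = S.tile (c + u * c') (u * u')}

lemma mem_tile_mul (hu : ‖u‖ = 1) :
    c + u * z ∈ S.tile (c + u * c') (u * u') ↔ z ∈ S.tile c' u' := by
  simp only [Shape.tile, mem_ofPred_eq]
  refine forall_congr' fun k => ?_
  rw [show c + u * z - (c + u * c') = u * (z - c') by ring, mul_assoc, cross_unit_mul hu]

lemma exists_eq_add_mul (hu : ‖u‖ = 1) (c z : ℂ) : ∃ y, z = c + u * y :=
  ⟨conj u * (z - c), by rw [← mul_assoc, mul_conj_unit hu]; ring⟩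

lemma sep_of_orbit (hN : A.Near) (h : A.Orbit c u) (h' : A.Orbit c' u') (hz : z ∈ S.tile c u)
    (hz' : z ∈ interior (S.tile c' u')) : S.tile c u = S.tile c' u' := by
  have hcc : c = c' := by
    -- A common point is equidistant from both centres; moving it slightly towards `c` stays in the
    -- second cell but makes `c` strictly nearer. With equal centres the Voronoi cells agree.
    by_contra hne
    have e1 := (h.mem_tile_iff hN).1 hz _ _ h'
    have e2 := (h'.mem_tile_iff hN).1 (interior_subset hz') _ _ h
    have heq : ‖z - c‖ ^ 2 = ‖z - c'‖ ^ 2 := by rw [le_antisymm e1 e2]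
    have ht : Tendsto (fun x : ℝ => z + x * (c - c')) (𝓝[>] 0) (𝓝 z) := by
      have : Continuous (fun x : ℝ => z + x * (c - c')) := by fun_prop
      simpa using (this.tendsto 0).mono_left nhdsWithin_le_nhds
    have hev := ht.eventually (mem_interior_iff_mem_nhds.1 hz')
    obtain ⟨x, hx, hx0⟩ := (hev.and self_mem_nhdsWithin).exists
    have hx0 : 0 < x := hx0
    have e3 := pow_le_pow_left₀ (norm_nonneg _) ((h'.mem_tile_iff hN).1 hx _ _ h) 2
    have hpos : 0 < ‖c - c'‖ ^ 2 := by
      have : 0 < ‖c - c'‖ := norm_pos_iff.2 (sub_ne_zero.2 hne)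
      positivity
    rw [norm_sq_eq, norm_sq_eq] at e3 heq
    rw [norm_sq_eq] at hpos
    simp only [add_re, add_im, sub_re, sub_im, re_ofReal_mul, im_ofReal_mul] at *
    have := mul_pos hx0 hpos
    nlinarith
  ext y
  rw [h.mem_tile_iff hN, h'.mem_tile_iff hN, hcc]

lemma isTiling_tilingAt (hN : A.Near) (hu : ‖u‖ = 1) : S.IsTiling (A.tilingAt c u) where
  tiles := by
    rintro X ⟨c', u', h', rfl⟩
    exact ⟨_, _, by rw [norm_mul, hu, h'.norm_eq_one, one_mul], rfl⟩
  cover := by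
    intro z
    obtain ⟨y, rfl⟩ := exists_eq_add_mul hu c z
    obtain ⟨c', u', h', hy⟩ := Orbit.exists_nearest hN y
    exact ⟨_, ⟨c', u', h', rfl⟩, (mem_tile_mul hu).2 ((h'.mem_tile_iff hN).2 hy)⟩
  sep := by
    rintro _ ⟨c₁, u₁, h₁, rfl⟩ _ ⟨c₂, u₂, h₂, rfl⟩ z hz hz'
    obtain ⟨y, rfl⟩ := exists_eq_add_mul hu c z
    rw [mem_tile_mul hu] at hz
    have hy' : y ∈ interior (S.tile c₂ u₂) := by
      apply Shape.mem_interior_tile_of_lt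
      intro k
      have := Shape.lt_of_mem_interior_tile
        (by rw [norm_mul, hu, h₂.norm_eq_one, one_mul]) hz' k
      rwa [show c + u * y - (c + u * c₂) = u * (y - c₂) by ring, mul_assoc,
        cross_unit_mul hu] at this
    have heq := sep_of_orbit hN h₁ h₂ hz hy'
    ext x
    obtain ⟨y, rfl⟩ := exists_eq_add_mul hu c x
    rw [mem_tile_mul hu, mem_tile_mul hu, heq]

/-- A tiling in which all adjacent tiles are as prescribed is the periodic one. -/
lemma eq_tilingAt (hN : A.Near) {𝒮 : Set (Set ℂ)} (h : S.IsTiling 𝒮)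
    (hnb : ∀ c u, ‖u‖ = 1 → S.tile c u ∈ 𝒮 → ∀ k, S.tile (c + u * S.d k) (u * A.w k) ∈ 𝒮)
    (hu : ‖u‖ = 1) (hX : S.tile c u ∈ 𝒮) : 𝒮 = A.tilingAt c u := by
  have hsub : A.tilingAt c u ⊆ 𝒮 := by
    rintro X ⟨c', u', h', rfl⟩
    induction h' with
    | base => simpa using hX
    | @step c₁ u₁ h₁ k ih =>
      have := hnb _ _ (by rw [norm_mul, hu, h₁.norm_eq_one, one_mul]) ih k
      rwa [add_assoc, mul_assoc u, ← mul_add, mul_assoc u] at this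
  refine Subset.antisymm (fun X hX => ?_) hsub
  obtain ⟨c₁, u₁, hu₁, rfl⟩ := h.tiles X hX
  obtain ⟨Y, hY, hc⟩ := (isTiling_tilingAt (c := c) hN hu).cover c₁
  have := h.sep Y (hsub hY) _ hX c₁ hc
    (Shape.ball_subset_interior_tile hu₁ (Metric.mem_ball_self S.rad_pos))
  rwa [← this]

/-- How the pentagon meets the other tiles. -/
lemma Orbit.inter_cases (h : A.Orbit c u) (hN : A.Near) :
    (c = 0 ∧ u = 1) ∨ S.tile 0 1 ∩ S.tile c u = ∅ ∨
      (∃ k, c = 2 * S.v k ∧ u = -1 ∧ S.tile 0 1 ∩ S.tile c u = {S.v k}) ∨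
      (∃ k, c = S.d k ∧ u = A.w k ∧
        S.tile 0 1 ∩ S.tile c u = segment ℝ (S.v k) (S.v (k + 1))) := by
  have hv : ∀ k, S.v k ∈ S.tile 0 1 := fun k => by
    simpa using Shape.vertex_mem_tile (S := S) (c := 0) (u := 1) (by simp) k
  have hb : A.Orbit 0 1 := Orbit.base
  have heq : ∀ z ∈ S.tile 0 1 ∩ S.tile c u, ‖z‖ = ‖z - c‖ ∧ ‖z‖ ≤ A.R := by
    rintro z ⟨h1, h2⟩
    have e1 := (hb.mem_tile_iff hN).1 h1 _ _ h
    have e2 := (h.mem_tile_iff hN).1 h2 _ _ hb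
    rw [sub_zero] at e1 e2
    exact ⟨le_antisymm e1 e2, Shape.norm_le_of_mem A.norm_v_le h1⟩
  by_cases hc : ‖c‖ ≤ 2 * A.R
  · rcases hN _ _ h hc with h0 | ⟨k, rfl, rfl⟩ | ⟨k, rfl, rfl, hR⟩
    · exact Or.inl h0
    · right; right; right
      refine ⟨k, rfl, rfl, Subset.antisymm ?_ ?_⟩
      · intro z hz
        have h1 := (heq z hz).1
        have h2 := norm_sub_d_sq S k z
        rw [← h1] at h2
        have h3 : 4 * S.rad * (cross (S.f k) z + S.rad) = 0 := by linarith
        have h4 : cross (S.f k) z + S.rad = 0 :=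
          (mul_eq_zero.1 h3).resolve_left (by linarith [S.rad_pos])
        have h5 : cross (S.f k) (z - S.v k) = 0 := by
          rw [cross_sub, S.cross_v]; linarith
        have h6 := eq_real_mul_of_cross_eq_zero (S.norm_f k) h5
        set s := cross (z - S.v k) (I * S.f k)
        have h7 := (Shape.add_mem_tile_iff_edge (S := S) (c := 0) (u := 1) (k := k) (s := 0)
          (p := S.v k) (by simp) (by simp) s).1 (by
            rw [one_mul, ← h6, add_sub_cancel]; exact hz.1)
        rw [zero_add] at h7
        have hl := S.len_pos k
        refine ⟨1 - s / S.len k, s / S.len k, ?_, div_nonneg h7.1 hl.le, by ring, ?_⟩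
        · have := (div_le_one hl).2 h7.2
          linarith
        · rw [S.v_succ]
          have : z = S.v k + s * S.f k := by rw [← h6]; ring
          rw [this, real_smul, real_smul]
          have hl' : (S.len k : ℂ) ≠ 0 := by exact_mod_cast hl.ne'
          push_cast
          field_simp
          ring
      · have hcv : Convex ℝ (S.tile 0 1 ∩ S.tile (S.d k) (A.w k)) :=
          Shape.convex_tile.inter Shape.convex_tile
        apply hcv.segment_subset
        · refine ⟨hv _, ?_⟩
          have := Shape.vertex_mem_tile (S := S) (c := S.d k) (A.norm_w k) (A.opp k + 1)
          rwa [A.glue'] at this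
        · refine ⟨hv _, ?_⟩
          have := Shape.vertex_mem_tile (S := S) (c := S.d k) (A.norm_w k) (A.opp k)
          rwa [A.glue] at this
    · right; right; left
      refine ⟨k, rfl, rfl, ?_⟩
      apply Subset.antisymm
      · intro z hz
        obtain ⟨h1, h2⟩ := heq z hz
        -- Equality in the triangle inequality: `z` has distance at most `A.R` from `0` and from `2
        -- * S.v k`, whose distance is `2 * A.R`, so `z` is their midpoint.
        have h3 : ‖z - S.v k‖ ^ 2 ≤ 0 := by
          have e1 := pow_le_pow_left₀ (norm_nonneg _) h2 2
          have e2 : ‖z‖ ^ 2 = ‖z - 2 * S.v k‖ ^ 2 := by rw [← h1]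
          have e3 : ‖2 * S.v k‖ ^ 2 = (2 * A.R) ^ 2 := by rw [hR]
          rw [norm_sq_eq] at *
          rw [norm_sq_eq] at e2
          simp only [sub_re, sub_im, mul_re, mul_im, re_ofNat, im_ofNat] at *
          nlinarith
        have h4 : ‖z - S.v k‖ = 0 := by
          have := norm_nonneg (z - S.v k)
          nlinarith
        exact sub_eq_zero.1 (norm_eq_zero.1 h4)
      · rintro _ rfl
        refine ⟨hv k, ?_⟩
        have := Shape.vertex_mem_tile (S := S) (c := 2 * S.v k) (u := -1) (by simp) k
        rwa [show 2 * S.v k + -1 * S.v k = S.v k by ring] at this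
  · right; left
    rw [eq_empty_iff_forall_notMem]
    intro z hz
    obtain ⟨h1, h2⟩ := heq z hz
    have htri : ‖c‖ ≤ ‖z‖ + ‖z - c‖ := by
      calc ‖c‖ = ‖z - (z - c)‖ := by congr 1; ring
        _ ≤ _ := norm_sub_le _ _
    rw [← h1] at htri
    linarith

end Adjacency

lemma two_sqrt_six_sq {z : ℂ} (h : ‖z‖ ≤ 2 * √6) : z.re * z.re + z.im * z.im ≤ 24 := by
  have h1 := pow_le_pow_left₀ (norm_nonneg _) h 2
  rw [Adjacency.norm_sq_eq, mul_pow, Real.sq_sqrt (by norm_num)] at h1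
  linarith

lemma norm_le_sqrt {z : ℂ} {x : ℝ} (h : z.re * z.re + z.im * z.im ≤ x) : ‖z‖ ≤ √x := by
  apply Real.le_sqrt_of_sq_le
  rwa [Adjacency.norm_sq_eq]

/-- Adjacency in the Cairo tiling. -/
noncomputable def cairoAdj : Adjacency cairo where
  w := cairoW
  opp := ![0, 2, 1, 4, 3]
  R := √6
  R_pos := by positivity
  norm_v_le := by
    refine forall_fin_five ?_ ?_ ?_ ?_ ?_ <;> apply norm_le_sqrt <;>
      simp [cairo, cairoV] <;> nlinarith [sqrt_three_sq]
  norm_w := by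
    refine forall_fin_five ?_ ?_ ?_ ?_ ?_ <;> simp [cairoW]
  w_mul_w := by
    refine forall_fin_five ?_ ?_ ?_ ?_ ?_ <;> simp [cairoW]
  w_mul_f := by
    refine forall_fin_five ?_ ?_ ?_ ?_ ?_ <;> apply Complex.ext <;>
      simp [cairoW, cairo, cairoF]  <;> ring
  glue := by
    have := sqrt_three_sq
    refine forall_fin_five ?_ ?_ ?_ ?_ ?_ <;> apply Complex.ext <;>
      simp [cairoW, cairo, cairoF, cairoV, Shape.d] <;> nlinarith
  glue' := by
    have := sqrt_three_sq
    refine forall_fin_five ?_ ?_ ?_ ?_ ?_ <;> apply Complex.ext <;>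
      simp [cairoW, cairo, cairoF, cairoV, Shape.d] <;> nlinarith

/-- Adjacency in the Prismatic tiling. -/
noncomputable def prismAdj : Adjacency prism where
  w := prismW
  opp := ![0, 1, 4, 3, 2]
  R := √6
  R_pos := by positivity
  norm_v_le := by
    refine forall_fin_five ?_ ?_ ?_ ?_ ?_ <;> apply norm_le_sqrt <;>
      simp [prism, prismV] <;> nlinarith [sqrt_three_sq]
  norm_w := by
    refine forall_fin_five ?_ ?_ ?_ ?_ ?_ <;> simp [prismW]
  w_mul_w := by
    refine forall_fin_five ?_ ?_ ?_ ?_ ?_ <;> simp [prismW]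
  w_mul_f := by
    refine forall_fin_five ?_ ?_ ?_ ?_ ?_ <;> apply Complex.ext <;>
      simp [prismW, prism, prismF]
  glue := by
    have := sqrt_three_sq
    refine forall_fin_five ?_ ?_ ?_ ?_ ?_ <;> apply Complex.ext <;>
      simp [prismW, prism, prismF, prismV, Shape.d] <;> nlinarith
  glue' := by
    have := sqrt_three_sq
    refine forall_fin_five ?_ ?_ ?_ ?_ ?_ <;> apply Complex.ext <;>
      simp [prismW, prism, prismF, prismV, Shape.d] <;> nlinarith

end PentagonTiling

namespace PentagonTiling

open Complex Filter Topology Set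
open scoped ComplexConjugate

/-! ### Lattice coordinates of the tile centres -/

lemma cairo_d : cairo.d = ![⟨2 * √3, 0⟩, ⟨√3, 3⟩, ⟨-3, √3⟩, ⟨-3, -√3⟩, ⟨√3, -3⟩] := by
  have := sqrt_three_sq
  funext k
  revert k
  refine forall_fin_five ?_ ?_ ?_ ?_ ?_ <;> apply Complex.ext <;>
    simp [Shape.d, cairo, cairoF] <;> nlinarith

lemma prism_d : prism.d = ![⟨3, -√3⟩, ⟨3, √3⟩, ⟨0, 2 * √3⟩, ⟨-2 * √3, 0⟩, ⟨0, -2 * √3⟩] := by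
  have := sqrt_three_sq
  funext k
  revert k
  refine forall_fin_five ?_ ?_ ?_ ?_ ?_ <;> apply Complex.ext <;>
    simp [Shape.d, prism, prismF] <;> nlinarith

/-- One coset of a lattice for each of the four orientations; `m` witnesses the parity condition on
the coordinates. `Near` becomes a finite check. -/
lemma cairo_orbit {c u : ℂ} (h : cairoAdj.Orbit c u) : ∃ a b m : ℤ, a + b = 2 * m ∧
    ((u = 1 ∧ c = ⟨(3 + √3) * a, (3 + √3) * b⟩) ∨
      (u = -1 ∧ c = ⟨2 * √3 + (3 + √3) * a, (3 + √3) * b⟩) ∨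
      (u = I ∧ c = ⟨√3 + (3 + √3) * a, 3 + (3 + √3) * b⟩) ∨
      (u = -I ∧ c = ⟨√3 + (3 + √3) * a, -3 + (3 + √3) * b⟩)) := by
  induction h with
  | base => exact ⟨0, 0, 0, by norm_num, Or.inl ⟨rfl, by apply Complex.ext <;> simp⟩⟩
  | step h k ih =>
    obtain ⟨a, b, m, hm, ih⟩ := ih
    have hw : cairoAdj.w = ![-1, I, -I, I, -I] := rfl
    rw [hw, cairo_d]
    rcases ih with ⟨rfl, rfl⟩ | ⟨rfl, rfl⟩ | ⟨rfl, rfl⟩ | ⟨rfl, rfl⟩ <;> revert k <;>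
      refine forall_fin_five ?_ ?_ ?_ ?_ ?_
    · exact ⟨a, b, m, hm, Or.inr (Or.inl ⟨by simp, by
        apply Complex.ext <;> simp <;> ring⟩)⟩
    · exact ⟨a, b, m, hm, Or.inr (Or.inr (Or.inl ⟨by simp, by
        apply Complex.ext <;> simp <;> ring⟩))⟩
    · exact ⟨a - 1, b + 1, m, by linarith, Or.inr (Or.inr (Or.inr ⟨by simp, by
        apply Complex.ext <;> simp <;> ring⟩))⟩
    · exact ⟨a - 1, b - 1, m - 1, by linarith, Or.inr (Or.inr (Or.inl ⟨by simp, by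
        apply Complex.ext <;> simp <;> ring⟩))⟩
    · exact ⟨a, b, m, hm, Or.inr (Or.inr (Or.inr ⟨by simp, by
        apply Complex.ext <;> simp <;> ring⟩))⟩
    · exact ⟨a, b, m, hm, Or.inl ⟨by simp, by
        apply Complex.ext <;> simp⟩⟩
    · exact ⟨a, b, m, hm, Or.inr (Or.inr (Or.inr ⟨by simp, by
        apply Complex.ext <;> simp <;> ring⟩))⟩
    · exact ⟨a + 1, b - 1, m, by linarith, Or.inr (Or.inr (Or.inl ⟨by simp, by
        apply Complex.ext <;> simp <;> ring⟩))⟩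
    · exact ⟨a + 1, b + 1, m + 1, by linarith, Or.inr (Or.inr (Or.inr ⟨by simp, by
        apply Complex.ext <;> simp <;> ring⟩))⟩
    · exact ⟨a, b, m, hm, Or.inr (Or.inr (Or.inl ⟨by simp, by
        apply Complex.ext <;> simp <;> ring⟩))⟩
    · exact ⟨a, b + 2, m + 1, by linarith, Or.inr (Or.inr (Or.inr ⟨by simp, by
        apply Complex.ext <;> simp <;> ring⟩))⟩
    · exact ⟨a - 1, b + 1, m, by linarith, Or.inr (Or.inl ⟨by simp, by
        apply Complex.ext <;> simp <;> ring⟩)⟩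
    · exact ⟨a, b, m, hm, Or.inl ⟨by simp, by
        apply Complex.ext <;> simp⟩⟩
    · exact ⟨a, b, m, hm, Or.inr (Or.inl ⟨by simp, by
        apply Complex.ext <;> simp <;> ring⟩)⟩
    · exact ⟨a + 1, b + 1, m + 1, by linarith, Or.inl ⟨by simp, by
        apply Complex.ext <;> simp <;> ring⟩⟩
    · exact ⟨a, b - 2, m - 1, by linarith, Or.inr (Or.inr (Or.inl ⟨by simp, by
        apply Complex.ext <;> simp <;> ring⟩))⟩
    · exact ⟨a + 1, b - 1, m, by linarith, Or.inl ⟨by simp, by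
        apply Complex.ext <;> simp <;> ring⟩⟩
    · exact ⟨a, b, m, hm, Or.inr (Or.inl ⟨by simp, by
        apply Complex.ext <;> simp <;> ring⟩)⟩
    · exact ⟨a, b, m, hm, Or.inl ⟨by simp, by
        apply Complex.ext <;> simp⟩⟩
    · exact ⟨a - 1, b - 1, m - 1, by linarith, Or.inr (Or.inl ⟨by simp, by
        apply Complex.ext <;> simp <;> ring⟩)⟩

lemma prism_orbit {c u : ℂ} (h : prismAdj.Orbit c u) : ∃ a b m : ℤ,
    (u = 1 ∧ a + b = 2 * m ∧ c = ⟨(3 + 2 * √3) * a, √3 * b⟩) ∨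
      (u = -1 ∧ a + b + 1 = 2 * m ∧ c = ⟨3 + (3 + 2 * √3) * a, √3 * b⟩) := by
  induction h with
  | base => exact ⟨0, 0, 0, Or.inl ⟨rfl, by norm_num, by apply Complex.ext <;> simp⟩⟩
  | step h k ih =>
    obtain ⟨a, b, m, ih⟩ := ih
    have hw : prismAdj.w = ![-1, -1, 1, -1, 1] := rfl
    rw [hw, prism_d]
    rcases ih with ⟨rfl, hm, rfl⟩ | ⟨rfl, hm, rfl⟩ <;> revert k <;>
      refine forall_fin_five ?_ ?_ ?_ ?_ ?_
    · exact ⟨a, b - 1, m, Or.inr ⟨by simp, by linarith, by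
        apply Complex.ext <;> simp <;> ring⟩⟩
    · exact ⟨a, b + 1, m + 1, Or.inr ⟨by simp, by linarith, by
        apply Complex.ext <;> simp <;> ring⟩⟩
    · exact ⟨a, b + 2, m + 1, Or.inl ⟨by simp, by linarith, by
        apply Complex.ext <;> simp <;> ring⟩⟩
    · exact ⟨a - 1, b, m, Or.inr ⟨by simp, by linarith, by
        apply Complex.ext <;> simp <;> ring⟩⟩
    · exact ⟨a, b - 2, m - 1, Or.inl ⟨by simp, by linarith, by
        apply Complex.ext <;> simp <;> ring⟩⟩
    · exact ⟨a, b + 1, m, Or.inl ⟨by simp, by linarith, by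
        apply Complex.ext <;> simp <;> ring⟩⟩
    · exact ⟨a, b - 1, m - 1, Or.inl ⟨by simp, by linarith, by
        apply Complex.ext <;> simp <;> ring⟩⟩
    · exact ⟨a, b - 2, m - 1, Or.inr ⟨by simp, by linarith, by
        apply Complex.ext <;> simp <;> ring⟩⟩
    · exact ⟨a + 1, b, m, Or.inl ⟨by simp, by linarith, by
        apply Complex.ext <;> simp <;> ring⟩⟩
    · exact ⟨a, b + 2, m + 1, Or.inr ⟨by simp, by linarith, by
        apply Complex.ext <;> simp <;> ring⟩⟩

/-! ### Enumeration of the centres within twice the circumradius -/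

lemma sqrt_three_bounds : 1.73 < √3 ∧ √3 < 1.74 := by
  constructor
  · apply Real.lt_sqrt_of_sq_lt; norm_num
  · rw [Real.sqrt_lt' (by norm_num)]; norm_num

/-- An integer `a` with `|x + y * a| ≤ 5` lies between given bounds. -/
lemma int_bounds (x : ℝ) {y : ℝ} (a l r : ℤ) (hy : 0 < y) (hz : (x + y * a) * (x + y * a) ≤ 24)
    (hl : x + y * (l - 1) < -4.9) (hr : 4.9 < x + y * (r + 1)) : l ≤ a ∧ a ≤ r := by
  have h1 : x + y * a ≤ 4.9 := by nlinarith
  have h2 : -4.9 ≤ x + y * a := by nlinarith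
  constructor
  · by_contra hc
    have : (a : ℝ) ≤ l - 1 := by exact_mod_cast (by lia : a ≤ l - 1)
    nlinarith
  · by_contra hc
    have : (r : ℝ) + 1 ≤ a := by exact_mod_cast (by lia : r + 1 ≤ a)
    nlinarith

lemma norm_eq_two_sqrt_six {z : ℂ} (h : z.re * z.re + z.im * z.im = 24) : ‖z‖ = 2 * √6 := by
  have h1 : ‖z‖ ^ 2 = (2 * √6) ^ 2 := by
    rw [Adjacency.norm_sq_eq, mul_pow, Real.sq_sqrt (by norm_num), h]; norm_num
  exact (pow_left_inj₀ (norm_nonneg _) (by positivity) two_ne_zero).1 h1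

/-- The bound `‖c‖ ≤ 2 * √6` leaves finitely many lattice coordinates and parity removes most of
them. The survivors are the origin, the five adjacent centres, and the two centres opposite at the
right-angled vertices `2` and `4`, which lie exactly on the bounding circle. -/
lemma cairo_near : cairoAdj.Near := by
  intro c u h hc
  have hs := sqrt_three_sq
  obtain ⟨hs1, hs2⟩ := sqrt_three_bounds
  replace hc : ‖c‖ ≤ 2 * √6 := hc
  replace hc := two_sqrt_six_sq hc
  obtain ⟨a, b, m, hm, ih⟩ := cairo_orbit h
  have hR : cairoAdj.R = √6 := rfl
  have hw : cairoAdj.w = ![-1, I, -I, I, -I] := rfl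
  have hv : cairo.v = cairoV := rfl
  rw [hw, cairo_d, hR, hv]
  have hre := mul_self_nonneg c.re
  have him := mul_self_nonneg c.im
  have hK : 0 < 3 + √3 := by linarith
  rcases ih with ⟨rfl, rfl⟩ | ⟨rfl, rfl⟩ | ⟨rfl, rfl⟩ | ⟨rfl, rfl⟩ <;> simp only at hc hre him
  · obtain ⟨a1, a2⟩ := int_bounds 0 a (-1) 1 hK
      (by linarith) (by push_cast; linarith) (by push_cast; linarith)
    obtain ⟨b1, b2⟩ := int_bounds 0 b (-1) 1 hK
      (by linarith) (by push_cast; linarith) (by push_cast; linarith)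
    have ha : a = 0 ∧ b = 0 := by
      interval_cases a <;> interval_cases b <;> first | lia | (exfalso; push_cast at hc; nlinarith)
    left
    rw [ha.1, ha.2]
    exact ⟨by apply Complex.ext <;> simp, rfl⟩
  · obtain ⟨a1, a2⟩ := int_bounds (2 * √3) a (-1) 0 hK
      (by linarith) (by push_cast; linarith) (by push_cast; linarith)
    obtain ⟨b1, b2⟩ := int_bounds 0 b (-1) 1 hK
      (by linarith) (by push_cast; linarith) (by push_cast; linarith)
    right
    interval_cases a <;> interval_cases b <;> try lia
    · right
      refine ⟨4, ?_, rfl, norm_eq_two_sqrt_six ?_⟩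
      · apply Complex.ext <;> simp [cairoV] <;> ring
      · push_cast; nlinarith
    · right
      refine ⟨2, ?_, rfl, norm_eq_two_sqrt_six ?_⟩
      · apply Complex.ext <;> simp [cairoV] <;> ring
      · push_cast; nlinarith
    · left
      exact ⟨0, by apply Complex.ext <;> simp, by simp⟩
  · obtain ⟨a1, a2⟩ := int_bounds √3 a (-1) 0 hK
      (by linarith) (by push_cast; linarith) (by push_cast; linarith)
    obtain ⟨b1, b2⟩ := int_bounds 3 b (-1) 0 hK
      (by linarith) (by push_cast; linarith) (by push_cast; linarith)
    right; left
    interval_cases a <;> interval_cases b <;> try lia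
    · exact ⟨3, by apply Complex.ext <;> simp, by simp⟩
    · exact ⟨1, by apply Complex.ext <;> simp, by simp⟩
  · obtain ⟨a1, a2⟩ := int_bounds √3 a (-1) 0 hK
      (by linarith) (by push_cast; linarith) (by push_cast; linarith)
    obtain ⟨b1, b2⟩ := int_bounds (-3) b (0) 1 hK
      (by linarith) (by push_cast; linarith) (by push_cast; linarith)
    right; left
    interval_cases a <;> interval_cases b <;> try lia
    · exact ⟨2, by apply Complex.ext <;> simp, by simp⟩
    · exact ⟨4, by apply Complex.ext <;> simp, by simp⟩

lemma prism_near : prismAdj.Near := by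
  intro c u h hc
  have hs := sqrt_three_sq
  obtain ⟨hs1, hs2⟩ := sqrt_three_bounds
  replace hc : ‖c‖ ≤ 2 * √6 := hc
  replace hc := two_sqrt_six_sq hc
  obtain ⟨a, b, m, ih⟩ := prism_orbit h
  have hR : prismAdj.R = √6 := rfl
  have hw : prismAdj.w = ![-1, -1, 1, -1, 1] := rfl
  have hv : prism.v = prismV := rfl
  rw [hw, prism_d, hR, hv]
  have hre := mul_self_nonneg c.re
  have him := mul_self_nonneg c.im
  have hK : 0 < 3 + 2 * √3 := by linarith
  have h3 : 0 < √3 := by linarith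
  rcases ih with ⟨rfl, hm, rfl⟩ | ⟨rfl, hm, rfl⟩ <;> simp only at hc hre him
  · obtain ⟨a1, a2⟩ := int_bounds 0 a (0) 0 hK
      (by linarith) (by push_cast; linarith) (by push_cast; linarith)
    obtain ⟨b1, b2⟩ := int_bounds 0 b (-2) 2 h3
      (by linarith) (by push_cast; linarith) (by push_cast; linarith)
    interval_cases a; interval_cases b <;> try lia
    · right; left
      exact ⟨4, by apply Complex.ext <;> simp <;> ring, by simp⟩
    · left
      exact ⟨by apply Complex.ext <;> simp, rfl⟩
    · right; left
      exact ⟨2, by apply Complex.ext <;> simp <;> ring, by simp⟩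
  · obtain ⟨a1, a2⟩ := int_bounds 3 a (-1) 0 hK
      (by linarith) (by push_cast; linarith) (by push_cast; linarith)
    obtain ⟨b1, b2⟩ := int_bounds 0 b (-2) 2 h3
      (by linarith) (by push_cast; linarith) (by push_cast; linarith)
    right
    interval_cases a <;> interval_cases b <;> try lia
    · right
      refine ⟨4, ?_, rfl, norm_eq_two_sqrt_six ?_⟩
      · apply Complex.ext <;> simp [prismV] <;> ring
      · push_cast; nlinarith
    · left
      exact ⟨3, by apply Complex.ext <;> simp, by simp⟩
    · right
      refine ⟨3, ?_, rfl, norm_eq_two_sqrt_six ?_⟩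
      · apply Complex.ext <;> simp [prismV] <;> ring
      · push_cast; nlinarith
    · left
      exact ⟨0, by apply Complex.ext <;> simp, by simp⟩
    · left
      exact ⟨1, by apply Complex.ext <;> simp, by simp⟩

end PentagonTiling

namespace PentagonTiling

open Complex Filter Topology Set
open scoped ComplexConjugate

/-! ### Recognising circumscribed pentagons by their angles -/

lemma inner_eq (a b : ℂ) : inner ℝ a b = a.re * b.re + a.im * b.im := by
  rw [Complex.inner]; simp; ring

lemma sq_add_sq_of_unit {a : ℂ} (ha : ‖a‖ = 1) : a.re * a.re + a.im * a.im = 1 := by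
  rw [← Adjacency.norm_sq_eq, ha]; norm_num

/-- Unit numbers in the upper half plane are determined by their real part. -/
lemma eq_of_re_eq_of_im_pos {a b : ℂ} (ha : ‖a‖ = 1) (hb : ‖b‖ = 1) (h : a.re = b.re)
    (ha' : 0 < a.im) (hb' : 0 < b.im) : a = b := by
  have h1 := sq_add_sq_of_unit ha
  have h2 := sq_add_sq_of_unit hb
  refine Complex.ext h ?_
  rw [h] at h1
  have : (a.im - b.im) * (a.im + b.im) = 0 := by linarith
  rcases mul_eq_zero.1 this with h3 | h3 <;> linarith

/-- The centre of a circle touching two sides of an angle lies inside the angle. -/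
lemma cross_eq_of_tangent {a b x : ℂ} {τ ρ : ℝ} (ha : ‖a‖ = 1) (hb : ‖b‖ = 1)
    (hab : 0 < cross a b) (hτ : 0 ≤ τ) (hρ : 0 < ρ) (h1 : inner ℝ x b = τ) (h2 : inner ℝ x a = -τ)
    (h3 : ‖x‖ ^ 2 = τ ^ 2 + ρ ^ 2) : cross a x = ρ := by
  have ha2 := sq_add_sq_of_unit ha
  have hb2 := sq_add_sq_of_unit hb
  rw [inner_eq] at h1 h2
  rw [Adjacency.norm_sq_eq] at h3
  have hc : cross a x ^ 2 = ρ ^ 2 := by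
    have : cross a x ^ 2 + (x.re * a.re + x.im * a.im) ^ 2
        = (a.re * a.re + a.im * a.im) * (x.re * x.re + x.im * x.im) := by
      simp only [cross]; ring
    rw [ha2, h2, h3] at this
    linarith
  set C := a.re * b.re + a.im * b.im with hC
  have hCS : C ^ 2 + cross a b ^ 2 = 1 := by
    have : C ^ 2 + cross a b ^ 2 = (a.re * a.re + a.im * a.im) * (b.re * b.re + b.im * b.im) := by
      simp only [cross, hC]; ring
    rw [this, ha2, hb2]; norm_num
  have hC1 : 0 < 1 + C := by nlinarith
  have hkey : cross a x * cross a b = τ * (1 + C) := by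
    have : C * (x.re * a.re + x.im * a.im) + cross a b * cross a x
        = (a.re * a.re + a.im * a.im) * (x.re * b.re + x.im * b.im) := by
      simp only [cross, hC]; ring
    rw [ha2, h1, h2] at this
    linarith
  have hnn : 0 ≤ cross a x := by
    by_contra hneg
    have := mul_neg_of_neg_of_pos (not_le.1 hneg) hab
    have := mul_nonneg hτ hC1.le
    linarith
  exact (pow_left_inj₀ hnn hρ.le two_ne_zero).1 hc

lemma forall_eq_zero_of_pred {α : Type*} {g : Fin 5 → α} (h : ∀ k, g (k - 1) = g k) (k : Fin 5) :
    g k = g 0 := by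
  have h1 : g 0 = g 1 := h 1
  have h2 : g 1 = g 2 := h 2
  have h3 : g 2 = g 3 := h 3
  have h4 : g 3 = g 4 := h 4
  fin_cases k
  · rfl
  · exact h1.symm
  · exact (h1.trans h2).symm
  · exact (h1.trans (h2.trans h3)).symm
  · exact (h1.trans (h2.trans (h3.trans h4))).symm

/-- A counterclockwise pentagon circumscribed about a circle is determined by its angles, up to
direct similarity. -/
lemma Shape.recognise (S : Shape) {p : Fin 5 → ℂ} {o : ℂ} {ρ : ℝ} (hρ : 0 < ρ)
    (hccw : ∀ k, 0 < cross (p k - p (k - 1)) (p (k + 1) - p k))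
    (hang : ∀ k, inner ℝ (p (k - 1) - p k) (p (k + 1) - p k)
      = (S.q k).re * (‖p (k - 1) - p k‖ * ‖p (k + 1) - p k‖))
    (htan : ∀ k, ∃ t ∈ segment ℝ (p k) (p (k + 1)), ‖t - o‖ = ρ ∧ inner ℝ (p k - t) (t - o) = 0 ∧
      inner ℝ (p (k + 1) - t) (t - o) = 0) :
    ∃ μ : ℂ, ‖μ‖ = 1 ∧ ∀ k, p k = o + (ρ / S.rad : ℝ) * (μ * S.v k) := by
  set ℓ : Fin 5 → ℝ := fun k => ‖p (k + 1) - p k‖ with hℓ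
  have hne : ∀ k, 0 < ℓ k := by
    intro k
    rw [hℓ, norm_pos_iff]
    intro h0
    have := hccw k
    rw [h0, cross_zero] at this
    exact lt_irrefl _ this
  set g : Fin 5 → ℂ := fun k => (ℓ k)⁻¹ * (p (k + 1) - p k) with hg
  have hgn : ∀ k, ‖g k‖ = 1 := by
    intro k
    have h0 := hne k
    rw [hg]
    simp only [norm_mul, norm_inv, Complex.norm_real, Real.norm_of_nonneg h0.le]
    exact inv_mul_cancel₀ h0.ne'
  have hpg : ∀ k, p (k + 1) = p k + ℓ k * g k := by
    intro k
    have h0 : (ℓ k : ℂ) ≠ 0 := by exact_mod_cast (hne k).ne'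
    simp only [hg, ofReal_inv]
    field_simp
    ring
  have hpg' : ∀ k, p k = p (k - 1) + ℓ (k - 1) * g (k - 1) := by
    intro k
    have := hpg (k - 1)
    rwa [sub_add_cancel] at this
  have hturn : ∀ k, 0 < cross (g (k - 1)) (g k) := by
    intro k
    have h1 := hccw k
    rw [hpg k, add_sub_cancel_left] at h1
    nth_rewrite 1 [hpg' k] at h1
    rw [add_sub_cancel_left, cross_real_mul, real_mul_cross] at h1
    by_contra hneg
    have h2 := mul_pos (hne k) (hne (k - 1))
    have := mul_nonneg h2.le (by linarith [not_lt.1 hneg] : 0 ≤ -cross (g (k - 1)) (g k))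
    linarith
  have hq : ∀ k, g k * S.q k = -g (k - 1) := by
    intro k
    have h1 := hang k
    have e1 : p (k - 1) - p k = (ℓ (k - 1) : ℝ) * -g (k - 1) := by
      rw [hpg' k]; ring
    have e2 : p (k + 1) - p k = (ℓ k : ℝ) * g k := by rw [hpg k]; ring
    have e3 : conj (g k) * -g (k - 1) = S.q k := by
      apply eq_of_re_eq_of_im_pos _ (S.norm_q k)
      · rw [e1, e2, inner_eq] at h1
        simp only [norm_mul, Complex.norm_real, norm_neg, hgn, Real.norm_of_nonneg (hne _).le,
          re_ofReal_mul, im_ofReal_mul, neg_re, neg_im, mul_one] at h1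
        have h2 := (mul_pos (hne k) (hne (k - 1))).ne'
        apply mul_left_cancel₀ h2
        simp only [mul_re, conj_re, conj_im, neg_re, neg_im]
        linarith
      · have := hturn k
        simp only [cross] at this
        simp only [mul_im, conj_re, conj_im, neg_re, neg_im]
        linarith
      · have : 0 < cross 1 (1 * S.q k) := Shape.cross_f_mul_q_pos (by simp)
        simpa [cross] using this
      · rw [norm_mul, norm_neg, RCLike.norm_conj, hgn, hgn, one_mul]
    rw [← e3, ← mul_assoc, mul_conj_unit (hgn k), one_mul]
  have hμ : ∀ k, g (k - 1) * conj (S.f (k - 1)) = g k * conj (S.f k) := by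
    intro k
    have h1 := hq k
    have h2 := S.f_mul_q k
    have h3 := mul_conj_unit (S.norm_q k)
    have h4 : conj (S.f k) * conj (S.q k) = -conj (S.f (k - 1)) := by
      rw [← map_mul, h2, map_neg]
    linear_combination g k * conj (S.f k) * h3 - conj (S.f k) * conj (S.q k) * h1
      + g (k - 1) * h4
  have hμ' := forall_eq_zero_of_pred (g := fun k => g k * conj (S.f k)) hμ
  set μ := g 0 * conj (S.f 0) with hμdef
  have hgμ : ∀ k, g k = μ * S.f k := by
    intro k
    have h1 : g k * conj (S.f k) = μ := hμ' k
    rw [← h1, mul_assoc, conj_mul_unit (S.norm_f k), mul_one]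
  have hμn : ‖μ‖ = 1 := by
    rw [hμdef, norm_mul, RCLike.norm_conj, hgn, S.norm_f, one_mul]
  choose t ht ht1 ht2 ht3 using htan
  have htl : ∀ k, ∃ τ τ' : ℝ, 0 ≤ τ ∧ 0 ≤ τ' ∧ t k = p k + τ * g k ∧ t k = p (k + 1) - τ' * g k := by
    intro k
    obtain ⟨a, b, ha, hb, hab, h⟩ := ht k
    refine ⟨b * ℓ k, a * ℓ k, mul_nonneg hb (hne k).le, mul_nonneg ha (hne k).le, ?_, ?_⟩
    · rw [← h, hpg k]
      have : (a : ℂ) + b = 1 := by exact_mod_cast hab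
      simp only [real_smul]
      push_cast
      linear_combination p k * this
    · rw [← h, hpg k]
      have : (a : ℂ) + b = 1 := by exact_mod_cast hab
      simp only [real_smul]
      push_cast
      linear_combination (p k + ℓ k * g k) * this
  have hperp : ∀ k, inner ℝ (t k - o) (g k) = 0 := by
    intro k
    have h1 := ht2 k
    have h2 := ht3 k
    rw [hpg k] at h2
    rw [inner_eq] at *
    have : ℓ k * ((t k - o).re * (g k).re + (t k - o).im * (g k).im) = 0 := by
      simp only [sub_re, sub_im, add_re, add_im, re_ofReal_mul, im_ofReal_mul] at *
      linarith
    exact (mul_eq_zero.1 this).resolve_left (hne k).ne'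
  have hcr : ∀ k, cross (g (k - 1)) (o - p k) = ρ := by
    intro k
    obtain ⟨τ, -, hτ, -, e1, -⟩ := htl k
    obtain ⟨-, τ', -, hτ', -, e2⟩ := htl (k - 1)
    rw [sub_add_cancel] at e2
    have n1 := sq_add_sq_of_unit (hgn k)
    have n2 := sq_add_sq_of_unit (hgn (k - 1))
    have p1 := hperp k
    have p2 := hperp (k - 1)
    have r1 : ‖t k - o‖ ^ 2 = ρ ^ 2 := by rw [ht1]
    have r2 : ‖t (k - 1) - o‖ ^ 2 = ρ ^ 2 := by rw [ht1]
    rw [e1] at p1 r1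
    rw [e2] at p2 r2
    rw [inner_eq] at p1 p2
    rw [Adjacency.norm_sq_eq] at r1 r2
    simp only [sub_re, sub_im, add_re, add_im, re_ofReal_mul, im_ofReal_mul] at p1 p2 r1 r2
    have i1 : inner ℝ (o - p k) (g k) = τ := by
      rw [inner_eq]; simp only [sub_re, sub_im]
      linear_combination (-1 : ℝ) * p1 + τ * n1
    have i2 : inner ℝ (o - p k) (g (k - 1)) = -τ' := by
      rw [inner_eq]; simp only [sub_re, sub_im]
      linear_combination (-1 : ℝ) * p2 - τ' * n2
    have s1 : ‖o - p k‖ ^ 2 = τ ^ 2 + ρ ^ 2 := by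
      rw [Adjacency.norm_sq_eq]; simp only [sub_re, sub_im]
      linear_combination r1 - 2 * τ * p1 + τ ^ 2 * n1
    have s2 : ‖o - p k‖ ^ 2 = τ' ^ 2 + ρ ^ 2 := by
      rw [Adjacency.norm_sq_eq]; simp only [sub_re, sub_im]
      linear_combination r2 + 2 * τ' * p2 + τ' ^ 2 * n2
    -- The two tangent segments from a vertex to the circle have equal length.
    have hττ : τ = τ' := (pow_left_inj₀ hτ hτ' two_ne_zero).1 (by linarith)
    rw [← hττ] at i2
    exact cross_eq_of_tangent (hgn _) (hgn _) (hturn k) hτ hρ i1 i2 s1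
  refine ⟨μ, hμn, fun k => ?_⟩
  have hr := S.rad_pos.ne'
  have c1 : cross (g (k - 1)) (p k - o) = cross (g (k - 1)) ((ρ / S.rad : ℝ) * (μ * S.v k)) := by
    have h1 := hcr k
    have h2 := S.cross_v_succ (k - 1)
    rw [sub_add_cancel] at h2
    rw [← neg_sub o, cross_neg, h1, cross_real_mul, hgμ, cross_unit_mul hμn, h2]
    field_simp
  have c2 : cross (g k) (p k - o) = cross (g k) ((ρ / S.rad : ℝ) * (μ * S.v k)) := by
    have h1 := hcr (k + 1)
    rw [add_sub_cancel_right, hpg k, sub_add_eq_sub_sub, cross_sub, cross_real_mul, cross_self,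
      mul_zero, sub_zero] at h1
    rw [← neg_sub o, cross_neg, h1, cross_real_mul, hgμ, cross_unit_mul hμn, S.cross_v]
    field_simp
  -- A vertex is the intersection of two edge lines, each at distance `ρ` from `o` in a known
  -- direction.
  have := eq_of_cross_eq (hturn k).ne' c1 c2
  rw [← this]; ring

/-! ### Convex pentagons in the plane -/

/-- The identification of the Euclidean plane with the complex plane. -/
noncomputable def toC : Plane ≃ₗᵢ[ℝ] ℂ := Complex.orthonormalBasisOneI.repr.symm

lemma exists_real_mul_of_cross_eq_zero {a b : ℂ} (ha : a ≠ 0) (h : cross a b = 0) :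
    ∃ t : ℝ, b = t * a := by
  have hn : 0 < ‖a‖ := norm_pos_iff.2 ha
  have hn' : (‖a‖ : ℂ) ≠ 0 := by exact_mod_cast hn.ne'
  have h1 : ‖((‖a‖⁻¹ : ℝ) : ℂ) * a‖ = 1 := by
    rw [norm_mul, Complex.norm_real, Real.norm_of_nonneg (by positivity), inv_mul_cancel₀ hn.ne']
  have h2 : cross (((‖a‖⁻¹ : ℝ) : ℂ) * a) b = 0 := by rw [real_mul_cross, h, mul_zero]
  have h3 := eq_real_mul_of_cross_eq_zero h1 h2
  exact ⟨_, by rw [h3, ← mul_assoc, ← ofReal_mul]⟩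

section Side

variable (L : Plane ≃ₗᵢ[ℝ] ℂ) {a b x y : Plane}

lemma mem_line_iff (hab : a ≠ b) : x ∈ line[ℝ, a, b] ↔ cross (L b - L a) (L x - L a) = 0 := by
  have hne : L b - L a ≠ 0 := sub_ne_zero.2 (fun h => hab (L.injective h.symm))
  rw [mem_affineSpan_pair_iff_exists_lineMap_eq]
  constructor
  · rintro ⟨r, rfl⟩
    rw [AffineMap.lineMap_apply, vsub_eq_sub, vadd_eq_add, map_add, map_smul, map_sub,
      add_sub_cancel_right, real_smul, cross_real_mul, cross_self, mul_zero]
  · intro h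
    obtain ⟨t, ht⟩ := exists_real_mul_of_cross_eq_zero hne h
    refine ⟨t, L.injective ?_⟩
    rw [AffineMap.lineMap_apply, vsub_eq_sub, vadd_eq_add, map_add, map_smul, map_sub, real_smul,
      ← ht]
    ring

lemma sSameSide_iff (hab : a ≠ b) : line[ℝ, a, b].SSameSide x y ↔
    0 < cross (L b - L a) (L x - L a) * cross (L b - L a) (L y - L a) := by
  have hshift : ∀ p ∈ line[ℝ, a, b], ∀ z, cross (L b - L a) (L z - L a)
      = cross (L b - L a) (L (z - p)) := by
    intro p hp z
    rw [mem_line_iff L hab] at hp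
    rw [map_sub, show L z - L p = (L z - L a) - (L p - L a) by ring, cross_sub _ (L z - L a), hp,
      sub_zero]
  constructor
  · rintro ⟨⟨p, hp, r, hr, hray⟩, hx, hy⟩
    have hxp : x -ᵥ p ≠ 0 := fun h => hx (by rw [vsub_eq_zero_iff_eq.1 h]; exact hp)
    have hyr : y -ᵥ r ≠ 0 := fun h => hy (by rw [vsub_eq_zero_iff_eq.1 h]; exact hr)
    obtain ⟨s, t, hs, ht, hst⟩ := hray.exists_pos hxp hyr
    rw [mem_line_iff L hab] at hx
    have h1 := congrArg (fun v => cross (L b - L a) (L v)) hst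
    simp only [vsub_eq_sub, map_smul, real_smul, cross_real_mul] at h1
    rw [← hshift p hp, ← hshift r hr] at h1
    set X := cross (L b - L a) (L x - L a)
    set Y := cross (L b - L a) (L y - L a)
    have h2 : t * (X * Y) = s * (X * X) := by linear_combination (-X) * h1
    have h3 : 0 < s * (X * X) := mul_pos hs (mul_self_pos.2 hx)
    rw [← h2] at h3
    exact pos_of_mul_pos_right h3 ht.le
  · intro h
    set X := cross (L b - L a) (L x - L a) with hX
    set Y := cross (L b - L a) (L y - L a) with hY
    have hX0 : X ≠ 0 := fun h0 => by rw [h0, zero_mul] at h; exact lt_irrefl _ h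
    have hY0 : Y ≠ 0 := fun h0 => by rw [h0, mul_zero] at h; exact lt_irrefl _ h
    -- The second point is obtained by moving from `y` parallel to `x - a` until the line is
    -- reached; the ratio `Y / X` is positive by hypothesis.
    refine ⟨⟨a, left_mem_affineSpan_pair _ _ _, y - (Y / X) • (x - a), ?_, ?_⟩, ?_, ?_⟩
    · rw [mem_line_iff L hab]
      have : L (y - (Y / X) • (x - a)) - L a = (L y - L a) - ((Y / X : ℝ) : ℂ) * (L x - L a) := by
        rw [map_sub, map_smul, map_sub, real_smul]; ring
      rw [this, cross_sub _ (L y - L a), cross_real_mul, ← hX, ← hY]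
      field_simp
      ring
    · rw [vsub_eq_sub, vsub_eq_sub, sub_sub_cancel]
      apply SameRay.sameRay_nonneg_smul_right
      have : Y / X = X * Y / (X * X) := by field_simp
      rw [this]
      exact div_nonneg h.le (mul_self_nonneg _)
    · rwa [mem_line_iff L hab]
    · rwa [mem_line_iff L hab]

end Side

lemma finRotate_eq (i : Fin 5) : finRotate 5 i = i + 1 := by simp

lemma finRotate_symm_eq (i : Fin 5) : (finRotate 5).symm i = i - 1 := by
  rw [Equiv.symm_apply_eq, finRotate_eq, sub_add_cancel]

section Convex

variable {P : Pentagon}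

lemma IsConvex.ne (h : IsConvex P) (i : Fin 5) : P i ≠ P (i + 1) := by
  intro h0
  have h1 := h (i + 1) i i (by simp) (by simp [add_assoc]) (by simp)
    (by simp [add_assoc])
  apply h1.left_notMem
  rw [h0]
  exact left_mem_affineSpan_pair _ _ _

lemma isConvex_iff (L : Plane ≃ₗᵢ[ℝ] ℂ) : IsConvex P ↔ (∀ i, P i ≠ P (i + 1)) ∧
    ∀ i j k : Fin 5, j ≠ i → j ≠ i + 1 → k ≠ i → k ≠ i + 1 →
      0 < cross (L (P (i + 1)) - L (P i)) (L (P j) - L (P i)) *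
        cross (L (P (i + 1)) - L (P i)) (L (P k) - L (P i)) := by
  constructor
  · intro h
    refine ⟨h.ne, fun i j k h1 h2 h3 h4 => ?_⟩
    rw [← sSameSide_iff L (h.ne i), ← finRotate_eq]
    exact h i j k h1 (by rwa [finRotate_eq]) h3 (by rwa [finRotate_eq])
  · rintro ⟨hne, h⟩ i j k h1 h2 h3 h4
    rw [finRotate_eq] at *
    rw [sSameSide_iff L (hne i)]
    exact h i j k h1 h2 h3 h4

/-- The vertices of a convex pentagon are in counterclockwise or in clockwise order. -/
lemma IsConvex.orientation (L : Plane ≃ₗᵢ[ℝ] ℂ) (h : IsConvex P) :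
    (∀ k, 0 < cross (L (P k) - L (P (k - 1))) (L (P (k + 1)) - L (P k))) ∨
      (∀ k, cross (L (P k) - L (P (k - 1))) (L (P (k + 1)) - L (P k)) < 0) := by
  set s : Fin 5 → ℝ := fun k => cross (L (P k) - L (P (k - 1))) (L (P (k + 1)) - L (P k)) with hs
  -- The vertices `k - 2` and `k + 1` lie on the same side of the line through `k - 1` and `k`, so
  -- the turns at its two vertices have equal sign.
  have hprod : ∀ k, 0 < s (k - 1) * s k := by
    intro k
    obtain ⟨-, h'⟩ := (isConvex_iff L).1 h
    have d1 : ∀ k : Fin 5, k - 2 ≠ k - 1 ∧ k - 2 ≠ k - 1 + 1 ∧ k + 1 ≠ k - 1 ∧ k + 1 ≠ k - 1 + 1 ∧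
      k - 1 - 1 = k - 2 := by decide
    obtain ⟨a1, a2, a3, a4, a5⟩ := d1 k
    have h1 := h' (k - 1) (k - 2) (k + 1) a1 a2 a3 a4
    rw [sub_add_cancel] at h1
    have e1 : s (k - 1) = cross (L (P k) - L (P (k - 1))) (L (P (k - 2)) - L (P (k - 1))) := by
      simp only [hs, sub_add_cancel, a5, cross, sub_re, sub_im]; ring
    have e2 : s k = cross (L (P k) - L (P (k - 1))) (L (P (k + 1)) - L (P (k - 1))) := by
      simp only [hs, cross, sub_re, sub_im]; ring
    rw [e1, e2]; exact h1
  have hsign : ∀ k, (0 < s (k - 1)) = (0 < s k) := by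
    intro k
    rcases mul_pos_iff.1 (hprod k) with ⟨a, b⟩ | ⟨a, b⟩
    · simp [a, b]
    · simp [a.not_gt, b.not_gt]
  have hall := forall_eq_zero_of_pred (g := fun k => 0 < s k) hsign
  by_cases h0 : 0 < s 0
  · left; intro k
    have := hall k
    simp only [h0, eq_iff_iff, iff_true] at this
    exact this
  · right; intro k
    have := hall k
    simp only [h0, eq_iff_iff, iff_false] at this
    rcases mul_pos_iff.1 (hprod k) with ⟨a, b⟩ | ⟨a, b⟩
    · exact absurd b this
    · exact b

end Convex

end PentagonTiling

namespace PentagonTiling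

open Complex Filter Topology Set
open scoped ComplexConjugate Pointwise

/-! ### Pentagons with prescribed angles -/

/-- Convex pentagons of unit area circumscribed about a circle, with the interior angles `θ`. -/
def HasAngles (θ : Fin 5 → ℝ) (P : Pentagon) : Prop :=
  IsConvex P ∧ MeasureTheory.volume (region P) = 1 ∧ IsCircumscribed P ∧
    ∀ i, interiorAngle P i = θ i

/-- The pentagon `S` has the angles `θ`, it is symmetric under complex conjugation, and the
feet of the perpendiculars from the incentre lie on the edges. -/
structure Shape.Model (S : Shape) (θ : Fin 5 → ℝ) where
  re_q : ∀ k, (S.q k).re = Real.cos (θ k)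
  nonneg : ∀ k, 0 ≤ θ k
  le_pi : ∀ k, θ k ≤ Real.pi
  flip : Fin 5 → Fin 5
  flip_flip : ∀ k, flip (flip k) = k
  conj_v : ∀ k, conj (S.v k) = S.v (flip k)
  foot : Fin 5 → ℝ
  foot_nonneg : ∀ k, 0 ≤ foot k
  foot_le : ∀ k, foot k ≤ S.len k
  foot_eq : ∀ k, S.v k + foot k * S.f k = -(S.rad * (I * S.f k))

lemma edgeSet_eq (P : Pentagon) (i : Fin 5) : P.edgeSet ℝ i = segment ℝ (P i) (P (i + 1)) := by
  rw [Polygon.edgeSet, affineSegment_eq_segment, finRotate_eq]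

lemma recognise_of_orientation {S : Shape} {θ : Fin 5 → ℝ} (M : S.Model θ) {P : Pentagon}
    (h : HasAngles θ P) (L : Plane ≃ₗᵢ[ℝ] ℂ)
    (hL : ∀ k, 0 < cross (L (P k) - L (P (k - 1))) (L (P (k + 1)) - L (P k))) :
    ∃ (o : ℂ) (r : ℝ) (μ : ℂ), 0 < r ∧ ‖μ‖ = 1 ∧ ∀ k, L (P k) = o + r * (μ * S.v k) := by
  obtain ⟨-, -, ⟨s, hs, htan⟩, hang⟩ := h
  obtain ⟨μ, hμ, hP⟩ := S.recognise (p := fun k => L (P k)) (o := L s.center) hs hL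
    (fun k => by
      have h1 := hang k
      have h2 := InnerProductGeometry.cos_angle_mul_norm_mul_norm (P (k - 1) - P k) (P (k + 1) - P k)
      rw [interiorAngle, EuclideanGeometry.angle, finRotate_eq, finRotate_symm_eq, vsub_eq_sub,
        vsub_eq_sub] at h1
      rw [h1, ← M.re_q] at h2
      rw [← map_sub, ← map_sub, L.inner_map_map, L.norm_map, L.norm_map, h2])
    (fun k => by
      obtain ⟨t, ht, htt⟩ := htan k
      rw [edgeSet_eq] at ht
      rw [finRotate_eq] at htt
      refine ⟨L t, ?_, ?_, ?_, ?_⟩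
      · have := mem_image_of_mem L ht
        have e := image_segment ℝ L.toLinearEquiv.toLinearMap.toAffineMap (P k) (P (k + 1))
        simp only [LinearMap.coe_toAffineMap, LinearEquiv.coe_coe,
          LinearIsometryEquiv.coe_toLinearEquiv] at e
        rwa [e] at this
      · rw [← map_sub, L.norm_map, ← dist_eq_norm]
        exact EuclideanGeometry.mem_sphere.1 htt.mem_sphere
      · rw [← map_sub, ← map_sub, L.inner_map_map]
        exact htt.inner_left_eq_zero_of_mem (left_mem_affineSpan_pair _ _ _)
      · rw [← map_sub, ← map_sub, L.inner_map_map]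
        exact htt.inner_left_eq_zero_of_mem (right_mem_affineSpan_pair _ _ _))
  exact ⟨_, _, μ, div_pos hs S.rad_pos, hμ, hP⟩

lemma volume_image_similarity (L : Plane ≃ₗᵢ[ℝ] ℂ) (o : ℂ) {r : ℝ} {μ : ℂ} (hμ : ‖μ‖ = 1)
    (X : Set ℂ) : MeasureTheory.volume (L.symm '' ((fun z => o + r * (μ * z)) '' X)) =
      ENNReal.ofReal (r ^ 2) * MeasureTheory.volume X := by
  set m : Circle := ⟨μ, by simp [Submonoid.unitSphere, hμ]⟩ with hm
  have e1 : (fun z : ℂ => o + r * (μ * z)) '' X = (fun z => o + z) '' (r • (rotation m '' X)) := by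
    rw [← image_smul, image_image, image_image]
    rfl
  have e2 : ∀ (Y : Set ℂ), MeasureTheory.volume (L.symm '' Y) = MeasureTheory.volume Y := by
    intro Y
    rw [← L.measurePreserving.measure_preimage_emb L.toHomeomorph.measurableEmbedding]
    congr 1
    rw [L.symm.image_eq_preimage_symm]; rfl
  have e3 : ∀ (Y : Set ℂ), MeasureTheory.volume (rotation m '' Y) = MeasureTheory.volume Y := by
    intro Y
    have := (rotation m).symm.measurePreserving.measure_preimage_emb
      (rotation m).symm.toHomeomorph.measurableEmbedding Y
    rw [← this, (rotation m).image_eq_preimage_symm]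
  rw [e2, e1, image_add_left, MeasureTheory.measure_preimage_add, MeasureTheory.Measure.addHaar_smul,
    e3, Complex.finrank_real_complex, abs_of_nonneg (by positivity)]

/-! ### Scaling to unit area and placements in the Euclidean plane -/

namespace Shape

variable (S : Shape)

lemma volume_tile_pos : 0 < MeasureTheory.volume (S.tile 0 1) :=
  (Metric.measure_ball_pos _ 0 S.rad_pos).trans_le (MeasureTheory.measure_mono
    ((ball_subset_interior_tile (by simp)).trans interior_subset))

lemma volume_tile_lt_top : MeasureTheory.volume (S.tile 0 1) < ⊤ := by
  rw [← convexHull_eq_tile]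
  exact ((finite_range S.v).isCompact_convexHull (𝕜 := ℝ)).measure_lt_top

/-- The factor by which the pentagon has to be scaled to obtain unit area. -/
noncomputable def scale : ℝ := (√(MeasureTheory.volume (S.tile 0 1)).toReal)⁻¹

lemma scale_pos : 0 < S.scale :=
  inv_pos.2 (Real.sqrt_pos.2 (ENNReal.toReal_pos S.volume_tile_pos.ne' S.volume_tile_lt_top.ne))

lemma scale_sq_mul : ENNReal.ofReal (S.scale ^ 2) * MeasureTheory.volume (S.tile 0 1) = 1 := by
  have h := ENNReal.toReal_pos S.volume_tile_pos.ne' S.volume_tile_lt_top.ne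
  rw [← ENNReal.ofReal_toReal S.volume_tile_lt_top.ne, ← ENNReal.ofReal_mul (by positivity), scale,
    inv_pow, Real.sq_sqrt h.le, inv_mul_cancel₀ h.ne', ENNReal.ofReal_one]

lemma eq_scale {r : ℝ} (hr : 0 < r)
    (h : ENNReal.ofReal (r ^ 2) * MeasureTheory.volume (S.tile 0 1) = 1) : r = S.scale := by
  rw [← S.scale_sq_mul] at h
  have h1 := (ENNReal.mul_left_inj S.volume_tile_pos.ne' S.volume_tile_lt_top.ne).1 h
  rw [ENNReal.ofReal_eq_ofReal_iff (by positivity) (by positivity)] at h1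
  exact (pow_left_inj₀ hr.le S.scale_pos.le two_ne_zero).1 h1

/-- The similarity from the complex plane to the Euclidean plane that scales the pentagon to unit
area. -/
noncomputable def emb : ℂ ≃L[ℝ] Plane :=
  (LinearEquiv.smulOfNeZero ℝ ℂ S.scale S.scale_pos.ne').toContinuousLinearEquiv.trans
    toC.symm.toContinuousLinearEquiv

lemma emb_apply (z : ℂ) : S.emb z = toC.symm (S.scale * z) := by
  rw [← real_smul]; rfl

lemma toC_emb (z : ℂ) : toC (S.emb z) = S.scale * z := by
  rw [emb_apply, LinearIsometryEquiv.apply_symm_apply]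

lemma inner_emb (a b : ℂ) : inner ℝ (S.emb a) (S.emb b) = S.scale ^ 2 * inner ℝ a b := by
  rw [← toC.inner_map_map, toC_emb, toC_emb, inner_eq, inner_eq]
  simp only [re_ofReal_mul, im_ofReal_mul]; ring

lemma norm_emb (a : ℂ) : ‖S.emb a‖ = S.scale * ‖a‖ := by
  rw [← toC.norm_map, toC_emb, norm_mul, norm_real, Real.norm_of_nonneg S.scale_pos.le]

/-- The placement of the pentagon in the Euclidean plane with centre `c` and rotation `u`. -/
noncomputable def place (c u : ℂ) : ℂ →ᵃ[ℝ] Plane :=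
  (S.emb.toLinearEquiv.toLinearMap ∘ₗ LinearMap.mulLeft ℝ u).toAffineMap +
    AffineMap.const ℝ ℂ (S.emb c)

lemma place_apply (c u z : ℂ) : S.place c u z = S.emb (c + u * z) := by
  rw [map_add, add_comm]; rfl

lemma place_mul (c u c' u' z : ℂ) :
    S.place (c + u * c') (u * u') z = S.place c u (c' + u' * z) := by
  rw [place_apply, place_apply]; congr 1; ring

variable {S} {c u c' u' : ℂ}

lemma place_injective (hu : ‖u‖ = 1) : Function.Injective (S.place c u) := by
  intro x y h
  rw [place_apply, place_apply] at h
  have h1 := add_left_cancel (S.emb.injective h)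
  exact mul_left_cancel₀ (by rintro rfl; simp at hu) h1

lemma image_place_tile (hu : ‖u‖ = 1) (hu' : ‖u'‖ = 1) :
    S.place c u '' S.tile c' u' = S.emb '' S.tile (c + u * c') (u * u') := by
  rw [S.tile_eq_image hu', S.tile_eq_image (by rw [norm_mul, hu, hu', one_mul] : ‖u * u'‖ = 1),
    image_image, image_image]
  refine image_congr fun z _ => ?_
  rw [place_apply]; congr 1; ring

lemma image_place_tile_zero (hu : ‖u‖ = 1) :
    S.place c u '' S.tile 0 1 = S.emb '' S.tile c u := by
  rw [image_place_tile hu (by simp), mul_zero, add_zero, mul_one]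

lemma image_place_convexHull (hu : ‖u‖ = 1) :
    convexHull ℝ (S.place c u '' range S.v) = S.emb '' S.tile c u := by
  rw [← AffineMap.image_convexHull, convexHull_eq_tile, image_place_tile_zero hu]

lemma volume_emb_tile (hu : ‖u‖ = 1) : MeasureTheory.volume (S.emb '' S.tile c u) = 1 := by
  rw [← S.scale_sq_mul, ← volume_image_similarity toC (S.scale * c) hu, tile_eq_image hu, image_image,
    image_image]
  congr 1
  refine image_congr fun z _ => ?_
  rw [emb_apply]; congr 1; ring

/-- A pentagon with the angles of `S` is a placement of `S`, in one of two orientations. -/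
lemma Model.exists_place {θ : Fin 5 → ℝ} (M : S.Model θ) {P : Pentagon} (h : HasAngles θ P) :
    ∃ c u, ‖u‖ = 1 ∧ region P = S.emb '' S.tile c u ∧
      ((∀ k, P k = S.place c u (S.v k)) ∨ (∀ k, P k = S.place c u (S.v (M.flip k)))) := by
  have hr : ∀ (L : Plane ≃ₗᵢ[ℝ] ℂ) {o : ℂ} {r : ℝ} {μ : ℂ}, 0 < r → ‖μ‖ = 1 →
      (∀ k, L (P k) = o + r * (μ * S.v k)) → r = S.scale := by
    intro L o r μ hr hμ hP
    apply S.eq_scale hr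
    rw [← volume_image_similarity L o hμ, ← h.2.1, ← convexHull_eq_tile, region]
    have e : range P.vertices = (fun z => L.symm (o + r * (μ * z))) '' range S.v := by
      rw [← range_comp]
      congr 1
      funext k
      exact (L.symm_apply_eq.2 (hP k).symm).symm
    rw [e, image_image]
    congr 1
    let g : ℂ →ᵃ[ℝ] Plane := (L.symm.toLinearEquiv.toLinearMap ∘ₗ
      LinearMap.mulLeft ℝ ((r : ℂ) * μ)).toAffineMap + AffineMap.const ℝ ℂ (L.symm o)
    have hg : ∀ z, g z = L.symm (o + r * (μ * z)) := by
      intro z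
      rw [map_add, add_comm, ← mul_assoc]; rfl
    have := AffineMap.image_convexHull g (range S.v)
    simp only [hg] at this
    exact this
  have hreg : ∀ {c u : ℂ}, ‖u‖ = 1 → ((∀ k, P k = S.place c u (S.v k)) ∨
      (∀ k, P k = S.place c u (S.v (M.flip k)))) → region P = S.emb '' S.tile c u := by
    intro c u hu hP
    rw [← image_place_convexHull hu, region]
    congr 1
    rcases hP with hP | hP
    · rw [← range_comp]; congr 1; funext k; exact hP k
    · apply Subset.antisymm
      · rintro _ ⟨k, rfl⟩
        exact ⟨_, mem_range_self (M.flip k), (hP k).symm⟩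
      · rintro _ ⟨_, ⟨k, rfl⟩, rfl⟩
        refine ⟨M.flip k, ?_⟩
        have := hP (M.flip k)
        rwa [M.flip_flip] at this
  have hs : (S.scale : ℂ) ≠ 0 := by exact_mod_cast S.scale_pos.ne'
  rcases h.1.orientation toC with ho | ho
  · obtain ⟨o, r, μ, hr0, hμ, hP⟩ := recognise_of_orientation M h toC ho
    obtain rfl := hr toC hr0 hμ hP
    have hP' : ∀ k, P k = S.place (o / S.scale) μ (S.v k) := by
      intro k
      apply toC.injective
      rw [hP, place_apply, toC_emb]
      field_simp
    exact ⟨_, μ, hμ, hreg hμ (Or.inl hP'), Or.inl hP'⟩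
  -- A clockwise pentagon becomes counterclockwise after complex conjugation; by the mirror symmetry
  -- `M.conj_v`, conjugating back yields a direct placement with relabelled vertices.
  · set L := toC.trans conjLIE with hL
    have hLc : ∀ x, L x = conj (toC x) := fun x => rfl
    obtain ⟨o, r, μ, hr0, hμ, hP⟩ := recognise_of_orientation M h L (by
      intro k
      have := ho k
      simp only [hLc, cross, sub_re, sub_im, conj_re, conj_im] at *
      linarith)
    obtain rfl := hr L hr0 hμ hP
    have hμ' : ‖conj μ‖ = 1 := by rw [RCLike.norm_conj, hμ]
    have hP' : ∀ k, P k = S.place (conj o / S.scale) (conj μ) (S.v (M.flip k)) := by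
      intro k
      apply toC.injective
      have h1 := congrArg conj (hP k)
      rw [hLc, Complex.conj_conj, map_add, map_mul, map_mul, conj_ofReal, M.conj_v] at h1
      rw [h1, place_apply, toC_emb]
      field_simp
    exact ⟨_, _, hμ', hreg hμ' (Or.inr hP'), Or.inr hP'⟩

variable (S) in
/-- The pentagon `S`, placed in the Euclidean plane. -/
noncomputable def pentagon (c u : ℂ) : Pentagon := ⟨fun k => S.place c u (S.v k)⟩

lemma pentagon_apply (k : Fin 5) : S.pentagon c u k = S.emb (c + u * S.v k) :=
  S.place_apply c u (S.v k)

lemma region_pentagon (hu : ‖u‖ = 1) : region (S.pentagon c u) = S.emb '' S.tile c u := by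
  rw [← image_place_convexHull hu, region, ← range_comp]; rfl

lemma isConvex_pentagon (hu : ‖u‖ = 1) : IsConvex (S.pentagon c u) := by
  rw [isConvex_iff toC]
  have h1 : ∀ i j, toC (S.pentagon c u j) - toC (S.pentagon c u i)
      = S.scale * (u * (S.v j - S.v i)) := by
    intro i j
    rw [pentagon_apply, pentagon_apply, toC_emb, toC_emb]; ring
  have h2 : ∀ i, S.v (i + 1) - S.v i = S.len i * S.f i := fun i => by rw [S.v_succ]; ring
  have h3 : ∀ i j, j ≠ i → j ≠ i + 1 → 0 < cross (toC (S.pentagon c u (i + 1)) -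
      toC (S.pentagon c u i)) (toC (S.pentagon c u j) - toC (S.pentagon c u i)) := by
    intro i j hj hj'
    rw [h1, h1, real_mul_cross, cross_real_mul, cross_unit_mul hu, h2, real_mul_cross, cross_sub,
      S.cross_v]
    have := S.conv i j hj hj'
    have := S.scale_pos
    have := S.len_pos i
    have h0 : 0 < cross (S.f i) (S.v j) - -S.rad := by linarith
    positivity
  refine ⟨fun i h => ?_, fun i j k a b c d => mul_pos (h3 i j a b) (h3 i k c d)⟩
  have := h3 i (i - 1) (by simp) (by rw [Ne, sub_eq_iff_eq_add, add_assoc]; simp)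
  rw [← h, sub_self, cross_swap, cross_zero, neg_zero] at this
  exact lt_irrefl _ this

lemma hasAngles_pentagon {θ : Fin 5 → ℝ} (M : S.Model θ) (hu : ‖u‖ = 1) :
    HasAngles θ (S.pentagon c u) := by
  refine ⟨isConvex_pentagon hu, by rw [region_pentagon hu, volume_emb_tile hu], ?_, ?_⟩
  · refine ⟨⟨S.emb c, S.scale * S.rad⟩, mul_pos S.scale_pos S.rad_pos, fun k => ?_⟩
    have hperp : ∀ x : ℝ, inner ℝ (S.emb (c + u * (S.v k + x * S.f k)) -
        S.emb (c + u * (S.v k + M.foot k * S.f k)))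
        (S.emb (c + u * (S.v k + M.foot k * S.f k)) - S.emb c) = 0 := by
      intro x
      rw [← map_sub, ← map_sub, inner_emb, M.foot_eq]
      have e1 : c + u * (S.v k + x * S.f k) - (c + u * -(S.rad * (I * S.f k)))
          = (x - M.foot k : ℝ) * (u * S.f k) := by
        rw [← M.foot_eq]; push_cast; ring
      have e2 : c + u * -(S.rad * (I * S.f k)) - c = (-S.rad : ℝ) * (I * (u * S.f k)) := by
        push_cast; ring
      rw [e1, e2, inner_eq]
      simp only [re_ofReal_mul, im_ofReal_mul, I_mul_re, I_mul_im]
      ring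
    have hend := hperp (S.len k)
    have hst := hperp 0
    rw [← S.v_succ] at hend
    rw [ofReal_zero, zero_mul, add_zero] at hst
    have hmem : S.emb (c + u * (S.v k + M.foot k * S.f k)) ∈ (S.pentagon c u).edgeSet ℝ k := by
      have hl := S.len_pos k
      rw [edgeSet_eq]
      refine ⟨1 - M.foot k / S.len k, M.foot k / S.len k, ?_, div_nonneg (M.foot_nonneg k) hl.le,
        by ring, ?_⟩
      · have := (div_le_one hl).2 (M.foot_le k)
        linarith
      · rw [pentagon_apply, pentagon_apply, ← map_smul, ← map_smul, ← map_add, S.v_succ, real_smul,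
          real_smul]
        congr 1
        have hl' : (S.len k : ℂ) ≠ 0 := by exact_mod_cast hl.ne'
        push_cast
        field_simp
        ring
    refine ⟨_, hmem, ⟨?_, ?_, ?_⟩⟩
    · rw [EuclideanGeometry.mem_sphere, dist_eq_norm, ← map_sub, norm_emb, M.foot_eq]
      simp [hu, S.norm_f, abs_of_pos S.rad_pos]
    · rw [Polygon.edgeSet] at hmem
      exact affineSegment_subset_affineSpan _ _ _ hmem
    · rw [finRotate_eq, pentagon_apply, pentagon_apply]
      exact affineSpan_pair_le_of_mem_of_mem
        (EuclideanGeometry.Sphere.mem_orthRadius_iff_inner_left.2 hst)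
        (EuclideanGeometry.Sphere.mem_orthRadius_iff_inner_left.2 hend)
  · intro k
    rw [interiorAngle, EuclideanGeometry.angle, finRotate_eq, finRotate_symm_eq, vsub_eq_sub,
      vsub_eq_sub, InnerProductGeometry.angle, pentagon_apply, pentagon_apply, pentagon_apply,
      ← map_sub, ← map_sub, inner_emb, norm_emb, norm_emb]
    have e1 : c + u * S.v (k - 1) - (c + u * S.v k) = (-S.len (k - 1) : ℝ) * (u * S.f (k - 1)) := by
      have := S.v_succ (k - 1)
      rw [sub_add_cancel] at this
      rw [this]; push_cast; ring
    have e2 : c + u * S.v (k + 1) - (c + u * S.v k) = (S.len k : ℝ) * (u * S.f k) := by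
      rw [S.v_succ]; ring
    have h1 := S.len_pos (k - 1)
    have h2 := S.len_pos k
    have h3 := S.scale_pos
    have h4 := sq_add_sq_of_unit hu
    have h5 : inner ℝ ((-S.len (k - 1) : ℝ) * (u * S.f (k - 1))) ((S.len k : ℝ) * (u * S.f k))
        = S.len (k - 1) * S.len k * (S.q k).re := by
      rw [inner_eq]
      simp only [re_ofReal_mul, im_ofReal_mul]
      simp only [mul_re, mul_im, q, neg_re, conj_re, conj_im]
      linear_combination (-S.len (k - 1) * S.len k * ((S.f (k - 1)).re * (S.f k).re +
        (S.f (k - 1)).im * (S.f k).im)) * h4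
    rw [e1, e2, h5]
    simp only [norm_mul, norm_real, hu, S.norm_f, norm_neg, Real.norm_of_nonneg h1.le, mul_one,
      Real.norm_of_nonneg h2.le]
    rw [show S.scale ^ 2 * (S.len (k - 1) * S.len k * (S.q k).re) /
      (S.scale * S.len (k - 1) * (S.scale * S.len k)) = (S.q k).re by field_simp, M.re_q,
      Real.arccos_cos (M.nonneg k) (M.le_pi k)]

end Shape

end PentagonTiling

namespace PentagonTiling

open Complex Filter Topology Set
open scoped ComplexConjugate

/-! ### Vertices and edges of a region -/

namespace Shape

variable {S : Shape} {c u c' u' p : ℂ} {P : Pentagon}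

/-- A constraint that is tight inside an open segment of the tile is tight at both ends. At a vertex
two constraints with independent directions are tight, so both ends equal the vertex. -/
lemma vertex_mem_extremePoints (hu : ‖u‖ = 1) (k : Fin 5) :
    c + u * S.v k ∈ extremePoints ℝ (S.tile c u) := by
  have key : ∀ j, cross (S.f j) (S.v k) = -S.rad → ∀ x₁ ∈ S.tile c u, ∀ x₂ ∈ S.tile c u,
      c + u * S.v k ∈ openSegment ℝ x₁ x₂ →
        cross (u * S.f j) (x₁ - c) = -S.rad ∧ cross (u * S.f j) (x₂ - c) = -S.rad := by
    rintro j hj x₁ h₁ x₂ h₂ ⟨a, b, ha, hb, hab, h⟩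
    have e : u * S.v k = a * (x₁ - c) + b * (x₂ - c) := by
      have hab' : (a : ℂ) + b = 1 := by exact_mod_cast hab
      rw [real_smul, real_smul] at h
      linear_combination -h + c * hab'
    have e2 : cross (u * S.f j) (u * S.v k) = a * cross (u * S.f j) (x₁ - c) +
        b * cross (u * S.f j) (x₂ - c) := by
      rw [e, cross_add, cross_real_mul, cross_real_mul]
    rw [cross_unit_mul hu, hj] at e2
    have g₁ := h₁ j
    have g₂ := h₂ j
    have m₁ := mul_nonneg ha.le (by linarith : 0 ≤ cross (u * S.f j) (x₁ - c) + S.rad)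
    have m₂ := mul_nonneg hb.le (by linarith : 0 ≤ cross (u * S.f j) (x₂ - c) + S.rad)
    have m : a * (cross (u * S.f j) (x₁ - c) + S.rad) + b * (cross (u * S.f j) (x₂ - c) + S.rad)
        = 0 := by linear_combination -e2 + S.rad * hab
    constructor
    · have := (mul_eq_zero.1 (by linarith : a * (cross (u * S.f j) (x₁ - c) + S.rad) = 0))
      rcases this with h0 | h0 <;> linarith
    · have := (mul_eq_zero.1 (by linarith : b * (cross (u * S.f j) (x₂ - c) + S.rad) = 0))
      rcases this with h0 | h0 <;> linarith
  have hk := S.cross_v k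
  have hk' := S.cross_v_succ (k - 1)
  rw [sub_add_cancel] at hk'
  have hne : cross (u * S.f (k - 1)) (u * S.f k) ≠ 0 := by
    rw [cross_unit_mul hu]; exact (S.turn' k).ne'
  have fin : ∀ x, cross (u * S.f k) (x - c) = -S.rad → cross (u * S.f (k - 1)) (x - c) = -S.rad →
      x = c + u * S.v k := by
    intro x h1 h2
    have := eq_of_cross_eq (x := x - c) (y := u * S.v k) hne
      (by rw [h2, cross_unit_mul hu, hk']) (by rw [h1, cross_unit_mul hu, hk])
    rw [← this]; ring
  rw [mem_extremePoints]
  refine ⟨vertex_mem_tile hu k, fun x₁ h₁ x₂ h₂ h => ?_⟩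
  have a := key k hk x₁ h₁ x₂ h₂ h
  have b := key (k - 1) hk' x₁ h₁ x₂ h₂ h
  exact ⟨fin _ a.1 b.1, fin _ a.2 b.2⟩

lemma edge_notMem_extremePoints (hu : ‖u‖ = 1) (k : Fin 5) {s : ℝ} (hs : 0 < s)
    (hs' : s < S.len k) : c + u * (S.v k + s * S.f k) ∉ extremePoints ℝ (S.tile c u) := by
  intro h
  have hl := S.len_pos k
  have h1 := (mem_extremePoints.1 h).2 _ (vertex_mem_tile hu k) _ (vertex_mem_tile hu (k + 1)) (by
    refine ⟨1 - s / S.len k, s / S.len k, ?_, div_pos hs hl, by ring, ?_⟩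
    · have := (div_lt_one hl).2 hs'
      linarith
    · rw [S.v_succ, real_smul, real_smul]
      have hl' : (S.len k : ℂ) ≠ 0 := by exact_mod_cast hl.ne'
      push_cast
      field_simp
      ring)
  have h2 : u * (s * S.f k) = 0 := by linear_combination -h1.1
  have h3 := congrArg norm h2
  rw [norm_mul, norm_mul, hu, S.norm_f, norm_real, Real.norm_of_nonneg hs.le, norm_zero] at h3
  linarith

/-- `IsEdgeToEdge` and `IsVertexOfDegree` quantify over all convex pentagons with a given region,
whatever their labelling; extreme points recover the vertices from the region. -/
lemma exists_vertex_eq (hu : ‖u‖ = 1) (hP : region P = S.emb '' S.tile c u) (k : Fin 5) :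
    ∃ i, P i = S.place c u (S.v k) := by
  have h1 := mem_image_of_mem S.emb (vertex_mem_extremePoints (S := S) (c := c) hu k)
  rw [image_extremePoints, ← hP, region] at h1
  obtain ⟨i, hi⟩ := extremePoints_convexHull_subset h1
  exact ⟨i, hi.trans (S.place_apply c u _).symm⟩

lemma v_injective : Function.Injective S.v := by
  have key : ∀ i j, j ≠ i → j ≠ i + 1 → S.v i ≠ S.v j := by
    intro i j h1 h2 h
    have := S.conv i j h1 h2
    rw [← h, S.cross_v] at this
    exact lt_irrefl _ this
  intro i j h
  by_contra hne
  have h1 : j = i + 1 := by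
    by_contra h1
    exact key i j (Ne.symm hne) h1 h
  have h2 : i = j + 1 := by
    by_contra h2
    exact key j i hne h2 h.symm
  rw [h1] at h2
  revert h2
  have : ∀ i : Fin 5, i ≠ i + 1 + 1 := by decide
  exact this i

/-- The two vertices next to a diagonal are on opposite sides. -/
lemma cross_diagonal (S : Shape) (a : Fin 5) :
    cross (S.v (a + 2) - S.v a) (S.v (a + 1) - S.v a) < 0 ∧
      0 < cross (S.v (a + 2) - S.v a) (S.v (a + 3) - S.v a) := by
  have d : ∀ a : Fin 5, a + 2 ≠ a ∧ a + 2 ≠ a + 1 ∧ a ≠ a + 2 ∧ a ≠ a + 2 + 1 ∧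
    a + 3 = a + 2 + 1 := by decide
  obtain ⟨d1, d2, d3, d4, d5⟩ := d a
  constructor
  · have h1 := S.conv a (a + 2) d1 d2
    have h2 := S.cross_v a
    rw [S.v_succ a, add_sub_cancel_left, cross_real_mul, cross_swap, cross_sub, h2]
    have := mul_pos (S.len_pos a) (by linarith : 0 < cross (S.f a) (S.v (a + 2)) - -S.rad)
    linarith
  · have h1 := S.conv (a + 2) a d3 d4
    have h2 := S.cross_v (a + 2)
    rw [d5, S.v_succ (a + 2)]
    have e : cross (S.v (a + 2) - S.v a) (S.v (a + 2) + S.len (a + 2) * S.f (a + 2) - S.v a)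
        = S.len (a + 2) * (cross (S.f (a + 2)) (S.v a) - cross (S.f (a + 2)) (S.v (a + 2))) := by
      simp only [cross, sub_re, sub_im, add_re, add_im, re_ofReal_mul, im_ofReal_mul]; ring
    rw [e, h2]
    exact mul_pos (S.len_pos _) (by linarith)

/-- Vertices of `P` correspond to those of `S` through `φ`. The two neighbours of `φ k` in `P` come
from neighbours of `k` in `S`, and being distinct they include `φ (k + 1)`. -/
lemma exists_edge_eq (hc : IsConvex P) (hu : ‖u‖ = 1) (hP : region P = S.emb '' S.tile c u)
    (k : Fin 5) :
    ∃ i, P.edgeSet ℝ i = S.place c u '' segment ℝ (S.v k) (S.v (k + 1)) := by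
  choose φ hφ using exists_vertex_eq hu hP
  have hinj : Function.Injective φ := by
    intro i j h
    apply v_injective (S := S)
    apply place_injective (S := S) (c := c) hu
    rw [← hφ, ← hφ, h]
  have hsurj := Finite.surjective_of_injective hinj
  have hcr : ∀ a b j : Fin 5, cross (toC (P (φ b)) - toC (P (φ a)))
      (toC (P (φ j)) - toC (P (φ a))) = S.scale ^ 2 * cross (S.v b - S.v a) (S.v j - S.v a) := by
    intro a b j
    have e : ∀ b, toC (P (φ b)) - toC (P (φ a)) = S.scale * (u * (S.v b - S.v a)) := by
      intro b
      rw [hφ, hφ, place_apply, place_apply, toC_emb, toC_emb]; ring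
    rw [e, e, real_mul_cross, cross_real_mul, cross_unit_mul hu]; ring
  obtain ⟨-, hside⟩ := (isConvex_iff toC).1 hc
  -- An edge of the convex pentagon `P` has the other vertices on one side, while a diagonal of `S`
  -- has vertices on both sides.
  have hnd : ∀ a b : Fin 5, φ b = φ a + 1 → b ≠ a + 2 ∧ a ≠ b + 2 := by
    have d : ∀ a : Fin 5, a + 1 ≠ a ∧ a + 1 ≠ a + 2 ∧ a + 3 ≠ a ∧ a + 3 ≠ a + 2 := by decide
    have hs := pow_pos S.scale_pos 2
    intro a b hab
    constructor
    · rintro rfl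
      obtain ⟨d1, d2, d3, d4⟩ := d a
      have h1 := hside (φ a) (φ (a + 1)) (φ (a + 3)) (hinj.ne d1) (by rw [← hab]; exact hinj.ne d2)
        (hinj.ne d3) (by rw [← hab]; exact hinj.ne d4)
      rw [← hab, hcr, hcr] at h1
      obtain ⟨g1, g2⟩ := S.cross_diagonal a
      have := mul_neg_of_neg_of_pos (mul_neg_of_pos_of_neg hs g1) (mul_pos hs g2)
      linarith
    · rintro rfl
      obtain ⟨d1, d2, d3, d4⟩ := d b
      have h1 := hside (φ (b + 2)) (φ (b + 1)) (φ (b + 3)) (hinj.ne d2)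
        (by rw [← hab]; exact hinj.ne d1) (hinj.ne d4) (by rw [← hab]; exact hinj.ne d3)
      rw [← hab, hcr, hcr] at h1
      obtain ⟨g1, g2⟩ := S.cross_diagonal b
      have r : ∀ x, cross (S.v b - S.v (b + 2)) (x - S.v (b + 2))
          = -cross (S.v (b + 2) - S.v b) (x - S.v b) := by
        intro x; simp only [cross, sub_re, sub_im]; ring
      rw [r, r] at h1
      have := mul_neg_of_neg_of_pos (mul_neg_of_pos_of_neg hs g1) (mul_pos hs g2)
      linarith
  obtain ⟨a, ha⟩ := hsurj (φ k + 1)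
  obtain ⟨b, hb⟩ := hsurj (φ k - 1)
  have h1 := hnd k a ha
  have h2 := hnd b k (by rw [hb, sub_add_cancel])
  have hne : a ≠ b := by
    rintro rfl
    rw [ha] at hb
    have : ∀ i : Fin 5, i + 1 ≠ i - 1 := by decide
    exact this _ hb
  have hak : a ≠ k := by
    rintro rfl
    have : ∀ i : Fin 5, i ≠ i + 1 := by decide
    exact this _ ha
  have hbk : b ≠ k := by
    rintro rfl
    have : ∀ i : Fin 5, i ≠ i - 1 := by decide
    exact this _ hb
  have hcase : a = k + 1 ∨ b = k + 1 := by
    have d : ∀ a k : Fin 5, a ≠ k + 2 ∧ k ≠ a + 2 → a ≠ k → a = k + 1 ∨ a = k - 1 := by decide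
    rcases d a k h1 hak with h3 | h3
    · exact Or.inl h3
    · rcases d b k h2.symm hbk with h4 | h4
      · exact Or.inr h4
      · exact absurd (h3.trans h4.symm) hne
  rcases hcase with rfl | rfl
  · refine ⟨φ k, ?_⟩
    rw [edgeSet_eq, image_segment, ← ha, hφ, hφ]
  · refine ⟨φ (k + 1), ?_⟩
    rw [edgeSet_eq, image_segment, hb, sub_add_cancel, ← hb, hφ, hφ, segment_symm]

/-! ### Tilings of the Euclidean plane and of the complex plane -/

variable (S) in
/-- The tiling of the complex plane corresponding to a tiling of the Euclidean plane. -/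
def pull (𝒯 : Set (Set Plane)) : Set (Set ℂ) := {X | S.emb '' X ∈ 𝒯}

variable {θ : Fin 5 → ℝ} {𝒯 : Set (Set Plane)} {𝒮 : Set (Set ℂ)}

lemma image_emb_interior (X : Set ℂ) : S.emb '' interior X = interior (S.emb '' X) :=
  S.emb.toHomeomorph.image_interior X

lemma Model.exists_tile (M : S.Model θ) (h : IsTilingBy (HasAngles θ) 𝒯) {T : Set Plane}
    (hT : T ∈ 𝒯) : ∃ c u, ‖u‖ = 1 ∧ T = S.emb '' S.tile c u := by
  obtain ⟨P, hP, rfl⟩ := h.1 T hT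
  obtain ⟨c, u, hu, hr, -⟩ := M.exists_place hP
  exact ⟨c, u, hu, hr⟩

lemma Model.isTiling_pull (M : S.Model θ) (h : IsTilingBy (HasAngles θ) 𝒯) :
    S.IsTiling (S.pull 𝒯) where
  tiles X hX := by
    obtain ⟨c, u, hu, hr⟩ := M.exists_tile h hX
    exact ⟨c, u, hu, S.emb.injective.image_injective hr⟩
  cover z := by
    have hz : S.emb z ∈ ⋃₀ 𝒯 := by rw [h.2.1]; trivial
    obtain ⟨T, hT, hz⟩ := hz
    obtain ⟨c, u, hu, rfl⟩ := M.exists_tile h hT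
    exact ⟨_, hT, (S.emb.injective.mem_set_image).1 hz⟩
  sep X hX Y hY z hz hz' := by
    by_contra hne
    have h1 := h.2.2 hX hY (fun e => hne (S.emb.injective.image_injective e))
      ⟨mem_image_of_mem S.emb hz, mem_image_of_mem S.emb (interior_subset hz')⟩
    have h2 := mem_image_of_mem S.emb hz'
    rw [image_emb_interior] at h2
    exact h1.2.2 h2

lemma Model.image_pull (M : S.Model θ) (h : IsTilingBy (HasAngles θ) 𝒯) :
    𝒯 = (fun X => S.emb '' X) '' S.pull 𝒯 := by
  apply Subset.antisymm
  · intro T hT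
    obtain ⟨c, u, hu, rfl⟩ := M.exists_tile h hT
    exact ⟨_, hT, rfl⟩
  · rintro _ ⟨X, hX, rfl⟩
    exact hX

lemma Model.isTilingBy_image (M : S.Model θ) (h : S.IsTiling 𝒮) :
    IsTilingBy (HasAngles θ) ((fun X => S.emb '' X) '' 𝒮) := by
  refine ⟨?_, ?_, ?_⟩
  · rintro _ ⟨X, hX, rfl⟩
    obtain ⟨c, u, hu, rfl⟩ := h.tiles X hX
    exact ⟨S.pentagon c u, hasAngles_pentagon M hu, region_pentagon hu⟩
  · rw [eq_univ_iff_forall]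
    intro x
    obtain ⟨X, hX, hx⟩ := h.cover (S.emb.symm x)
    exact ⟨_, ⟨X, hX, rfl⟩, _, hx, S.emb.apply_symm_apply x⟩
  · have key : ∀ X ∈ 𝒮, ∀ Y ∈ 𝒮, X ≠ Y → ∀ z ∈ X, z ∈ Y → S.emb z ∈ frontier (S.emb '' Y) := by
      intro X hX Y hY hne z hz hz'
      refine ⟨subset_closure (mem_image_of_mem _ hz'), fun hi => hne (h.sep X hX Y hY z hz ?_)⟩
      rw [← image_emb_interior] at hi
      exact (S.emb.injective.mem_set_image).1 hi
    rintro _ ⟨X, hX, rfl⟩ _ ⟨Y, hY, rfl⟩ hne _ ⟨⟨z, hz, rfl⟩, hz'⟩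
    rw [S.emb.injective.mem_set_image] at hz'
    have hXY : X ≠ Y := fun e => hne (by rw [e])
    have hfr := key X hX Y hY hXY z hz hz'
    exact ⟨key Y hY X hX hXY.symm z hz' hz, hfr⟩

/-- In an edge-to-edge tiling no vertex lies in the interior of an edge. -/
lemma vertexCond_pull (h : IsEdgeToEdge 𝒯) : S.VertexCond (S.pull 𝒯) := by
  rintro p e k e' k' s' ⟨c, u, hu, hX, -, hp, -, -⟩ ⟨c', u', hu', hX', -, hp', hs, hs'⟩
  by_contra hne
  have hs0 : 0 < s' := lt_of_le_of_ne hs (Ne.symm hne)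
  rw [ofReal_zero, zero_mul, add_zero] at hp
  have hext : p ∈ extremePoints ℝ (S.tile c u) := hp ▸ vertex_mem_extremePoints hu k
  have hnext : p ∉ extremePoints ℝ (S.tile c' u') := hp' ▸ edge_notMem_extremePoints hu' k' hs0 hs'
  have hmem' : p ∈ S.tile c' u' := hp' ▸ vertex_add_mem_tile hu' k' hs hs'.le
  have hnv : ∀ j, S.pentagon c' u' j ≠ S.emb p := by
    intro j hj
    rw [pentagon_apply] at hj
    exact hnext (S.emb.injective hj ▸ vertex_mem_extremePoints hu' j)
  have hint : S.emb p ∈ region (S.pentagon c u) ∩ region (S.pentagon c' u') := by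
    rw [region_pentagon hu, region_pentagon hu']
    exact ⟨mem_image_of_mem _ hext.1, mem_image_of_mem _ hmem'⟩
  rcases h (S.pentagon c u) (S.pentagon c' u') (isConvex_pentagon hu) (isConvex_pentagon hu')
    (by rw [region_pentagon hu]; exact hX) (by rw [region_pentagon hu']; exact hX')
    (by
      rw [region_pentagon hu, region_pentagon hu']
      intro h0
      rw [S.emb.injective.image_injective h0] at hext
      exact hnext hext) with h0 | ⟨i, j, h0, h1⟩ | ⟨i, j, h0, h1⟩
  · rw [h0] at hint; exact hint
  · rw [h0, h1] at hint
    exact hnv j hint.symm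
  -- Being extreme in the first tile, the point is extreme in the shared edge contained in it, hence
  -- an endpoint of that edge and a vertex of the second tile.
  · have h2 : S.emb p ∈ extremePoints ℝ (S.emb '' S.tile c u) := by
      rw [← image_extremePoints]; exact mem_image_of_mem _ hext
    rw [h0, h1] at hint
    have hsub : (S.pentagon c' u').edgeSet ℝ j ⊆ S.emb '' S.tile c u := by
      rw [← h1, ← h0, ← region_pentagon hu]; exact inter_subset_left
    have h3 := inter_extremePoints_subset_extremePoints_of_subset hsub ⟨hint, h2⟩
    rw [edgeSet_eq, ← convexHull_pair] at h3
    rcases extremePoints_convexHull_subset h3 with h4 | h4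
    · exact hnv _ h4.symm
    · exact hnv _ h4.symm

end Shape

/-! ### The periodic tiling in the Euclidean plane -/

namespace Adjacency

variable {S : Shape} {A : Adjacency S} {c u c' u' p : ℂ} {θ : Fin 5 → ℝ} {𝒯 : Set (Set Plane)}

variable (A) in
/-- The periodic tiling of the Euclidean plane with one tile centred at `c` and rotated by `u`. -/
def planeTiling (c u : ℂ) : Set (Set Plane) :=
  {T | ∃ c' u', A.Orbit c' u' ∧ T = S.place c u '' S.tile c' u'}

lemma image_tilingAt (hu : ‖u‖ = 1) : (fun X => S.emb '' X) '' A.tilingAt c u = A.planeTiling c u := by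
  apply Subset.antisymm
  · rintro _ ⟨_, ⟨c', u', h', rfl⟩, rfl⟩
    exact ⟨c', u', h', (Shape.image_place_tile hu h'.norm_eq_one).symm⟩
  · rintro _ ⟨c', u', h', rfl⟩
    exact ⟨_, ⟨c', u', h', rfl⟩, (Shape.image_place_tile hu h'.norm_eq_one).symm⟩

lemma isTilingBy_planeTiling (M : S.Model θ) (hN : A.Near) (hu : ‖u‖ = 1) :
    IsTilingBy (HasAngles θ) (A.planeTiling c u) := by
  rw [← image_tilingAt hu]
  exact M.isTilingBy_image (isTiling_tilingAt hN hu)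

lemma eq_planeTiling (M : S.Model θ) (hN : A.Near) (h : IsTilingBy (HasAngles θ) 𝒯)
    (hnb : ∀ c u, ‖u‖ = 1 → S.tile c u ∈ S.pull 𝒯 →
      ∀ k, S.tile (c + u * S.d k) (u * A.w k) ∈ S.pull 𝒯)
    (hu : ‖u‖ = 1) (hX : S.emb '' S.tile c u ∈ 𝒯) : 𝒯 = A.planeTiling c u := by
  rw [M.image_pull h, eq_tilingAt hN (M.isTiling_pull h) hnb hu hX, image_tilingAt hu]

lemma exists_eq_planeTiling (M : S.Model θ) (hN : A.Near) (h : IsTilingBy (HasAngles θ) 𝒯)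
    (hnb : ∀ c u, ‖u‖ = 1 → S.tile c u ∈ S.pull 𝒯 →
      ∀ k, S.tile (c + u * S.d k) (u * A.w k) ∈ S.pull 𝒯) :
    ∃ c u, ‖u‖ = 1 ∧ 𝒯 = A.planeTiling c u := by
  obtain ⟨X, hX, -⟩ := (M.isTiling_pull h).cover 0
  obtain ⟨c, u, hu, rfl⟩ := (M.isTiling_pull h).tiles X hX
  exact ⟨c, u, hu, eq_planeTiling M hN h hnb hu hX⟩

lemma areCongruent_planeTiling (hu : ‖u‖ = 1) (hu' : ‖u'‖ = 1) :
    AreCongruent (A.planeTiling c u) (A.planeTiling c' u') := by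
  have hn : ‖u' * conj u‖ = 1 := by rw [norm_mul, RCLike.norm_conj, hu, hu', one_mul]
  set m : Circle := ⟨u' * conj u, by simp [Submonoid.unitSphere, hu, hu']⟩ with hm
  set g : Plane ≃ᵃⁱ[ℝ] Plane := ((toC.trans (rotation m)).trans toC.symm).toAffineIsometryEquiv.trans
    (AffineIsometryEquiv.constVAdd ℝ Plane (S.emb (c' - u' * conj u * c))) with hg
  have hgp : ∀ z, g (S.place c u z) = S.place c' u' z := by
    intro z
    have e : g (S.place c u z) = S.emb (c' - u' * conj u * c) +
      toC.symm (u' * conj u * toC (S.place c u z)) := rfl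
    apply toC.injective
    rw [e, map_add, toC.apply_symm_apply, Shape.place_apply, Shape.place_apply, Shape.toC_emb,
      Shape.toC_emb, Shape.toC_emb]
    linear_combination (S.scale * u' * z) * conj_mul_unit hu
  refine ⟨g, ?_⟩
  apply Subset.antisymm
  · rintro _ ⟨c₁, u₁, h₁, rfl⟩
    exact ⟨_, ⟨c₁, u₁, h₁, rfl⟩, by simp only [image_image, hgp]⟩
  · rintro _ ⟨_, ⟨c₁, u₁, h₁, rfl⟩, rfl⟩
    exact ⟨c₁, u₁, h₁, by simp only [image_image, hgp]⟩

/-- The tiling looks the same from each of its tiles, because the orbit is a group. -/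
lemma planeTiling_mul_subset (h : A.Orbit c' u') {T : Set Plane} (hT : T ∈ A.planeTiling c u) :
    T ∈ A.planeTiling (c + u * c') (u * u') := by
  obtain ⟨c₁, u₁, h₁, rfl⟩ := hT
  have hu' := h.norm_eq_one
  refine ⟨_, _, h.inv.mul h₁, ?_⟩
  have e : (S.place (c + u * c') (u * u') : ℂ → Plane)
      = S.place c u ∘ fun z => c' + u' * z := by
    funext z; exact S.place_mul c u c' u' z
  rw [e, image_comp]
  congr 1
  ext x
  obtain ⟨y, rfl⟩ := exists_eq_add_mul hu' c' x
  have hinj : Function.Injective (fun z => c' + u' * z) := by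
    intro a b hab
    exact mul_left_cancel₀ (by rintro rfl; simp at hu') (add_left_cancel hab)
  rw [hinj.mem_set_image (a := y), ← mem_tile_mul (c := c') (u := u') (z := y) hu']
  have e1 : c' + u' * (-(conj u' * c') + conj u' * c₁) = c₁ := by
    linear_combination (c₁ - c') * mul_conj_unit hu'
  have e2 : u' * (conj u' * u₁) = u₁ := by
    linear_combination u₁ * mul_conj_unit hu'
  rw [e1, e2]

lemma isEdgeToEdge_planeTiling (hN : A.Near) (hu : ‖u‖ = 1) : IsEdgeToEdge (A.planeTiling c u) := by
  intro P Q hP hQ hP𝒯 hQ𝒯 hne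
  obtain ⟨c₁, u₁, h₁, hP₁⟩ := hP𝒯
  obtain ⟨c₂, u₂, h₂, hQ₂⟩ := planeTiling_mul_subset h₁ hQ𝒯
  rw [Shape.image_place_tile hu h₁.norm_eq_one] at hP₁
  have hU : ‖u * u₁‖ = 1 := by rw [norm_mul, hu, h₁.norm_eq_one, one_mul]
  generalize c + u * c₁ = C at *
  generalize u * u₁ = U at *
  have hP₁' := hP₁.trans (Shape.image_place_tile_zero hU).symm
  have hQ₂' := hQ₂.trans (Shape.image_place_tile hU h₂.norm_eq_one)
  have hU₂ : ‖U * u₂‖ = 1 := by rw [norm_mul, hU, h₂.norm_eq_one, one_mul]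
  have hint : region P ∩ region Q = S.place C U '' (S.tile 0 1 ∩ S.tile c₂ u₂) := by
    rw [hP₁', hQ₂, image_inter (Shape.place_injective hU)]
  rw [hint]
  rcases h₂.inter_cases hN with ⟨rfl, rfl⟩ | h0 | ⟨k, rfl, rfl, h0⟩ | ⟨k, rfl, rfl, h0⟩
  · exact absurd (hP₁'.trans hQ₂.symm) hne
  · left; rw [h0, image_empty]
  · right; left
    obtain ⟨i, hi⟩ := Shape.exists_vertex_eq hU hP₁ k
    obtain ⟨j, hj⟩ := Shape.exists_vertex_eq hU₂ hQ₂' k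
    refine ⟨i, j, by rw [h0, image_singleton, hi], ?_⟩
    rw [hi, hj, Shape.place_mul]
    congr 1; ring
  · right; right
    obtain ⟨i, hi⟩ := Shape.exists_edge_eq hP hU hP₁ k
    obtain ⟨j, hj⟩ := Shape.exists_edge_eq hQ hU₂ hQ₂' (A.opp k)
    refine ⟨i, j, by rw [h0, hi], ?_⟩
    rw [hi, hj, image_segment, image_segment, Shape.place_mul, Shape.place_mul, A.glue, A.glue',
      segment_symm]

/-- A vertex closer to the incentre than the circumradius `R` lies in three tiles. -/
lemma isVertexOfDegree_three (hN : A.Near) (hu : ‖u‖ = 1) {k : Fin 5} (hk : ‖S.v k‖ < A.R) :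
    IsVertexOfDegree (A.planeTiling c u) (S.place c u (S.v k)) 3 := by
  have hb : A.Orbit 0 1 := Orbit.base
  have hv : S.v k ∈ S.tile 0 1 := by
    simpa using Shape.vertex_mem_tile (S := S) (c := 0) (u := 1) (by simp) k
  -- Such a centre has norm at most `2 * ‖S.v k‖ < 2 * A.R`, which excludes tiles that touch only at
  -- a vertex. Being equidistant from `0` and `S.d j` puts `S.v k` on the line of edge `j`, so `j`
  -- is `k` or `k - 1`.
  have hcase : ∀ c' u', A.Orbit c' u' → S.v k ∈ S.tile c' u' → (c' = 0 ∧ u' = 1) ∨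
      (c' = S.d k ∧ u' = A.w k) ∨ (c' = S.d (k - 1) ∧ u' = A.w (k - 1)) := by
    intro c' u' h hm
    have e1 := (hb.mem_tile_iff hN).1 hv _ _ h
    have e2 := (h.mem_tile_iff hN).1 hm _ _ hb
    rw [sub_zero] at e1 e2
    have htri : ‖c'‖ ≤ ‖S.v k‖ + ‖S.v k - c'‖ := by
      calc ‖c'‖ = ‖S.v k - (S.v k - c')‖ := by congr 1; ring
        _ ≤ _ := norm_sub_le _ _
    rcases hN _ _ h (by linarith) with h0 | ⟨j, rfl, rfl⟩ | ⟨j, -, -, h0⟩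
    · exact Or.inl h0
    · right
      have h1 := norm_sub_d_sq S j (S.v k)
      rw [le_antisymm e2 e1] at h1
      have h2 := (mul_eq_zero.1 (by linarith : 4 * S.rad * (cross (S.f j) (S.v k) + S.rad) = 0)
        ).resolve_left (by linarith [S.rad_pos])
      by_cases hj : k = j
      · left; rw [hj]; exact ⟨rfl, rfl⟩
      · by_cases hj' : k = j + 1
        · right; rw [hj', add_sub_cancel_right]; exact ⟨rfl, rfl⟩
        · have := S.conv j k hj hj'
          linarith
    · linarith
  have g₁ : S.d k + A.w k * S.v (A.opp k + 1) = S.v k := A.glue' k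
  have g₂ : S.d (k - 1) + A.w (k - 1) * S.v (A.opp (k - 1)) = S.v k := by
    rw [A.glue, sub_add_cancel]
  have m₁ : S.v k ∈ S.tile (S.d k) (A.w k) := by
    have := Shape.vertex_mem_tile (S := S) (c := S.d k) (A.norm_w k) (A.opp k + 1)
    rwa [g₁] at this
  have m₂ : S.v k ∈ S.tile (S.d (k - 1)) (A.w (k - 1)) := by
    have := Shape.vertex_mem_tile (S := S) (c := S.d (k - 1)) (A.norm_w (k - 1)) (A.opp (k - 1))
    rwa [g₂] at this
  have hinj := Shape.place_injective (S := S) (c := c) hu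
  have hne : ∀ {c₁ u₁ c₂ u₂}, A.Orbit c₁ u₁ → A.Orbit c₂ u₂ → c₁ ≠ c₂ →
      S.place c u '' S.tile c₁ u₁ ≠ S.place c u '' S.tile c₂ u₂ := by
    intro c₁ u₁ c₂ u₂ h₁ h₂ hne h
    have h3 := hinj.image_injective h
    have h4 : c₁ ∈ S.tile c₁ u₁ := interior_subset
      (Shape.ball_subset_interior_tile h₁.norm_eq_one (Metric.mem_ball_self S.rad_pos))
    rw [h3, h₂.mem_tile_iff hN] at h4
    have h5 := h4 _ _ h₁
    rw [sub_self, norm_zero] at h5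
    exact hne (sub_eq_zero.1 (norm_le_zero_iff.1 h5))
  have hd0 : ∀ j, (0 : ℂ) ≠ S.d j := by
    intro j h
    have := norm_d S j
    rw [← h, norm_zero] at this
    linarith [S.rad_pos]
  have hdd : S.d k ≠ S.d (k - 1) := by
    intro h
    have hr : (S.rad : ℂ) ≠ 0 := by exact_mod_cast S.rad_pos.ne'
    have h1 : S.f k = S.f (k - 1) := by
      simp only [Shape.d] at h
      have : (2 * S.rad * I) * S.f k = (2 * S.rad * I) * S.f (k - 1) := by linear_combination -h
      exact mul_left_cancel₀ (by simp [hr, I_ne_zero]) this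
    have h2 := S.turn' k
    rw [h1, cross_self] at h2
    exact lt_irrefl _ h2
  refine ⟨?_, ?_⟩
  · have o₁ := A.orbit_neighbour k
    have o₂ := A.orbit_neighbour (k - 1)
    rw [Nat.cast_ofNat, encard_eq_three]
    refine ⟨S.place c u '' S.tile 0 1, S.place c u '' S.tile (S.d k) (A.w k),
      S.place c u '' S.tile (S.d (k - 1)) (A.w (k - 1)), hne hb o₁ (hd0 k), hne hb o₂ (hd0 _),
      hne o₁ o₂ hdd, ?_⟩
    apply Subset.antisymm
    · rintro _ ⟨⟨c', u', h, rfl⟩, hm⟩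
      rw [hinj.mem_set_image] at hm
      rcases hcase _ _ h hm with ⟨rfl, rfl⟩ | ⟨rfl, rfl⟩ | ⟨rfl, rfl⟩ <;> simp
    · rintro _ (rfl | rfl | rfl)
      · exact ⟨⟨_, _, hb, rfl⟩, mem_image_of_mem _ hv⟩
      · exact ⟨⟨_, _, o₁, rfl⟩, mem_image_of_mem _ m₁⟩
      · exact ⟨⟨_, _, o₂, rfl⟩, mem_image_of_mem _ m₂⟩
  · rintro P - ⟨c', u', h, hP⟩ hm
    rw [hP, hinj.mem_set_image] at hm
    have hu' := h.norm_eq_one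
    rw [Shape.image_place_tile hu hu'] at hP
    have huu : ‖u * u'‖ = 1 := by rw [norm_mul, hu, hu', one_mul]
    have hj : ∃ j, c' + u' * S.v j = S.v k := by
      rcases hcase _ _ h hm with ⟨rfl, rfl⟩ | ⟨rfl, rfl⟩ | ⟨rfl, rfl⟩
      · exact ⟨k, by ring⟩
      · exact ⟨_, g₁⟩
      · exact ⟨_, g₂⟩
    obtain ⟨j, hj⟩ := hj
    obtain ⟨i, hi⟩ := Shape.exists_vertex_eq huu hP j
    exact ⟨i, by rw [hi, Shape.place_mul, hj]⟩

end Adjacency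

end PentagonTiling

namespace PentagonTiling

open Complex Filter Topology Set
open scoped ComplexConjugate

/-! ### The Cairo and the Prismatic tiling -/

lemma cos_two_pi_div_three : Real.cos (2 * Real.pi / 3) = -1 / 2 := by
  rw [show 2 * Real.pi / 3 = Real.pi - Real.pi / 3 by ring, Real.cos_pi_sub, Real.cos_pi_div_three]
  norm_num

/-- The Cairo pentagon has the angles required of Cairo pentagons. -/
noncomputable def cairoModel : cairo.Model
    ![2 * Real.pi / 3, 2 * Real.pi / 3, Real.pi / 2, 2 * Real.pi / 3, Real.pi / 2] where
  re_q := by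
    rw [cairo_q]
    refine forall_fin_five ?_ ?_ ?_ ?_ ?_ <;> simp [om, cos_two_pi_div_three]
  nonneg := by
    refine forall_fin_five ?_ ?_ ?_ ?_ ?_ <;> simp <;> positivity
  le_pi := by
    refine forall_fin_five ?_ ?_ ?_ ?_ ?_ <;> simp <;> linarith [Real.pi_pos]
  flip := ![1, 0, 4, 3, 2]
  flip_flip := by decide
  conj_v := by
    refine forall_fin_five ?_ ?_ ?_ ?_ ?_ <;> apply Complex.ext <;> simp [cairo, cairoV] <;> ring
  foot := ![1, 1, √3, 1, √3]
  foot_nonneg := by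
    refine forall_fin_five ?_ ?_ ?_ ?_ ?_ <;> simp
  foot_le := by
    have := one_lt_sqrt_three
    refine forall_fin_five ?_ ?_ ?_ ?_ ?_ <;> simp [cairo_len]
  foot_eq := by
    have := sqrt_three_sq
    refine forall_fin_five ?_ ?_ ?_ ?_ ?_ <;> apply Complex.ext <;>
      simp [cairo, cairoV, cairoF] <;> nlinarith

/-- The Prismatic pentagon has the angles required of Prismatic pentagons. -/
noncomputable def prismModel : prism.Model
    ![2 * Real.pi / 3, 2 * Real.pi / 3, 2 * Real.pi / 3, Real.pi / 2, Real.pi / 2] where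
  re_q := by
    rw [prism_q]
    refine forall_fin_five ?_ ?_ ?_ ?_ ?_ <;> simp [om, cos_two_pi_div_three]
  nonneg := by
    refine forall_fin_five ?_ ?_ ?_ ?_ ?_ <;> simp <;> positivity
  le_pi := by
    refine forall_fin_five ?_ ?_ ?_ ?_ ?_ <;> simp <;> linarith [Real.pi_pos]
  flip := ![2, 1, 0, 4, 3]
  flip_flip := by decide
  conj_v := by
    refine forall_fin_five ?_ ?_ ?_ ?_ ?_ <;> apply Complex.ext <;> simp [prism, prismV]
  foot := ![1, 1, 1, √3, √3]
  foot_nonneg := by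
    refine forall_fin_five ?_ ?_ ?_ ?_ ?_ <;> simp
  foot_le := by
    have := one_lt_sqrt_three
    refine forall_fin_five ?_ ?_ ?_ ?_ ?_ <;> simp [prism_len]
  foot_eq := by
    have := sqrt_three_sq
    refine forall_fin_five ?_ ?_ ?_ ?_ ?_ <;> apply Complex.ext <;>
      simp [prism, prismV, prismF] <;> nlinarith

variable {𝒯 𝒯' : Set (Set Plane)}

lemma cairo_eq_planeTiling (h : IsTilingBy IsCairo 𝒯) {c u : ℂ} (hu : ‖u‖ = 1)
    (hX : cairo.emb '' cairo.tile c u ∈ 𝒯) : 𝒯 = cairoAdj.planeTiling c u :=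
  Adjacency.eq_planeTiling cairoModel cairo_near h
    (fun _ _ hu hX k => cairo_neighbour (cairoModel.isTiling_pull h) hu hX k) hu hX

lemma cairo_exists_eq_planeTiling (h : IsTilingBy IsCairo 𝒯) :
    ∃ c u, ‖u‖ = 1 ∧ 𝒯 = cairoAdj.planeTiling c u :=
  Adjacency.exists_eq_planeTiling cairoModel cairo_near h
    (fun _ _ hu hX k => cairo_neighbour (cairoModel.isTiling_pull h) hu hX k)

lemma prism_exists_eq_planeTiling (h : IsTilingBy IsPrismatic 𝒯) (he : IsEdgeToEdge 𝒯) :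
    ∃ c u, ‖u‖ = 1 ∧ 𝒯 = prismAdj.planeTiling c u :=
  Adjacency.exists_eq_planeTiling prismModel prism_near h
    (fun _ _ hu hX k => prism_neighbour (prismModel.isTiling_pull h)
      (Shape.vertexCond_pull he) hu hX k)

/-- The ends of the short edge have squared distance `4` from the incentre, and `cairoAdj.R ^ 2 =
6`. -/
lemma cairo_norm_v_lt {k : Fin 5} (hk : k = 0 ∨ k = 1) : ‖cairo.v k‖ < cairoAdj.R := by
  have : ‖cairo.v k‖ ≤ √4 := by
    rcases hk with rfl | rfl <;> apply norm_le_sqrt <;> simp [cairo, cairoV] <;>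
      nlinarith [sqrt_three_sq]
  exact this.trans_lt (Real.sqrt_lt_sqrt (by norm_num) (by norm_num))

lemma dist_place_v {S : Shape} {c u : ℂ} (hu : ‖u‖ = 1) (k : Fin 5) :
    dist (S.place c u (S.v k)) (S.place c u (S.v (k + 1))) = S.scale * S.len k := by
  rw [Shape.place_apply, Shape.place_apply, dist_comm, dist_eq_norm, ← map_sub, Shape.norm_emb,
    S.v_succ, show c + u * (S.v k + S.len k * S.f k) - (c + u * S.v k) = u * (S.len k * S.f k) by
    ring, norm_mul, norm_mul, hu, S.norm_f, norm_real, Real.norm_of_nonneg (S.len_pos k).le]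
  ring

lemma IsCairo.exists_place {P : Pentagon} (h : IsCairo P) : ∃ c u, ‖u‖ = 1 ∧
    region P = cairo.emb '' cairo.tile c u ∧ IsShortEdge P 0 ∧
    (∃ k, (k = 0 ∨ k = 1) ∧ P 0 = cairo.place c u (cairo.v k)) ∧
    (∃ k, (k = 0 ∨ k = 1) ∧ P 1 = cairo.place c u (cairo.v k)) := by
  obtain ⟨c, u, hu, hr, hP⟩ := cairoModel.exists_place h
  have hlen : ∀ j : Fin 5, j ≠ 0 → cairo.len 0 < cairo.len j := by
    have := one_lt_sqrt_three
    refine forall_fin_five ?_ ?_ ?_ ?_ ?_ <;> simp [cairo_len] <;> linarith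
  have hs := cairo.scale_pos
  refine ⟨c, u, hu, hr, ?_, ?_⟩
  · rcases hP with hP | hP
    · intro j hj
      rw [edgeLength, edgeLength, finRotate_eq, finRotate_eq, hP, hP, hP, hP, dist_place_v hu,
        dist_place_v hu]
      exact mul_lt_mul_of_pos_left (hlen j hj) hs
    -- The symmetry reverses the edges: edge `j` of `P` is edge `flip (j + 1)` of the model, and the
    -- short edge `0` is mapped to itself.
    · have hf : ∀ j : Fin 5, cairoModel.flip j = cairoModel.flip (j + 1) + 1 := by decide
      have hf0 : cairoModel.flip (0 + 1) = 0 := rfl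
      have hfj : ∀ j : Fin 5, j ≠ 0 → cairoModel.flip (j + 1) ≠ 0 := by decide
      intro j hj
      rw [edgeLength, edgeLength, finRotate_eq, finRotate_eq, hP, hP, hP, hP, hf 0, hf j,
        dist_comm, dist_place_v hu, dist_comm, dist_place_v hu, hf0]
      exact mul_lt_mul_of_pos_left (hlen _ (hfj j hj)) hs
  · rcases hP with hP | hP
    · exact ⟨⟨0, Or.inl rfl, hP 0⟩, ⟨1, Or.inr rfl, hP 1⟩⟩
    · exact ⟨⟨1, Or.inr rfl, hP 0⟩, ⟨0, Or.inl rfl, hP 1⟩⟩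

end PentagonTiling

open PentagonTiling
theorem proposition2p2 :
    ((∃ 𝒯, IsTilingBy IsCairo 𝒯) ∧
      (∀ 𝒯 𝒯', IsTilingBy IsCairo 𝒯 → IsTilingBy IsCairo 𝒯' → AreCongruent 𝒯 𝒯') ∧
      (∀ 𝒯, IsTilingBy IsCairo 𝒯 → IsEdgeToEdge 𝒯 ∧
        ∀ P : Pentagon, IsCairo P → region P ∈ 𝒯 → ∃ i, IsShortEdge P i ∧
          IsVertexOfDegree 𝒯 (P i) 3 ∧ IsVertexOfDegree 𝒯 (P (finRotate 5 i)) 3)) ∧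
    ((∃ 𝒯, IsTilingBy IsPrismatic 𝒯 ∧ IsEdgeToEdge 𝒯) ∧
      (∀ 𝒯 𝒯', IsTilingBy IsPrismatic 𝒯 → IsEdgeToEdge 𝒯 →
        IsTilingBy IsPrismatic 𝒯' → IsEdgeToEdge 𝒯' → AreCongruent 𝒯 𝒯')) := by
  have h1 : ‖(1 : ℂ)‖ = 1 := norm_one
  refine ⟨⟨⟨cairoAdj.planeTiling 0 1, Adjacency.isTilingBy_planeTiling cairoModel cairo_near h1⟩,
    ?_, ?_⟩, ⟨prismAdj.planeTiling 0 1, Adjacency.isTilingBy_planeTiling prismModel prism_near h1,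
      Adjacency.isEdgeToEdge_planeTiling prism_near h1⟩, ?_⟩
  · intro 𝒯 𝒯' h h'
    obtain ⟨c, u, hu, rfl⟩ := cairo_exists_eq_planeTiling h
    obtain ⟨c', u', hu', rfl⟩ := cairo_exists_eq_planeTiling h'
    exact Adjacency.areCongruent_planeTiling hu hu'
  · intro 𝒯 h
    constructor
    · obtain ⟨c, u, hu, rfl⟩ := cairo_exists_eq_planeTiling h
      exact Adjacency.isEdgeToEdge_planeTiling cairo_near hu
    · intro P hP hP𝒯
      obtain ⟨c, u, hu, hr, hs, ⟨k, hk, h0⟩, ⟨k', hk', h0'⟩⟩ := hP.exists_place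
      rw [hr] at hP𝒯
      obtain rfl := cairo_eq_planeTiling h hu hP𝒯
      refine ⟨0, hs, ?_, ?_⟩
      · rw [h0]
        exact Adjacency.isVertexOfDegree_three cairo_near hu (cairo_norm_v_lt hk)
      · rw [finRotate_eq, zero_add, h0']
        exact Adjacency.isVertexOfDegree_three cairo_near hu (cairo_norm_v_lt hk')
  · intro 𝒯 𝒯' h he h' he'
    obtain ⟨c, u, hu, rfl⟩ := prism_exists_eq_planeTiling h he
    obtain ⟨c', u', hu', rfl⟩ := prism_exists_eq_planeTiling h' he'
    exact Adjacency.areCongruent_planeTiling hu hu'
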